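/- All graphs are finite, simple and undirected. For a graph $G$ on $n$ vertices let $A(G)$ be its adjacency matrix, $D(G)$ the diagonal matrix of its vertex degrees, and $Q(G)=D(G)+A(G)$ its signless Laplacian matrix. The permanent of an $n\times n$ matrix $X=(x_{ij})$ is $\operatorname{per}(X)=\sum_{\sigma}\prod_{i=1}^{n}x_{i\sigma(i)}$, the sum running over all permutations $\sigma$ of $\{1,\dots,n\}$, and the signless Laplacian permanental polynomial of $G$ is $\pi(Q(G);x)=\operatorname{per}(xI-Q(G))$. For integers $p\ge 3$, $q\ge 3$ and $r\ge 2$, let $d(p,q,r)$ be the graph on $p+q+r-2$ vertices obtained from disjoint cycles $C_p$, $C_q$ and a path $P_r$ on $r$ vertices by identifying a vertex of $C_p$ with one end vertex of $P_r$ and a vertex of $C_q$ with the other end vertex of $P_r$. **Theorem 1.3.** For all integers $p\ge 3$, $q\ge 3$, $r\ge 2$, the graph $d(p,q,r)$ is determined by its signless Laplacian permanental polynomial: if $G$ is any graph with $\pi(Q(G);x)=\pi(Q(d(p,q,r));x)$, then $G$ is isomorphic to $d(p,q,r)$. -/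

import Mathlib

open Polynomial

/-- The permanental polynomial `per (x I - M)` of a square integer matrix `M`. -/
noncomputable def Matrix.permPoly {V : Type*} [Fintype V] [DecidableEq V]
    (M : Matrix V V ℤ) : ℤ[X] :=
  (Matrix.scalar V (X : ℤ[X]) - M.map C).permanent

namespace SimpleGraph

/-- The signless Laplacian matrix `Q(G) = D(G) + A(G)`. -/
def signlessLapMatrix {V : Type*} [Fintype V] [DecidableEq V] (G : SimpleGraph V)
    [DecidableRel G.Adj] : Matrix V V ℤ :=
  G.degMatrix ℤ + G.adjMatrix ℤ

/-- The signless Laplacian permanental polynomial `per (x I - Q(G))`. -/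
noncomputable def signlessLapPermPoly {V : Type*} [Fintype V] [DecidableEq V]
    (G : SimpleGraph V) [DecidableRel G.Adj] : ℤ[X] :=
  G.signlessLapMatrix.permPoly

/-- The translation `i ↦ a + i` as an embedding of `Fin m` into `Fin n`, for `a + m ≤ n`. -/
def shiftEmb (a m n : ℕ) (h : a + m ≤ n) : Fin m ↪ Fin n where
  toFun i := ⟨a + i.val, by omega⟩
  inj' i j hij := by
    simp only [Fin.mk.injEq] at hij
    exact Fin.ext (by omega)

/-- The bicyclic graph `d(p, q, r)`: the cycles `C_p` and `C_q` are identified, at one vertex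
each, with the two different end vertices of the path `P_r` on `r` vertices. It has
`p + q + r - 2` vertices. The copy of `C_p` lives on `0, …, p - 1`, the copy of `P_r` on
`p - 1, …, p + r - 2`, and the copy of `C_q` on `p + r - 2, …, p + q + r - 3`; consecutive copies
share exactly one vertex, namely `p - 1` and `p + r - 2` (the end vertices of the path). -/
def dGraph (p q r : ℕ) (hp : 3 ≤ p) (hq : 3 ≤ q) (hr : 2 ≤ r) :
    SimpleGraph (Fin (p + q + r - 2)) :=
  (cycleGraph p).map (shiftEmb 0 p _ (by omega)) ⊔
    (pathGraph r).map (shiftEmb (p - 1) r _ (by omega)) ⊔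
    (cycleGraph q).map (shiftEmb (p + r - 2) q _ (by omega))

noncomputable instance (p q r : ℕ) (hp : 3 ≤ p) (hq : 3 ≤ q) (hr : 2 ≤ r) :
    DecidableRel (dGraph p q r hp hq hr).Adj :=
  Classical.decRel _

end SimpleGraph

/-! The reversed polynomial `per(I - XQ)` has constant term 1, and its next two coefficients give
the sum of the degrees and the sum of their squares (`degree_sums_eq`). For `d(p,q,r)` this says
that `d - 2` and `(d - 2)²` both sum to 2 over the vertices. As `t² - t ≥ 0` for integers, a graph
`G` with the same polynomial has two vertices of degree 3 and all others of degree 2. A longest path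
argument (`exists_isChordedComp`) then shows that `G` consists of disjoint cycles and one core,
which is a path `0, …, n - 1` with two chords `{0, j}` and `{i, n - 1}`. The core is a dumbbell if
`j < i` and a theta graph (two vertices joined by three paths) if `i < j`.

With `y = x - 2` the permanent of a path satisfies a recurrence with characteristic roots `s` and
`-1/s`, where `y = s - 1/s`. In the variable `s`, multiplied by `(-s)^n (1 + s²)³`, the polynomial
of `G` becomes `dumbbellForm` or `thetaForm` of the core times one `cycleForm` for each extra cycle.
It has to be shown that `dumbbellForm X p q r` arises in this way only from `d(p,q,r)`.

Two tools do this. The first is the expansion at `s = 0` just past the order `m` of the shortest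
cycle. Up to a fixed part and path terms with odd coefficients, which must cancel on their own, a
cycle of length `k` contributes `2X^k` times `1 + X` in a dumbbell, times `1` in a theta graph and
times `1 + 2X` as an extra component. Hence the coefficients of `X^m` and `X^(m+1)` tell these kinds
apart. The second is divisibility. The values at `s = ±1` show that an extra cycle forces `p` and
`q` to be even; the roots of `cycleForm` in `(-1, 0)` and on the unit circle then show that the
length of each extra cycle is even and divides both `p` and `q` (`dvd_of_form_eq`).

Together they leave no extra cycles beside a dumbbell (`dumbbell_of_dumbbellForm_eq`). They exclude
theta cores (`dumbbellForm_ne_thetaForm_mul`) up to the single candidate made of a theta graph with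
paths of lengths `a`, `a`, `c` and a cycle of length `2a`, which is refuted by evaluation at `s = 2`
or `s = 1`. -/

theorem apply_mem_iff_of_mapsTo {α : Type*} {A : Finset α} {σ : Equiv.Perm α}
    (h : ∀ x ∈ A, σ x ∈ A) (x : α) : σ x ∈ A ↔ x ∈ A := by
  refine ⟨fun hx => ?_, h x⟩
  have : A.map σ.toEmbedding = A := by
    apply Finset.eq_of_subset_of_card_le
    · intro y hy
      obtain ⟨z, hz, rfl⟩ := Finset.mem_map.1 hy
      exact h z hz
    · simp
  rw [← this] at hx
  obtain ⟨z, hz, hzx⟩ := Finset.mem_map.1 hx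
  rwa [← σ.injective hzx]

theorem ne_zero_of_prod_ne_zero {α R : Type*} [CommRing R] {M : α → α → R} {S : Finset α} {σ : Equiv.Perm α}
    (h : ∏ x ∈ S, M x (σ x) ≠ 0) {x : α} (hx : x ∈ S) : M x (σ x) ≠ 0 :=
  fun h0 => h (Finset.prod_eq_zero hx h0)

/-! ### Permanents of principal submatrices: cut vertices, expansion at a vertex, cycles through a
vertex. -/

section PerOn

variable {α R : Type*} [DecidableEq α] [CommRing R]

/-- The permanent of the principal submatrix of `M` indexed by `S`. -/
def perOn (M : α → α → R) (S : Finset α) : R :=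
  ∑ σ ∈ permsOfFinset S, ∏ x ∈ S, M x (σ x)

theorem mem_permsOfFinset {S : Finset α} {σ : Equiv.Perm α} :
    σ ∈ permsOfFinset S ↔ ∀ x ∉ S, σ x = x := by
  rw [mem_perms_of_finset_iff]
  constructor
  · intro h x hx
    by_contra hne
    exact hx (h hne)
  · intro h x hx
    by_contra hne
    exact hx (h x hne)

theorem apply_mem_of_mem_permsOfFinset {S : Finset α} {σ : Equiv.Perm α}
    (hσ : σ ∈ permsOfFinset S) {x : α} (hx : x ∈ S) : σ x ∈ S := by
  by_contra h
  have h1 := mem_permsOfFinset.1 hσ _ h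
  exact h ((σ.injective h1).symm ▸ hx)

theorem inv_mem_permsOfFinset {S : Finset α} {σ : Equiv.Perm α}
    (hσ : σ ∈ permsOfFinset S) : σ⁻¹ ∈ permsOfFinset S := by
  rw [mem_permsOfFinset] at hσ ⊢
  intro x hx
  rw [Equiv.Perm.inv_eq_iff_eq, hσ x hx]

/-- A permutation that agrees with `τ` on `K` is `τ` times a permutation of `S \ K`. -/
theorem sum_perms_agree (M : α → α → R) {K S : Finset α} (hKS : K ⊆ S) {τ : Equiv.Perm α}
    (hτ : τ ∈ permsOfFinset K) :
    ∑ σ ∈ (permsOfFinset S).filter (fun σ => ∀ x ∈ K, σ x = τ x), ∏ x ∈ S, M x (σ x)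
      = (∏ x ∈ K, M x (τ x)) * perOn M (S \ K) := by
  rw [perOn, Finset.mul_sum]
  refine Finset.sum_nbij' (fun σ => τ⁻¹ * σ) (fun ρ => τ * ρ) ?_ ?_ ?_ ?_ ?_
  · intro σ hσ
    rw [Finset.mem_filter] at hσ
    rw [mem_permsOfFinset]
    intro x hx
    rw [Equiv.Perm.mul_apply, Equiv.Perm.inv_eq_iff_eq]
    by_cases hxK : x ∈ K
    · exact hσ.2 x hxK
    · have hxS : x ∉ S := fun h => hx (Finset.mem_sdiff.2 ⟨h, hxK⟩)
      rw [mem_permsOfFinset.1 hσ.1 x hxS, mem_permsOfFinset.1 hτ x hxK]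
  · intro ρ hρ
    rw [mem_permsOfFinset] at hρ
    rw [Finset.mem_filter, mem_permsOfFinset]
    constructor
    · intro x hx
      rw [Equiv.Perm.mul_apply, hρ x (fun h => hx (Finset.mem_sdiff.1 h).1),
        mem_permsOfFinset.1 hτ x (fun h => hx (hKS h))]
    · intro x hx
      rw [Equiv.Perm.mul_apply, hρ x (fun h => (Finset.mem_sdiff.1 h).2 hx)]
  · intro σ _
    simp
  · intro σ _
    simp
  · intro σ hσ
    rw [Finset.mem_filter] at hσ
    rw [← Finset.prod_sdiff hKS, mul_comm]
    congr 1
    · exact Finset.prod_congr rfl fun x hx => by rw [hσ.2 x hx]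
    · refine Finset.prod_congr rfl fun x hx => ?_
      have hxK := (Finset.mem_sdiff.1 hx).2
      have hiff : ∀ y, σ y ∈ K ↔ y ∈ K := apply_mem_iff_of_mapsTo fun y hy => by
        rw [hσ.2 y hy]; exact apply_mem_of_mem_permsOfFinset hτ hy
      have h1 : τ⁻¹ (σ x) = σ x :=
        mem_permsOfFinset.1 (inv_mem_permsOfFinset hτ) _ (fun h => hxK ((hiff x).1 h))
      rw [Equiv.Perm.mul_apply, h1]

theorem sum_perms_mapsTo (M : α → α → R) {A S : Finset α} (hAS : A ⊆ S) :
    ∑ σ ∈ (permsOfFinset S).filter (fun σ => ∀ x ∈ A, σ x ∈ A), ∏ x ∈ S, M x (σ x)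
      = perOn M A * perOn M (S \ A) := by
  classical
  -- `g σ` is the restriction of `σ` to `A`, extended by the identity; the sum is grouped by its
  -- value. The value `1` for other `σ` is never used.
  let g : Equiv.Perm α → Equiv.Perm α := fun σ =>
    if h : ∀ x, σ x ∈ A ↔ x ∈ A then Equiv.Perm.ofSubtype (σ.subtypePerm h) else 1
  have hg : ∀ σ : Equiv.Perm α, (∀ x ∈ A, σ x ∈ A) → ∀ x ∈ A, g σ x = σ x := by
    intro σ hσ x hx
    have h := apply_mem_iff_of_mapsTo hσ
    simp only [g, dif_pos h]
    rw [Equiv.Perm.ofSubtype_apply_of_mem _ hx]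
    rfl
  have hg' : ∀ σ : Equiv.Perm α, g σ ∈ permsOfFinset A := by
    intro σ
    rw [mem_permsOfFinset]
    intro x hx
    by_cases h : ∀ x, σ x ∈ A ↔ x ∈ A
    · simp only [g, dif_pos h]
      exact Equiv.Perm.ofSubtype_apply_of_not_mem _ hx
    · simp only [g, dif_neg h, Equiv.Perm.one_apply]
  rw [← Finset.sum_fiberwise_of_maps_to (t := permsOfFinset A) (g := g) (fun σ _ => hg' σ)]
  conv_rhs => rw [perOn, Finset.sum_mul]
  refine Finset.sum_congr rfl fun τ hτ => ?_
  rw [← sum_perms_agree M hAS hτ]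
  refine Finset.sum_congr ?_ fun _ _ => rfl
  ext σ
  simp only [Finset.mem_filter]
  constructor
  · rintro ⟨⟨h1, h2⟩, rfl⟩
    exact ⟨h1, fun x hx => (hg σ h2 x hx).symm⟩
  · rintro ⟨h1, h2⟩
    have h3 : ∀ x ∈ A, σ x ∈ A := fun x hx => by
      rw [h2 x hx]; exact apply_mem_of_mem_permsOfFinset hτ hx
    refine ⟨⟨h1, h3⟩, ?_⟩
    ext x
    by_cases hx : x ∈ A
    · rw [hg σ h3 x hx, h2 x hx]
    · rw [mem_permsOfFinset.1 (hg' σ) x hx, mem_permsOfFinset.1 hτ x hx]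

theorem perOn_empty (M : α → α → R) : perOn M ∅ = 1 := by
  have : permsOfFinset (∅ : Finset α) = {1} := by
    ext σ
    rw [mem_permsOfFinset, Finset.mem_singleton, Equiv.ext_iff]
    simp
  rw [perOn, this]
  simp

theorem perOn_singleton (M : α → α → R) (v : α) : perOn M {v} = M v v := by
  have : permsOfFinset ({v} : Finset α) = {1} := by
    ext σ
    rw [Finset.mem_singleton]
    constructor
    · intro h
      ext x
      by_cases hx : x ∈ ({v} : Finset α)
      · have := apply_mem_of_mem_permsOfFinset h hx
        rw [Finset.mem_singleton] at hx this
        rw [this, hx]; rfl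
      · exact mem_permsOfFinset.1 h x hx
    · rintro rfl
      exact mem_permsOfFinset.2 fun _ _ => rfl
  rw [perOn, this]
  simp

theorem perOn_congr {M M' : α → α → R} {S : Finset α}
    (h : ∀ x ∈ S, ∀ y ∈ S, M x y = M' x y) : perOn M S = perOn M' S :=
  Finset.sum_congr rfl fun _ hσ => Finset.prod_congr rfl fun x hx =>
    h x hx _ (apply_mem_of_mem_permsOfFinset hσ hx)

theorem perOn_union (M : α → α → R) {A B : Finset α} (hAB : Disjoint A B)
    (h : ∀ a ∈ A, ∀ b ∈ B, M a b = 0) : perOn M (A ∪ B) = perOn M A * perOn M B := by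
  have h1 := sum_perms_mapsTo M (A := A) (S := A ∪ B) Finset.subset_union_left
  rw [Finset.union_sdiff_cancel_left hAB] at h1
  rw [← h1, perOn, Finset.sum_filter_of_ne]
  intro σ hσ hne x hx
  have hxS : x ∈ A ∪ B := Finset.mem_union_left _ hx
  rcases Finset.mem_union.1 (apply_mem_of_mem_permsOfFinset hσ hxS) with h2 | h2
  · exact h2
  · exact absurd (h x hx _ h2) (ne_zero_of_prod_ne_zero hne hxS)

/-- The permanent of a graph with a cut vertex `v`. -/
theorem perOn_glue (M : α → α → R) {v : α} {A B : Finset α} (hAB : Disjoint A B)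
    (hvA : v ∉ A) (hvB : v ∉ B)
    (h : ∀ a ∈ A, ∀ b ∈ B, M a b = 0) (h' : ∀ a ∈ A, ∀ b ∈ B, M b a = 0) :
    perOn M (insert v (A ∪ B)) = perOn M (insert v A) * perOn M B
      + perOn M A * perOn M (insert v B) - M v v * perOn M A * perOn M B := by
  set S := insert v (A ∪ B) with hS
  have memS : ∀ x, x ∈ S ↔ x = v ∨ x ∈ A ∨ x ∈ B := fun x => by
    rw [hS, Finset.mem_insert, Finset.mem_union]
  have hd := Finset.disjoint_left.1 hAB
  have hA := sum_perms_mapsTo M (A := A) (S := S) (fun x hx => (memS x).2 (Or.inr (Or.inl hx)))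
  have hB := sum_perms_mapsTo M (A := B) (S := S) (fun x hx => (memS x).2 (Or.inr (Or.inr hx)))
  have hC := sum_perms_mapsTo M (A := A ∪ B) (S := S) (Finset.subset_insert _ _)
  have e1 : S \ A = insert v B := by
    ext x; rw [Finset.mem_sdiff, memS, Finset.mem_insert]
    constructor
    · tauto
    · rintro (rfl | h)
      · tauto
      · exact ⟨Or.inr (Or.inr h), fun hx => hd hx h⟩
  have e2 : S \ B = insert v A := by
    ext x; rw [Finset.mem_sdiff, memS, Finset.mem_insert]
    constructor
    · tauto
    · rintro (rfl | h)
      · tauto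
      · exact ⟨Or.inr (Or.inl h), fun hx => hd h hx⟩
  have e3 : S \ (A ∪ B) = {v} := by
    ext x; rw [Finset.mem_sdiff, memS, Finset.mem_singleton, Finset.mem_union]
    constructor
    · tauto
    · rintro rfl; tauto
  rw [e1] at hA
  rw [e2] at hB
  rw [e3, perOn_union M hAB h, perOn_singleton] at hC
  rw [mul_comm (perOn M (insert v A)), mul_assoc, mul_comm (M v v), ← hA, ← hB, ← hC, perOn]
  simp only [Finset.sum_filter]
  rw [← Finset.sum_add_distrib, ← Finset.sum_sub_distrib]
  refine Finset.sum_congr rfl fun σ hσ => ?_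
  by_cases hne : ∏ x ∈ S, M x (σ x) = 0
  · rw [hne]; simp
  have key : ∀ x ∈ S, M x (σ x) ≠ 0 := fun x hx => ne_zero_of_prod_ne_zero hne hx
  have hAm : ∀ x ∈ A, σ x ∈ A ∨ σ x = v := by
    intro x hx
    have hxS := (memS x).2 (Or.inr (Or.inl hx))
    rcases (memS _).1 (apply_mem_of_mem_permsOfFinset hσ hxS) with h1 | h1 | h1
    · exact Or.inr h1
    · exact Or.inl h1
    · exact absurd (h x hx _ h1) (key x hxS)
  have hBm : ∀ x ∈ B, σ x ∈ B ∨ σ x = v := by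
    intro x hx
    have hxS := (memS x).2 (Or.inr (Or.inr hx))
    rcases (memS _).1 (apply_mem_of_mem_permsOfFinset hσ hxS) with h1 | h1 | h1
    · exact Or.inr h1
    · exact absurd (h' _ h1 x hx) (key x hxS)
    · exact Or.inl h1
  -- A contributing `σ` leaves `A` or `B` only through `v`, and only one point is sent to `v`. The
  -- formula is therefore inclusion-exclusion over "`σ` preserves `A`" and "`σ` preserves `B`".
  have hor : (∀ x ∈ A, σ x ∈ A) ∨ (∀ x ∈ B, σ x ∈ B) := by
    by_contra hcon
    push Not at hcon
    obtain ⟨⟨a, ha, ha'⟩, ⟨b, hb, hb'⟩⟩ := hcon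
    have h1 := (hAm a ha).resolve_left ha'
    have h2 := (hBm b hb).resolve_left hb'
    have : a = b := σ.injective (h1.trans h2.symm)
    exact hd ha (this ▸ hb)
  have hand : (∀ x ∈ A ∪ B, σ x ∈ A ∪ B) ↔ (∀ x ∈ A, σ x ∈ A) ∧ (∀ x ∈ B, σ x ∈ B) := by
    constructor
    · intro hx
      constructor
      · intro x hxA
        rcases hAm x hxA with h1 | h1
        · exact h1
        · have := hx x (Finset.mem_union_left _ hxA)
          rw [h1, Finset.mem_union] at this
          tauto
      · intro x hxB
        rcases hBm x hxB with h1 | h1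
        · exact h1
        · have := hx x (Finset.mem_union_right _ hxB)
          rw [h1, Finset.mem_union] at this
          tauto
    · rintro ⟨h1, h2⟩ x hx
      rcases Finset.mem_union.1 hx with h3 | h3
      · exact Finset.mem_union_left _ (h1 x h3)
      · exact Finset.mem_union_right _ (h2 x h3)
  simp only [hand]
  by_cases h1 : ∀ x ∈ A, σ x ∈ A <;> by_cases h2 : ∀ x ∈ B, σ x ∈ B
  · simp only [if_pos h1, if_pos h2, if_pos (And.intro h1 h2)]; ring
  · simp only [if_pos h1, if_neg h2, if_neg (fun h : _ ∧ _ => h2 h.2)]; ring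
  · simp only [if_neg h1, if_pos h2, if_neg (fun h : _ ∧ _ => h1 h.1)]; ring
  · tauto

/-- The part of the permanent on `S` given by the permutations with `b ↦ v ↦ a`. -/
def perThrough (M : α → α → R) (S : Finset α) (v a b : α) : R :=
  ∑ σ ∈ (permsOfFinset S).filter (fun σ => σ v = a ∧ σ b = v), ∏ x ∈ S, M x (σ x)

/-- Inverting the permutation reverses its cycle through `v`; symmetry of `M` keeps the product. -/
theorem perThrough_symm {M : α → α → R} (hM : ∀ x y, M x y = M y x) (S : Finset α) (v a b : α) :
    perThrough M S v a b = perThrough M S v b a := by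
  refine Finset.sum_nbij' (fun σ => σ⁻¹) (fun σ => σ⁻¹) ?_ ?_ ?_ ?_ ?_
  · intro σ hσ
    rw [Finset.mem_filter] at hσ ⊢
    refine ⟨inv_mem_permsOfFinset hσ.1, ?_, ?_⟩ <;> rw [Equiv.Perm.inv_eq_iff_eq]
    exacts [hσ.2.2.symm, hσ.2.1.symm]
  · intro σ hσ
    rw [Finset.mem_filter] at hσ ⊢
    refine ⟨inv_mem_permsOfFinset hσ.1, ?_, ?_⟩ <;> rw [Equiv.Perm.inv_eq_iff_eq]
    exacts [hσ.2.2.symm, hσ.2.1.symm]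
  · intro σ _; exact inv_inv σ
  · intro σ _; exact inv_inv σ
  · intro σ hσ
    rw [Finset.mem_filter] at hσ
    refine Finset.prod_nbij' (fun x => σ x) (fun x => σ⁻¹ x) ?_ ?_ ?_ ?_ ?_
    · exact fun x hx => apply_mem_of_mem_permsOfFinset hσ.1 hx
    · exact fun x hx => apply_mem_of_mem_permsOfFinset (inv_mem_permsOfFinset hσ.1) hx
    · intro x _; simp
    · intro x _; simp
    · intro x _; simp [hM x]

/-- Expansion of the permanent at the vertex `v`. -/
theorem perOn_insert (M : α → α → R) {v : α} {S : Finset α} (hv : v ∉ S) :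
    perOn M (insert v S) = M v v * perOn M S + ∑ w ∈ S, M v w * M w v * perOn M (S.erase w)
      + ∑ a ∈ S, ∑ b ∈ S.erase a, perThrough M (insert v S) v a b := by
  set T := insert v S with hT
  have hvT : v ∈ T := Finset.mem_insert_self _ _
  -- Sort the permutations by the image `a` and the preimage `b` of `v`: `a = b = v` is a fixed
  -- point, `a = b ≠ v` a transposition, `a ≠ b` a longer cycle.
  have h0 : perOn M T = ∑ a ∈ T, ∑ b ∈ T, perThrough M T v a b := by
    rw [perOn, ← Finset.sum_fiberwise_of_maps_to (t := T) (g := fun σ : Equiv.Perm α => σ v)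
      (fun σ hσ => apply_mem_of_mem_permsOfFinset hσ hvT)]
    refine Finset.sum_congr rfl fun a _ => ?_
    rw [← Finset.sum_fiberwise_of_maps_to (t := T) (g := fun σ : Equiv.Perm α => σ⁻¹ v)
      (fun σ hσ => apply_mem_of_mem_permsOfFinset
        (inv_mem_permsOfFinset (Finset.mem_filter.1 hσ).1) hvT)]
    refine Finset.sum_congr rfl fun b _ => ?_
    refine Finset.sum_congr ?_ fun _ _ => rfl
    ext σ
    simp only [Finset.mem_filter, and_assoc]
    rw [Equiv.Perm.inv_eq_iff_eq, eq_comm (a := v)]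
  have hvv : perThrough M T v v v = M v v * perOn M S := by
    have := sum_perms_agree M (K := {v}) (S := T) (by simpa using hvT)
      (mem_permsOfFinset.2 fun _ _ => rfl : (1 : Equiv.Perm α) ∈ permsOfFinset ({v} : Finset α))
    rw [show T \ {v} = S by rw [Finset.sdiff_singleton_eq_erase, hT, Finset.erase_insert hv]]
      at this
    simp only [Finset.prod_singleton, Equiv.Perm.one_apply] at this
    rw [← this, perThrough]
    refine Finset.sum_congr ?_ fun _ _ => rfl
    ext σ
    simp
  have hva : ∀ a ∈ S, perThrough M T v v a = 0 ∧ perThrough M T v a v = 0 := by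
    intro a ha
    have hne : a ≠ v := fun h => hv (h ▸ ha)
    constructor <;> refine Finset.sum_eq_zero fun σ hσ => ?_ <;> rw [Finset.mem_filter] at hσ
    · exact absurd (σ.injective (hσ.2.2.trans hσ.2.1.symm)) hne
    · exact absurd (hσ.2.1.symm.trans hσ.2.2) hne
  have haa : ∀ w ∈ S, perThrough M T v w w = M v w * M w v * perOn M (S.erase w) := by
    intro w hw
    have hne : v ≠ w := fun h => hv (h ▸ hw)
    have hτ : Equiv.swap v w ∈ permsOfFinset ({v, w} : Finset α) := by
      rw [mem_permsOfFinset]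
      intro x hx
      simp only [Finset.mem_insert, Finset.mem_singleton, not_or] at hx
      exact Equiv.swap_apply_of_ne_of_ne hx.1 hx.2
    have hsub : ({v, w} : Finset α) ⊆ T := by
      intro x hx
      simp only [Finset.mem_insert, Finset.mem_singleton] at hx
      rcases hx with rfl | rfl
      · exact hvT
      · exact Finset.mem_insert_of_mem hw
    have := sum_perms_agree M (S := T) hsub hτ
    rw [show T \ {v, w} = S.erase w by
      ext x
      simp only [hT, Finset.mem_sdiff, Finset.mem_insert, Finset.mem_singleton, Finset.mem_erase]
      constructor
      · tauto
      · rintro ⟨h1, h2⟩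
        refine ⟨Or.inr h2, ?_⟩
        rintro (h3 | h3)
        · exact hv (h3 ▸ h2)
        · exact h1 h3] at this
    rw [Finset.prod_pair hne, Equiv.swap_apply_left, Equiv.swap_apply_right] at this
    rw [← this, perThrough]
    refine Finset.sum_congr ?_ fun _ _ => rfl
    ext σ
    simp
  rw [h0, hT, Finset.sum_insert hv, Finset.sum_insert hv, ← hT, hvv,
    Finset.sum_eq_zero fun a ha => (hva a ha).1, add_zero, add_assoc]
  congr 1
  rw [← Finset.sum_add_distrib]
  refine Finset.sum_congr rfl fun a ha => ?_
  rw [Finset.sum_insert hv, (hva a ha).2, zero_add, ← Finset.add_sum_erase _ _ ha, haa a ha]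

theorem perThrough_eq_zero_left {M : α → α → R} {S : Finset α} {v a b : α} (hv : v ∈ S)
    (h : M v a = 0) : perThrough M S v a b = 0 := by
  refine Finset.sum_eq_zero fun σ hσ => Finset.prod_eq_zero hv ?_
  rw [(Finset.mem_filter.1 hσ).2.1, h]

theorem perThrough_eq_zero_right {M : α → α → R} {S : Finset α} {v a b : α} (hb : b ∈ S)
    (h : M b v = 0) : perThrough M S v a b = 0 := by
  refine Finset.sum_eq_zero fun σ hσ => Finset.prod_eq_zero hb ?_
  rw [(Finset.mem_filter.1 hσ).2.2, h]

theorem perOn_insert_leaf (M : α → α → R) (hM : ∀ x y, M x y = M y x) {v w : α} {S : Finset α}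
    (hv : v ∉ S) (hw : w ∈ S) (hN : ∀ x ∈ S, x ≠ w → M v x = 0) :
    perOn M (insert v S) = M v v * perOn M S + M v w * M w v * perOn M (S.erase w) := by
  rw [perOn_insert M hv, Finset.sum_eq_single_of_mem w hw (fun x hx hne => by
    rw [hN x hx hne]; ring)]
  rw [Finset.sum_eq_zero, add_zero]
  intro a ha
  refine Finset.sum_eq_zero fun b hb => ?_
  obtain ⟨hba, hbS⟩ := Finset.mem_erase.1 hb
  by_cases haw : a = w
  · refine perThrough_eq_zero_right (Finset.mem_insert_of_mem hbS) ?_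
    rw [hM]; exact hN b hbS (haw ▸ hba)
  · exact perThrough_eq_zero_left (Finset.mem_insert_self _ _) (hN a ha haw)

theorem perOn_insert_two (M : α → α → R) (hM : ∀ x y, M x y = M y x) {v a b : α} {S : Finset α}
    (hv : v ∉ S) (ha : a ∈ S) (hb : b ∈ S) (hab : a ≠ b)
    (hva : M v a = -1) (hvb : M v b = -1)
    (hN : ∀ x ∈ S, x ≠ a → x ≠ b → M v x = 0) :
    perOn M (insert v S) = M v v * perOn M S + perOn M (S.erase a) + perOn M (S.erase b)
      + 2 * perThrough M (insert v S) v a b := by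
  have hsub : ({a, b} : Finset α) ⊆ S := by
    intro x hx
    simp only [Finset.mem_insert, Finset.mem_singleton] at hx
    rcases hx with rfl | rfl <;> assumption
  have hN' : ∀ x ∈ S, x ∉ ({a, b} : Finset α) → M v x = 0 := fun x hx h => by
    simp only [Finset.mem_insert, Finset.mem_singleton, not_or] at h
    exact hN x hx h.1 h.2
  rw [perOn_insert M hv, ← Finset.sum_subset hsub (fun x hx h => by rw [hN' x hx h]; ring),
    Finset.sum_pair hab, hM a, hM b, hva, hvb]
  have hrow : ∀ c ∈ S, ∑ d ∈ S.erase c, perThrough M (insert v S) v c d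
      = ∑ d ∈ ({a, b} : Finset α).erase c, perThrough M (insert v S) v c d := by
    intro c hc
    rw [← Finset.sum_subset (Finset.erase_subset_erase c hsub)]
    intro x hx h
    have hxS := (Finset.mem_erase.1 hx).2
    refine perThrough_eq_zero_right (Finset.mem_insert_of_mem hxS) ?_
    rw [hM]
    exact hN' x hxS fun h' => h (Finset.mem_erase.2 ⟨(Finset.mem_erase.1 hx).1, h'⟩)
  rw [Finset.sum_congr rfl hrow, ← Finset.sum_subset hsub (fun x hx h => Finset.sum_eq_zero
    fun d _ => perThrough_eq_zero_left (Finset.mem_insert_self _ _) (hN' x hx h)),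
    Finset.sum_pair hab]
  have e1 : ({a, b} : Finset α).erase a = {b} := by
    ext x; simp only [Finset.mem_erase, Finset.mem_insert, Finset.mem_singleton]
    constructor
    · tauto
    · rintro rfl; exact ⟨hab.symm, Or.inr rfl⟩
  have e2 : ({a, b} : Finset α).erase b = {a} := by
    ext x; simp only [Finset.mem_erase, Finset.mem_insert, Finset.mem_singleton]
    constructor
    · tauto
    · rintro rfl; exact ⟨hab, Or.inl rfl⟩
  rw [e1, e2, Finset.sum_singleton, Finset.sum_singleton, perThrough_symm hM _ v b a]
  ring

theorem perOn_insert_three (M : α → α → R) (hM : ∀ x y, M x y = M y x) {v a b c : α}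
    {S : Finset α} (hv : v ∉ S) (ha : a ∈ S) (hb : b ∈ S) (hc : c ∈ S)
    (hab : a ≠ b) (hac : a ≠ c) (hbc : b ≠ c)
    (hva : M v a = -1) (hvb : M v b = -1) (hvc : M v c = -1)
    (hN : ∀ x ∈ S, x ≠ a → x ≠ b → x ≠ c → M v x = 0) :
    perOn M (insert v S) = M v v * perOn M S + perOn M (S.erase a) + perOn M (S.erase b)
      + perOn M (S.erase c) + 2 * perThrough M (insert v S) v a b
      + 2 * perThrough M (insert v S) v a c + 2 * perThrough M (insert v S) v b c := by
  have hsub : ({a, b, c} : Finset α) ⊆ S := by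
    intro x hx
    simp only [Finset.mem_insert, Finset.mem_singleton] at hx
    rcases hx with rfl | rfl | rfl <;> assumption
  have hN' : ∀ x ∈ S, x ∉ ({a, b, c} : Finset α) → M v x = 0 := fun x hx h => by
    simp only [Finset.mem_insert, Finset.mem_singleton, not_or] at h
    exact hN x hx h.1 h.2.1 h.2.2
  have hsum : ∀ f : α → R, ∑ x ∈ ({a, b, c} : Finset α), f x = f a + f b + f c := fun f => by
    rw [Finset.sum_insert (by simp [hab, hac]), Finset.sum_pair hbc, add_assoc]
  rw [perOn_insert M hv, ← Finset.sum_subset hsub (fun x hx h => by rw [hN' x hx h]; ring),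
    hsum, hM a, hM b, hM c, hva, hvb, hvc]
  have hrow : ∀ d ∈ S, ∑ e ∈ S.erase d, perThrough M (insert v S) v d e
      = ∑ e ∈ ({a, b, c} : Finset α).erase d, perThrough M (insert v S) v d e := by
    intro d hd
    rw [← Finset.sum_subset (Finset.erase_subset_erase d hsub)]
    intro x hx h
    have hxS := (Finset.mem_erase.1 hx).2
    refine perThrough_eq_zero_right (Finset.mem_insert_of_mem hxS) ?_
    rw [hM]
    exact hN' x hxS fun h' => h (Finset.mem_erase.2 ⟨(Finset.mem_erase.1 hx).1, h'⟩)
  rw [Finset.sum_congr rfl hrow, ← Finset.sum_subset hsub (fun x hx h => Finset.sum_eq_zero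
    fun d _ => perThrough_eq_zero_left (Finset.mem_insert_self _ _) (hN' x hx h)), hsum]
  have e1 : ({a, b, c} : Finset α).erase a = {b, c} := Finset.erase_insert (by simp [hab, hac])
  have e2 : ({a, b, c} : Finset α).erase b = {a, c} := by
    rw [Finset.insert_comm]; exact Finset.erase_insert (by simp [hab.symm, hbc])
  have e3 : ({a, b, c} : Finset α).erase c = {a, b} := by
    rw [show ({a, b, c} : Finset α) = {c, a, b} by ext x; simp; tauto]
    exact Finset.erase_insert (by simp [hac.symm, hbc.symm])
  rw [e1, e2, e3, Finset.sum_pair hbc, Finset.sum_pair hac, Finset.sum_pair hab,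
    perThrough_symm hM _ v b a, perThrough_symm hM _ v c a, perThrough_symm hM _ v c b]
  ring

/-- The permutations through `v` in the direction of a cycle `c 0 = v, c 1, …, c (L - 1)` which has
at most one vertex `c m` other than `v` with neighbours outside the cycle. -/
theorem perThrough_cycle (M : α → α → R) {S : Finset α} {c : ℕ → α} {L m : ℕ} (hL : 3 ≤ L)
    (hc : ∀ a < L, ∀ b < L, c a = c b → a = b) (hcL : c L = c 0)
    (hcS : ∀ t < L, c t ∈ S) (hedge : ∀ t < L, M (c t) (c (t + 1)) = -1)
    (hN : ∀ t, t + 1 < L → t + 1 ≠ m → ∀ x ∈ S, x ≠ c t → x ≠ c (t + 1) → x ≠ c (t + 2) →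
      M (c (t + 1)) x = 0 ∧ M x (c (t + 1)) = 0) :
    perThrough M S (c 0) (c 1) (c (L - 1))
      = (-1) ^ L * perOn M (S \ (Finset.range L).image c) := by
  set l : List α := (List.range L).map c with hl
  have hlen : l.length = L := by simp [hl]
  have hget : ∀ t (ht : t < l.length), l[t] = c t := fun t ht => by simp [hl]
  have hnd : l.Nodup := by
    rw [List.nodup_iff_injective_get]
    intro a b hab
    simp only [List.get_eq_getElem, hget] at hab
    exact Fin.ext (hc _ (hlen ▸ a.2) _ (hlen ▸ b.2) hab)
  set K := (Finset.range L).image c with hK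
  have hτc : ∀ t < L, l.formPerm (c t) = c (t + 1) := by
    intro t ht
    have h1 := List.formPerm_apply_getElem l hnd t (hlen ▸ ht)
    rw [hget, hget] at h1
    rw [h1, hlen]
    rcases Nat.lt_or_ge (t + 1) L with h2 | h2
    · rw [Nat.mod_eq_of_lt h2]
    · have : t + 1 = L := by omega
      rw [this, Nat.mod_self, hcL]
  have hτ : l.formPerm ∈ permsOfFinset K := by
    rw [mem_permsOfFinset]
    intro x hx
    apply List.formPerm_apply_of_notMem
    intro h
    apply hx
    rw [hl, List.mem_map] at h
    obtain ⟨t, ht, rfl⟩ := h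
    exact Finset.mem_image_of_mem c (Finset.mem_range.2 (List.mem_range.1 ht))
  have hKS : K ⊆ S := by
    intro x hx
    obtain ⟨t, ht, rfl⟩ := Finset.mem_image.1 hx
    exact hcS t (Finset.mem_range.1 ht)
  have hprod : ∏ x ∈ K, M x (l.formPerm x) = (-1) ^ L := by
    rw [hK, Finset.prod_image (fun a ha b hb => hc a (by simpa using ha) b (by simpa using hb))]
    rw [Finset.prod_congr rfl (g := fun _ => (-1 : R)) (fun t ht => by
      rw [hτc t (Finset.mem_range.1 ht), hedge t (Finset.mem_range.1 ht)])]
    simp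
  rw [← hprod, ← sum_perms_agree M hKS hτ, perThrough]
  symm
  classical
  apply Finset.sum_subset_zero_on_sdiff
  · intro σ hσ
    rw [Finset.mem_filter] at hσ ⊢
    have hh : ∀ t < L, σ (c t) = c (t + 1) := fun t ht => by
      rw [hσ.2 _ (Finset.mem_image_of_mem c (Finset.mem_range.2 ht)), hτc t ht]
    refine ⟨hσ.1, hh 0 (by omega), ?_⟩
    rw [hh (L - 1) (by omega), show L - 1 + 1 = L by omega, hcL]
  · intro σ hσ
    rw [Finset.mem_sdiff, Finset.mem_filter, Finset.mem_filter] at hσ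
    obtain ⟨⟨hσS, h0, hlast⟩, hnot⟩ := hσ
    by_contra hne
    apply hnot
    refine ⟨hσS, ?_⟩
    have key : ∀ x ∈ S, M x (σ x) ≠ 0 := fun x hx => ne_zero_of_prod_ne_zero hne hx
    -- Going forward from `v`, the row of `c (t + 1)` offers only three images, and by injectivity
    -- two of them are already taken. This stops at the exceptional vertex `c m`.
    have fwd : ∀ t, t < L → t < m → σ (c t) = c (t + 1) := by
      intro t
      induction t using Nat.strong_induction_on with
      | _ t ih =>
        intro htL htm
        rcases t with _ | t
        · exact h0
        by_contra hcon
        have hS := apply_mem_of_mem_permsOfFinset hσS (hcS (t + 1) htL)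
        refine key _ (hcS (t + 1) htL) (hN t htL (by omega) _ hS ?_ ?_ hcon).1
        · intro h1
          rcases t with _ | t
          · have := hc _ (by omega) _ (by omega) (σ.injective (h1.trans hlast.symm))
            omega
          · have h2 := ih t (by omega) (by omega) (by omega)
            have := hc _ (by omega) _ (by omega) (σ.injective (h1.trans h2.symm))
            omega
        · intro h1
          have h2 := ih t (by omega) (by omega) (by omega)
          have := hc _ (by omega) _ (by omega) (σ.injective (h1.trans h2.symm))
          omega
    -- From the other end of the cycle the same argument runs on preimages, using the columns, until
    -- it reaches `c m`.
    have bwd : ∀ k, ∀ t, t + 1 + k = L → m ≤ t → σ (c t) = c (t + 1) := by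
      intro k
      induction k using Nat.strong_induction_on with
      | _ k ih =>
        intro t htL hmt
        rcases k with _ | k
        · obtain rfl : t = L - 1 := by omega
          rw [hlast, show L - 1 + 1 = L by omega, hcL]
        by_contra hcon
        have hnext : σ (c (t + 1)) = c (t + 2) := ih k (by omega) (t + 1) (by omega) (by omega)
        have hS := apply_mem_of_mem_permsOfFinset (inv_mem_permsOfFinset hσS) (hcS (t + 1) (by omega))
        have hk := key _ hS
        rw [show σ (σ⁻¹ (c (t + 1))) = c (t + 1) by simp] at hk
        refine hk (hN t (by omega) (by omega) _ hS ?_ ?_ ?_).2 <;>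
          rw [Ne, Equiv.Perm.inv_eq_iff_eq]
        · exact fun h => hcon h.symm
        · rw [hnext]
          intro h1
          rcases Nat.lt_or_ge (t + 2) L with h2 | h2
          · have := hc _ (by omega) _ (by omega) h1
            omega
          · rw [show t + 2 = L by omega, hcL] at h1
            have := hc _ (by omega) _ (by omega) h1
            omega
        · intro h1
          rcases k with _ | k
          · rw [show t + 2 = L by omega, hcL, h0] at h1
            have := hc _ (by omega) _ (by omega) h1
            omega
          · rw [ih k (by omega) (t + 2) (by omega) (by omega)] at h1
            rcases Nat.lt_or_ge (t + 3) L with h2 | h2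
            · have := hc _ (by omega) _ (by omega) h1
              omega
            · rw [show t + 2 + 1 = L by omega, hcL] at h1
              have := hc _ (by omega) _ (by omega) h1
              omega
    intro x hx
    obtain ⟨t, ht, rfl⟩ := Finset.mem_image.1 hx
    have htL := Finset.mem_range.1 ht
    rw [hτc t htL]
    rcases Nat.lt_or_ge t m with h | h
    · exact fwd t htL h
    · exact bwd (L - 1 - t) t (by omega) h
  · exact fun _ _ => rfl

end PerOn

/-! ### Permanents of paths, cycles, dumbbells and theta graphs. -/

section PathsAndCycles

variable {R : Type*} [CommRing R]

/-- `pathPer y (k + 2)` is the permanent of `y I - A` for a path on `k` vertices. -/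
def pathPer (y : R) : ℕ → R
  -- The values at 0 and 1 come from running the recurrence backwards to paths with -2 and -1
  -- vertices, so that degenerate legs need no separate formulas.
  | 0 => 1
  | 1 => 0
  | k + 2 => y * pathPer y (k + 1) + pathPer y k

/-- The symmetric matrix `M` is `y I - A` of the path `l, l + 1, …, h - 1`. -/
structure IsPathOn (M : ℕ → ℕ → R) (y : R) (l h : ℕ) : Prop where
  symm : ∀ a b, M a b = M b a
  diag : ∀ a, l ≤ a → a < h → M a a = y
  step : ∀ a, l ≤ a → a + 1 < h → M a (a + 1) = -1
  far : ∀ a b, l ≤ a → a + 2 ≤ b → b < h → M a b = 0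

theorem IsPathOn.mono {M : ℕ → ℕ → R} {y : R} {l h l' h' : ℕ} (H : IsPathOn M y l h)
    (hl : l ≤ l') (hh : h' ≤ h) : IsPathOn M y l' h' where
  symm := H.symm
  diag a h1 h2 := H.diag a (by omega) (by omega)
  step a h1 h2 := H.step a (by omega) (by omega)
  far a b h1 h2 h3 := H.far a b (by omega) h2 (by omega)

theorem insert_Ico_left {l h : ℕ} (hlh : l < h) :
    insert l (Finset.Ico (l + 1) h) = Finset.Ico l h := by
  ext x; simp only [Finset.mem_insert, Finset.mem_Ico]; omega

theorem erase_Ico_left (l h : ℕ) : (Finset.Ico l h).erase l = Finset.Ico (l + 1) h := by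
  ext x; simp only [Finset.mem_erase, Finset.mem_Ico]; omega

theorem erase_Ico_right (l h : ℕ) : (Finset.Ico l h).erase (h - 1) = Finset.Ico l (h - 1) := by
  ext x; simp only [Finset.mem_erase, Finset.mem_Ico]; omega

theorem perOn_Ico {M : ℕ → ℕ → R} {y : R} {l h : ℕ} (H : IsPathOn M y l h) :
    perOn M (Finset.Ico l h) = pathPer y (h - l + 2) := by
  induction hk : h - l using Nat.strong_induction_on generalizing l with
  | _ k ih =>
    rcases k with _ | k
    · rw [Finset.Ico_eq_empty_of_le (by omega), perOn_empty]
      simp [pathPer]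
    rcases k with _ | k
    · have : Finset.Ico l h = {l} := by
        ext x; simp only [Finset.mem_Ico, Finset.mem_singleton]; omega
      rw [this, perOn_singleton, H.diag l le_rfl (by omega)]
      simp [pathPer]
    · rw [← insert_Ico_left (show l < h by omega),
        perOn_insert_leaf M H.symm (w := l + 1) (by simp) (by simp; omega)
        (fun x hx hne => by
          rw [Finset.mem_Ico] at hx; exact H.far _ _ le_rfl (by omega) hx.2),
        erase_Ico_left, ih (k + 1) (by omega) (H.mono (by omega) le_rfl) (by omega),
        ih k (by omega) (H.mono (by omega) le_rfl) (by omega), H.diag l le_rfl (by omega),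
        H.symm (l + 1) l, H.step l le_rfl (by omega)]
      simp only [pathPer]; ring

theorem perOn_insert_Ico_left {M : ℕ → ℕ → R} {y : R} {l h v : ℕ} (H : IsPathOn M y l h)
    (hlh : l ≤ h) (hv : v ∉ Finset.Ico l h) (hvl : l < h → M v l = -1)
    (hfar : ∀ x, l < x → x < h → M v x = 0) :
    perOn M (insert v (Finset.Ico l h))
      = M v v * pathPer y (h - l + 2) + pathPer y (h - l + 1) := by
  rcases hlh.eq_or_lt with rfl | hlt
  · simp [perOn_singleton, pathPer]
  · rw [perOn_insert_leaf M H.symm (w := l) hv (by simp; omega)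
      (fun x hx hne => by rw [Finset.mem_Ico] at hx; exact hfar x (by omega) hx.2),
      erase_Ico_left, perOn_Ico H, perOn_Ico (H.mono (Nat.le_succ l) le_rfl), H.symm l v,
      hvl hlt, show h - (l + 1) + 2 = h - l + 1 by omega]
    ring

theorem perOn_insert_Ico_right {M : ℕ → ℕ → R} {y : R} {l h v : ℕ} (H : IsPathOn M y l h)
    (hlh : l ≤ h) (hv : v ∉ Finset.Ico l h) (hvl : l < h → M v (h - 1) = -1)
    (hfar : ∀ x, l ≤ x → x + 1 < h → M v x = 0) :
    perOn M (insert v (Finset.Ico l h))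
      = M v v * pathPer y (h - l + 2) + pathPer y (h - l + 1) := by
  rcases hlh.eq_or_lt with rfl | hlt
  · simp [perOn_singleton, pathPer]
  · rw [perOn_insert_leaf M H.symm (w := h - 1) hv (by simp; omega)
      (fun x hx hne => by rw [Finset.mem_Ico] at hx; exact hfar x (by omega) (by omega)),
      erase_Ico_right, perOn_Ico H, perOn_Ico (H.mono le_rfl (Nat.sub_le h 1)), H.symm (h - 1) v,
      hvl hlt, show h - 1 - l + 2 = h - l + 1 by omega]
    ring

/-- The permanent of `y I - A` of a cycle of length `m`, where `d` replaces one of the diagonal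
entries `y`. -/
def cyclePer (y d : R) (m : ℕ) : R :=
  d * pathPer y (m + 1) + 2 * pathPer y m + 2 * (-1) ^ m

theorem perOn_insert_Ico_cycle {M : ℕ → ℕ → R} {y : R} {l h v : ℕ} (H : IsPathOn M y l h)
    (hlh : l + 2 ≤ h) (hv : v ∉ Finset.Ico l h) (hvl : M v l = -1) (hvh : M v (h - 1) = -1)
    (hfar : ∀ x, l < x → x + 1 < h → M v x = 0) :
    perOn M (insert v (Finset.Ico l h)) = cyclePer y (M v v) (h - l + 1) := by
  rw [Finset.mem_Ico] at hv
  rw [perOn_insert_two M H.symm (a := l) (b := h - 1) (by simpa using hv) (by simp; omega)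
    (by simp; omega) (by omega) hvl hvh (fun x hx h1 h2 => by
      rw [Finset.mem_Ico] at hx; exact hfar x (by omega) (by omega)),
    erase_Ico_left, erase_Ico_right, perOn_Ico H, perOn_Ico (H.mono (Nat.le_succ l) le_rfl),
    perOn_Ico (H.mono le_rfl (Nat.sub_le h 1))]
  -- The cycle `v, l, l + 1, …, h - 1`, closing up at index `h - l + 1`. No vertex has neighbours
  -- outside it, hence `m := 0` below.
  let c : ℕ → ℕ := fun t => if t = 0 ∨ h - l + 1 ≤ t then v else l + t - 1
  have hcyc := perThrough_cycle M (S := insert v (Finset.Ico l h)) (c := c) (L := h - l + 1)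
    (m := 0) (by omega)
    (by
      intro a ha b hb hab
      simp only [c] at hab
      split_ifs at hab <;> omega)
    (by simp [c])
    (by
      intro t ht
      simp only [c, Finset.mem_insert, Finset.mem_Ico]
      split_ifs <;> omega)
    (by
      intro t ht
      rcases Nat.eq_zero_or_pos t with rfl | ht0
      · rw [show c 0 = v by simp [c], show c (0 + 1) = l by
          simp only [c]; rw [if_neg (by omega)]; omega]
        exact hvl
      · rcases Nat.lt_or_ge (t + 1) (h - l + 1) with h1 | h1
        · simp only [c, if_neg (show ¬ (t = 0 ∨ h - l + 1 ≤ t) by omega),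
            if_neg (show ¬ (t + 1 = 0 ∨ h - l + 1 ≤ t + 1) by omega)]
          have := H.step (l + t - 1) (by omega) (by omega)
          rwa [show l + t - 1 + 1 = l + (t + 1) - 1 by omega] at this
        · simp only [c, if_neg (show ¬ (t = 0 ∨ h - l + 1 ≤ t) by omega),
            if_pos (show (t + 1 = 0 ∨ h - l + 1 ≤ t + 1) by omega)]
          rw [H.symm, show l + t - 1 = h - 1 by omega, hvh])
    (by
      intro t ht _ x hx h1 h2 h3
      have key : M (c (t + 1)) x = 0 := by
        rw [Finset.mem_insert, Finset.mem_Ico] at hx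
        simp only [c] at h1 h2 h3 ⊢
        rw [if_neg (by omega)] at h2 ⊢
        rcases hx with rfl | hx
        · rw [H.symm]
          apply hfar
          · by_contra hcon
            exact h1 (if_pos (by omega)).symm
          · by_contra hcon
            exact h3 (if_pos (by omega)).symm
        · rcases Nat.lt_or_ge x (l + (t + 1) - 1) with h4 | h4
          · rw [H.symm]
            apply H.far _ _ hx.1 _ (by omega)
            by_contra hcon
            exact h1 (by rw [if_neg (by omega)]; omega)
          · apply H.far _ _ (by omega) _ hx.2
            by_contra hcon
            exact h3 (by rw [if_neg (by omega)]; omega)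
      exact ⟨key, (H.symm _ _).trans key⟩)
  have e0 : c 0 = v := by simp [c]
  have e1 : c 1 = l := by simp only [c]; rw [if_neg (by omega)]; omega
  have e2 : c (h - l + 1 - 1) = h - 1 := by
    simp only [c]; rw [if_neg (by omega)]; omega
  have hS : insert v (Finset.Ico l h) \ (Finset.range (h - l + 1)).image c = ∅ := by
    rw [Finset.sdiff_eq_empty_iff_subset]
    intro x hx
    rw [Finset.mem_insert, Finset.mem_Ico] at hx
    rw [Finset.mem_image]
    rcases hx with rfl | hx
    · exact ⟨0, by simp, e0⟩
    · refine ⟨x - l + 1, by rw [Finset.mem_range]; omega, ?_⟩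
      simp only [c]
      rw [if_neg (by omega)]; omega
  rw [e0, e1, e2, hS, perOn_empty] at hcyc
  rw [hcyc, cyclePer, show h - (l + 1) + 2 = h - l + 1 by omega,
    show h - 1 - l + 2 = h - l + 1 by omega]
  ring

/-- The symmetric matrix `M` agrees on `0, …, n - 1` with `y I - A - E`, where `A` is the adjacency
matrix of the path `0, …, n - 1` with the two chords `0 j` and `i (n - 1)` added, and `E` is
the diagonal matrix with the entry `1` at `i` and `j`. -/
structure IsChordedPath (M : ℕ → ℕ → R) (y : R) (n j i : ℕ) : Prop where
  symm : ∀ a b, M a b = M b a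
  diag : ∀ a, a < n → a ≠ i → a ≠ j → M a a = y
  diag_i : M i i = y - 1
  diag_j : M j j = y - 1
  step : ∀ a, a + 1 < n → M a (a + 1) = -1
  chord_j : M 0 j = -1
  chord_i : M i (n - 1) = -1
  far : ∀ a b, a + 2 ≤ b → b < n → ¬ (a = 0 ∧ b = j) → ¬ (a = i ∧ b = n - 1) → M a b = 0

theorem IsChordedPath.isPathOn {M : ℕ → ℕ → R} {y : R} {n j i l h : ℕ}
    (H : IsChordedPath M y n j i) (hi : ¬ (l ≤ i ∧ i < h)) (hj : ¬ (l ≤ j ∧ j < h)) (hn : h ≤ n) :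
    IsPathOn M y l h where
  symm := H.symm
  diag a h1 h2 := H.diag a (by omega) (by omega) (by omega)
  step a h1 h2 := H.step a (by omega)
  far a b h1 h2 h3 := H.far a b h2 (by omega) (by omega) (by omega)

/-- The value of `perOn` for a dumbbell with cycles of lengths `p` and `q`, whose connecting path
has `e + 1` edges. -/
def dumbbellPer (y : R) (p q e : ℕ) : R :=
  let leg := (y - 1) * pathPer y (e + 2) + pathPer y (e + 1)
  let leg' := (y - 1) * leg + (y - 1) * pathPer y (e + 1) + pathPer y e
  let Bq := cyclePer y (y - 1) q - (y - 1) * pathPer y (q + 1)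
  let lol := leg * pathPer y (q + 1) + pathPer y (e + 2) * Bq
  let lol' := leg' * pathPer y (q + 1) + leg * Bq
  cyclePer y (y - 1) p * lol + pathPer y (p + 1) * (lol' - (y - 1) * lol)

/-- For `j < i` both `i` and `j` are cut vertices, so `perOn_glue` at `i` and then at `j` reduces
everything to paths and cycles. -/
theorem perOn_dumbbell {M : ℕ → ℕ → R} {y : R} {n j i : ℕ} (H : IsChordedPath M y n j i)
    (hj : 2 ≤ j) (hji : j < i) (hin : i + 3 ≤ n) :
    perOn M (Finset.range n) = dumbbellPer y (j + 1) (n - i) (i - j - 1) := by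
  have zero : ∀ a b, a < n → b < n → a + 1 ≠ b → b + 1 ≠ a → a ≠ b → ¬ (a = 0 ∧ b = j) →
      ¬ (a = i ∧ b = n - 1) → ¬ (b = 0 ∧ a = j) → ¬ (b = i ∧ a = n - 1) → M a b = 0 := by
    intro a b ha hb h1 h2 h3 h4 h5 h6 h7
    rcases Nat.lt_or_ge a b with h | h
    · exact H.far a b (by omega) hb h4 h5
    · rw [H.symm]; exact H.far b a (by omega) ha h6 h7
  -- the three paths
  have pA := H.isPathOn (l := 0) (h := j) (by omega) (by omega) (by omega)
  have pB := H.isPathOn (l := j + 1) (h := i) (by omega) (by omega) (by omega)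
  have pC := H.isPathOn (l := i + 1) (h := n) (by omega) (by omega) le_rfl
  have rA := perOn_Ico pA
  have rB := perOn_Ico pB
  have rC := perOn_Ico pC
  have cA := perOn_insert_Ico_cycle (v := j) pA (by omega) (by simp)
    (by rw [H.symm]; exact H.chord_j)
    (by rw [H.symm]; convert H.step (j - 1) (by omega) using 2; omega)
    (fun x h1 h2 => zero _ _ (by omega) (by omega) (by omega) (by omega) (by omega) (by omega)
      (by omega) (by omega) (by omega))
  have cC := perOn_insert_Ico_cycle (v := i) pC (by omega) (by simp) (H.step i (by omega)) H.chord_i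
    (fun x h1 h2 => zero _ _ (by omega) (by omega) (by omega) (by omega) (by omega) (by omega)
      (by omega) (by omega) (by omega))
  have lBi := perOn_insert_Ico_right (v := i) pB (by omega) (by simp)
    (fun _ => by rw [H.symm]; convert H.step (i - 1) (by omega) using 2; omega)
    (fun x h1 h2 => zero _ _ (by omega) (by omega) (by omega) (by omega) (by omega) (by omega)
      (by omega) (by omega) (by omega))
  have lBj := perOn_insert_Ico_left (v := j) pB (by omega) (by simp)
    (fun _ => H.step j (by omega))
    (fun x h1 h2 => zero _ _ (by omega) (by omega) (by omega) (by omega) (by omega) (by omega)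
      (by omega) (by omega) (by omega))
  have lol := perOn_glue M (v := i) (A := Finset.Ico (j + 1) i) (B := Finset.Ico (i + 1) n)
    (Finset.disjoint_left.2 fun x h1 h2 => by rw [Finset.mem_Ico] at h1 h2; omega)
    (by simp) (by simp)
    (fun a ha b hb => by
      rw [Finset.mem_Ico] at ha hb; apply zero <;> omega)
    (fun a ha b hb => by
      rw [Finset.mem_Ico] at ha hb; apply zero <;> omega)
  have lol' := perOn_glue M (v := i) (A := Finset.Ico j i) (B := Finset.Ico (i + 1) n)
    (Finset.disjoint_left.2 fun x h1 h2 => by rw [Finset.mem_Ico] at h1 h2; omega)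
    (by simp) (by simp)
    (fun a ha b hb => by
      rw [Finset.mem_Ico] at ha hb; apply zero <;> omega)
    (fun a ha b hb => by
      rw [Finset.mem_Ico] at ha hb; apply zero <;> omega)
  have tot := perOn_glue M (v := j) (A := Finset.Ico 0 j) (B := Finset.Ico (j + 1) n)
    (Finset.disjoint_left.2 fun x h1 h2 => by rw [Finset.mem_Ico] at h1 h2; omega)
    (by simp) (by simp)
    (fun a ha b hb => by
      rw [Finset.mem_Ico] at ha hb; apply zero <;> omega)
    (fun a ha b hb => by
      rw [Finset.mem_Ico] at ha hb; apply zero <;> omega)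
  have e1 : insert i (Finset.Ico (j + 1) i ∪ Finset.Ico (i + 1) n) = Finset.Ico (j + 1) n := by
    ext x; simp only [Finset.mem_insert, Finset.mem_union, Finset.mem_Ico]; omega
  have e2 : insert i (Finset.Ico j i ∪ Finset.Ico (i + 1) n) = Finset.Ico j n := by
    ext x; simp only [Finset.mem_insert, Finset.mem_union, Finset.mem_Ico]; omega
  have e3 : insert j (Finset.Ico 0 j ∪ Finset.Ico (j + 1) n) = Finset.range n := by
    ext x; simp only [Finset.mem_insert, Finset.mem_union, Finset.mem_Ico, Finset.mem_range]; omega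
  rw [e1] at lol
  rw [e2] at lol'
  rw [e3, insert_Ico_left (show j < n by omega)] at tot
  rw [insert_Ico_left hji] at lBj
  have lij : perOn M (insert i (Finset.Ico j i)) = (y - 1) *
      ((y - 1) * pathPer y (i - j - 1 + 2) + pathPer y (i - j - 1 + 1))
      + (y - 1) * pathPer y (i - j - 1 + 1) + pathPer y (i - j - 1) := by
    have ej : insert i (Finset.Ico j i) = insert j (insert i (Finset.Ico (j + 1) i)) := by
      rw [Finset.insert_comm, insert_Ico_left hji]
    rw [ej, perOn_insert_leaf M H.symm (w := j + 1) (by simp; omega)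
      (by simp only [Finset.mem_insert, Finset.mem_Ico]; omega) (fun x hx hne => by
        rw [Finset.mem_insert, Finset.mem_Ico] at hx
        apply zero <;> omega), lBi, H.diag_i, H.diag_j, H.symm (j + 1) j, H.step j (by omega)]
    rcases Nat.eq_or_lt_of_le (show j + 1 ≤ i from hji) with h1 | h1
    · rw [← h1]
      simp [pathPer, perOn_empty]
    · have e4 : (insert i (Finset.Ico (j + 1) i)).erase (j + 1)
          = insert i (Finset.Ico (j + 2) i) := by
        ext x; simp only [Finset.mem_erase, Finset.mem_insert, Finset.mem_Ico]; omega
      have lBi' := perOn_insert_Ico_right (v := i) (pB.mono (Nat.le_succ _) le_rfl) (by omega)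
        (by simp) (fun _ => by rw [H.symm]; convert H.step (i - 1) (by omega) using 2; omega)
        (fun x h1 h2 => zero _ _ (by omega) (by omega) (by omega) (by omega) (by omega)
          (by omega) (by omega) (by omega) (by omega))
      rw [e4, lBi', H.diag_i, show i - (j + 1 + 1) + 2 = i - j - 1 + 1 by omega,
        show i - (j + 1 + 1) + 1 = i - j - 1 by omega, show i - (j + 1) = i - j - 1 by omega]
      ring
  rw [tot, lol', lol, lij, lBi, lBj, cA, cC, rA, rB, rC, H.diag_i, H.diag_j, dumbbellPer,
    show n - (i + 1) + 2 = n - i + 1 by omega, show n - (i + 1) + 1 = n - i by omega,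
    show i - (j + 1) = i - j - 1 by omega, Nat.sub_zero]
  ring

/-- The value of `perOn` for a spider whose centre has the diagonal entry `y - 1` and whose legs
have `a - 1`, `b - 1` and `c - 1` vertices. -/
def spiderPer (y : R) (a b c : ℕ) : R :=
  (y - 1) * pathPer y (a + 1) * pathPer y (b + 1) * pathPer y (c + 1)
    + pathPer y a * pathPer y (b + 1) * pathPer y (c + 1)
    + pathPer y (a + 1) * pathPer y b * pathPer y (c + 1)
    + pathPer y (a + 1) * pathPer y (b + 1) * pathPer y c

/-- The value of `perOn` for two vertices joined by three paths with `a + 1`, `b + 1` and `c + 1`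
edges. -/
def thetaPer (y : R) (a b c : ℕ) : R :=
  (y - 1) * spiderPer y (a + 1) (b + 1) (c + 1) + spiderPer y a (b + 1) (c + 1)
    + spiderPer y (a + 1) b (c + 1) + spiderPer y (a + 1) (b + 1) c
    + 2 * ((-1) ^ (a + b) * pathPer y (c + 2) + (-1) ^ (a + c) * pathPer y (b + 2)
      + (-1) ^ (b + c) * pathPer y (a + 2))

/-- For `i < j` the vertex `i` is expanded along its three edges and the three cycles through it,
each in two directions. Deleting `i` leaves a spider with centre `j`, and deleting a cycle leaves
the interior of the third path. -/
theorem perOn_theta {M : ℕ → ℕ → R} {y : R} {n j i : ℕ} (H : IsChordedPath M y n j i)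
    (hi : 1 ≤ i) (hij : i < j) (hjn : j + 2 ≤ n) :
    perOn M (Finset.range n) = thetaPer y i (j - i - 1) (n - j - 1) := by
  have zero : ∀ a b, a < n → b < n → a + 1 ≠ b → b + 1 ≠ a → a ≠ b → ¬ (a = 0 ∧ b = j) →
      ¬ (a = i ∧ b = n - 1) → ¬ (b = 0 ∧ a = j) → ¬ (b = i ∧ a = n - 1) → M a b = 0 := by
    intro a b ha hb h1 h2 h3 h4 h5 h6 h7
    rcases Nat.lt_or_ge a b with h | h
    · exact H.far a b (by omega) hb h4 h5
    · rw [H.symm]; exact H.far b a (by omega) ha h6 h7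
  have step' : ∀ a, 1 ≤ a → a < n → M a (a - 1) = -1 := fun a h1 h2 => by
    rw [H.symm]; convert H.step (a - 1) (by omega) using 2; omega
  have spider : ∀ a m h, a ≤ i → i + 1 ≤ m → m ≤ j → j + 1 ≤ h → h ≤ n →
      perOn M (insert j (Finset.Ico 0 a ∪ (Finset.Ico m j ∪ Finset.Ico (j + 1) h)))
        = spiderPer y (a + 1) (j - m + 1) (h - j) := by
    intro a m h h1 h2 h3 h4 h5
    have pA := H.isPathOn (l := 0) (h := a) (by omega) (by omega) (by omega)
    have pB := H.isPathOn (l := m) (h := j) (by omega) (by omega) (by omega)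
    have pC := H.isPathOn (l := j + 1) (h := h) (by omega) (by omega) (by omega)
    have lA := perOn_insert_Ico_left (v := j) pA (by omega) (by simp; omega)
      (fun _ => by rw [H.symm]; exact H.chord_j)
      (fun x h1 h2 => by apply zero <;> omega)
    have lB := perOn_insert_Ico_right (v := j) pB (by omega) (by simp)
      (fun _ => step' j (by omega) (by omega))
      (fun x h1 h2 => by apply zero <;> omega)
    have lC := perOn_insert_Ico_left (v := j) pC (by omega) (by simp)
      (fun _ => H.step j (by omega))
      (fun x h1 h2 => by apply zero <;> omega)
    have dBC : Disjoint (Finset.Ico m j) (Finset.Ico (j + 1) h) :=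
      Finset.disjoint_left.2 fun x h1 h2 => by rw [Finset.mem_Ico] at h1 h2; omega
    have zBC : ∀ x ∈ Finset.Ico m j, ∀ z ∈ Finset.Ico (j + 1) h, M x z = 0 := fun x hx z hz => by
      rw [Finset.mem_Ico] at hx hz; apply zero <;> omega
    have g1 := perOn_glue M (v := j) (A := Finset.Ico m j) (B := Finset.Ico (j + 1) h) dBC
      (by simp) (by simp) zBC (fun x hx z hz => by rw [H.symm]; exact zBC x hx z hz)
    have u1 := perOn_union M dBC zBC
    have zA : ∀ x ∈ Finset.Ico 0 a, ∀ z ∈ Finset.Ico m j ∪ Finset.Ico (j + 1) h, M x z = 0 :=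
      fun x hx z hz => by
        rw [Finset.mem_union, Finset.mem_Ico, Finset.mem_Ico] at hz
        rw [Finset.mem_Ico] at hx
        apply zero <;> omega
    have g2 := perOn_glue M (v := j) (A := Finset.Ico 0 a)
      (B := Finset.Ico m j ∪ Finset.Ico (j + 1) h)
      (Finset.disjoint_left.2 fun x h1 h2 => by
        rw [Finset.mem_union, Finset.mem_Ico, Finset.mem_Ico] at h2
        rw [Finset.mem_Ico] at h1; omega)
      (by simp; omega) (by simp) zA (fun x hx z hz => by rw [H.symm]; exact zA x hx z hz)
    rw [g2, g1, u1, lA, lB, lC, perOn_Ico pA, perOn_Ico pB, perOn_Ico pC, H.diag_j, spiderPer,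
      Nat.sub_zero, show h - (j + 1) + 2 = h - j + 1 by omega,
      show h - (j + 1) + 1 = h - j by omega]
    ring
  have hrange : Finset.range n = insert i (insert j (Finset.Ico 0 i ∪
      (Finset.Ico (i + 1) j ∪ Finset.Ico (j + 1) n))) := by
    ext x; simp only [Finset.mem_insert, Finset.mem_union, Finset.mem_Ico, Finset.mem_range]; omega
  set S := insert j (Finset.Ico 0 i ∪ (Finset.Ico (i + 1) j ∪ Finset.Ico (j + 1) n)) with hS
  have memS : ∀ x, x ∈ S ↔ x < n ∧ x ≠ i := fun x => by
    simp only [hS, Finset.mem_insert, Finset.mem_union, Finset.mem_Ico]; omega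
  have hexp := perOn_insert_three M H.symm (v := i) (a := i + 1) (b := i - 1) (c := n - 1) (S := S)
    (by rw [memS]; omega) (by rw [memS]; omega) (by rw [memS]; omega) (by rw [memS]; omega)
    (by omega) (by omega) (by omega) (H.step i (by omega)) (step' i hi (by omega)) H.chord_i
    (fun x hx h1 h2 h3 => by rw [memS] at hx; apply zero <;> omega)
  have s0 : perOn M S = spiderPer y (i + 1) (j - i - 1 + 1) (n - j - 1 + 1) := by
    rw [hS, spider i (i + 1) n le_rfl le_rfl hij (by omega) le_rfl,
      show j - (i + 1) = j - i - 1 by omega, show n - j - 1 + 1 = n - j by omega]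
  have s1 : perOn M (S.erase (i - 1)) = spiderPer y i (j - i - 1 + 1) (n - j - 1 + 1) := by
    have : S.erase (i - 1) = insert j (Finset.Ico 0 (i - 1) ∪
        (Finset.Ico (i + 1) j ∪ Finset.Ico (j + 1) n)) := by
      ext x
      simp only [memS, Finset.mem_erase, Finset.mem_insert, Finset.mem_union, Finset.mem_Ico]; omega
    rw [this, spider (i - 1) (i + 1) n (by omega) le_rfl hij (by omega) le_rfl,
      show j - (i + 1) = j - i - 1 by omega, show n - j - 1 + 1 = n - j by omega,
      show i - 1 + 1 = i by omega]
  have s2 : perOn M (S.erase (n - 1)) = spiderPer y (i + 1) (j - i - 1 + 1) (n - j - 1) := by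
    have : S.erase (n - 1) = insert j (Finset.Ico 0 i ∪
        (Finset.Ico (i + 1) j ∪ Finset.Ico (j + 1) (n - 1))) := by
      ext x
      simp only [memS, Finset.mem_erase, Finset.mem_insert, Finset.mem_union, Finset.mem_Ico]; omega
    rw [this, spider i (i + 1) (n - 1) le_rfl le_rfl hij (by omega) (by omega),
      show j - (i + 1) = j - i - 1 by omega, show n - 1 - j = n - j - 1 by omega]
  have s3 : perOn M (S.erase (i + 1)) = spiderPer y (i + 1) (j - i - 1) (n - j - 1 + 1) := by
    -- If `j = i + 1`, the erased vertex is the centre `j` itself and two paths remain. The spider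
    -- formula with leg parameter 0 still gives this, because `pathPer y 1 = 0` and `pathPer y 0 =
    -- 1`.
    rcases Nat.eq_or_lt_of_le (show i + 1 ≤ j from hij) with h1 | h1
    · have e1 : S.erase (i + 1) = Finset.Ico 0 i ∪ Finset.Ico (j + 1) n := by
        ext x; simp only [memS, Finset.mem_erase, Finset.mem_union, Finset.mem_Ico]; omega
      rw [e1, perOn_union M (Finset.disjoint_left.2 fun x h1 h2 => by
          rw [Finset.mem_Ico] at h1 h2; omega) (fun x hx z hz => by
          rw [Finset.mem_Ico] at hx hz; apply zero <;> omega),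
        perOn_Ico (H.isPathOn (by omega) (by omega) (by omega)),
        perOn_Ico (H.isPathOn (by omega) (by omega) (by omega)), spiderPer,
        show j - i - 1 = 0 by omega, show n - (j + 1) + 2 = n - j - 1 + 1 + 1 by omega,
        Nat.sub_zero]
      simp only [pathPer]; ring
    · have e1 : S.erase (i + 1) = insert j (Finset.Ico 0 i ∪
          (Finset.Ico (i + 2) j ∪ Finset.Ico (j + 1) n)) := by
        ext x
        simp only [memS, Finset.mem_erase, Finset.mem_insert, Finset.mem_union, Finset.mem_Ico]
        omega
      rw [e1, spider i (i + 2) n le_rfl (by omega) (by omega) (by omega) le_rfl,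
        show j - (i + 2) + 1 = j - i - 1 by omega, show n - j - 1 + 1 = n - j by omega]
  have t1 : perThrough M (insert i S) i (i + 1) (i - 1)
      = (-1) ^ (j + 1) * pathPer y (n - j - 1 + 2) := by
    -- The cycle `i, i + 1, …, j, 0, 1, …, i - 1`; the exceptional vertex `j` has position `j - i`.
    let c : ℕ → ℕ := fun t => if t ≤ j - i then i + t else if t ≤ j then t - (j - i + 1) else i
    have hcyc := perThrough_cycle M (S := insert i S) (c := c) (L := j + 1)
      (m := j - i) (by omega)
      (by intro a ha b hb hab; simp only [c] at hab; split_ifs at hab <;> omega)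
      (by simp only [c]; split_ifs <;> omega)
      (by
        intro t ht
        rw [← hrange, Finset.mem_range]; simp only [c]; split_ifs <;> omega)
      (by
        intro t ht
        rcases Nat.lt_trichotomy t (j - i) with h1 | h1 | h1
        · rw [show c t = i + t by simp only [c]; split_ifs <;> omega,
            show c (t + 1) = i + t + 1 by simp only [c]; split_ifs <;> omega]
          exact H.step _ (by omega)
        · rw [show c t = j by simp only [c]; split_ifs <;> omega,
            show c (t + 1) = 0 by simp only [c]; split_ifs <;> omega, H.symm]
          exact H.chord_j
        · rw [show c t = t - (j - i + 1) by simp only [c]; split_ifs <;> omega,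
            show c (t + 1) = t - (j - i + 1) + 1 by simp only [c]; split_ifs <;> omega]
          exact H.step _ (by omega))
      (by
        intro t ht htm x hx h1 h2 h3
        have key : M (c (t + 1)) x = 0 := by
          rw [← hrange, Finset.mem_range] at hx
          simp only [c] at h1 h2 h3 ⊢
          split_ifs at h1 h2 h3 ⊢ <;> first | omega | (apply zero <;> omega)
        exact ⟨key, (H.symm _ _).trans key⟩)
    have hrest : insert i S \ (Finset.range (j + 1)).image c = Finset.Ico (j + 1) n := by
      ext x
      rw [← hrange]
      simp only [Finset.mem_sdiff, Finset.mem_range, Finset.mem_image, Finset.mem_Ico]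
      constructor
      · rintro ⟨h1, h2⟩
        refine ⟨?_, h1⟩
        by_contra hcon
        apply h2
        rcases Nat.lt_or_ge x i with h3 | h3
        · exact ⟨x + (j - i + 1), by omega, by simp only [c]; split_ifs <;> omega⟩
        · exact ⟨x - i, by omega, by simp only [c]; split_ifs <;> omega⟩
      · rintro ⟨h1, h2⟩
        refine ⟨h2, ?_⟩
        rintro ⟨t, ht, rfl⟩
        simp only [c] at h1
        split_ifs at h1 <;> omega
    rw [hrest, perOn_Ico (H.isPathOn (by omega) (by omega) (by omega)),
      show c 0 = i by simp only [c]; split_ifs <;> omega,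
      show c 1 = i + 1 by simp only [c]; split_ifs <;> omega,
      show c (j + 1 - 1) = i - 1 by simp only [c]; split_ifs <;> omega,
      show n - (j + 1) = n - j - 1 by omega] at hcyc
    exact hcyc
  have t2 : perThrough M (insert i S) i (i + 1) (n - 1)
      = (-1) ^ (n - i) * pathPer y (i + 2) := by
    -- The cycle `i, i + 1, …, n - 1`, again with `j` at position `j - i`.
    let c : ℕ → ℕ := fun t => if t < n - i then i + t else i
    have hcyc := perThrough_cycle M (S := insert i S) (c := c) (L := n - i)
      (m := j - i) (by omega)
      (by intro a ha b hb hab; simp only [c] at hab; split_ifs at hab; omega)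
      (by simp only [c]; split_ifs <;> omega)
      (by
        intro t ht
        rw [← hrange, Finset.mem_range]; simp only [c]; split_ifs; omega)
      (by
        intro t ht
        rcases Nat.lt_or_ge (t + 1) (n - i) with h1 | h1
        · rw [show c t = i + t by simp only [c]; split_ifs <;> omega,
            show c (t + 1) = i + t + 1 by simp only [c]; split_ifs <;> omega]
          exact H.step _ (by omega)
        · rw [show c t = n - 1 by simp only [c]; split_ifs <;> omega,
            show c (t + 1) = i by simp only [c]; split_ifs <;> omega, H.symm]
          exact H.chord_i)
      (by
        intro t ht htm x hx h1 h2 h3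
        have key : M (c (t + 1)) x = 0 := by
          rw [← hrange, Finset.mem_range] at hx
          simp only [c] at h1 h2 h3 ⊢
          split_ifs at h1 h2 h3 ⊢ <;> first | omega | (apply zero <;> omega)
        exact ⟨key, (H.symm _ _).trans key⟩)
    have hrest : insert i S \ (Finset.range (n - i)).image c = Finset.Ico 0 i := by
      ext x
      rw [← hrange]
      simp only [Finset.mem_sdiff, Finset.mem_range, Finset.mem_image, Finset.mem_Ico]
      constructor
      · rintro ⟨h1, h2⟩
        refine ⟨by omega, ?_⟩
        by_contra hcon
        apply h2
        exact ⟨x - i, by omega, by simp only [c]; split_ifs <;> omega⟩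
      · rintro ⟨h1, h2⟩
        refine ⟨by omega, ?_⟩
        rintro ⟨t, ht, rfl⟩
        simp only [c] at h2
        split_ifs at h2; omega
    rw [hrest, perOn_Ico (H.isPathOn (by omega) (by omega) (by omega)),
      show c 0 = i by simp only [c]; split_ifs <;> omega,
      show c 1 = i + 1 by simp only [c]; split_ifs <;> omega,
      show c (n - i - 1) = n - 1 by simp only [c]; split_ifs <;> omega, Nat.sub_zero] at hcyc
    exact hcyc
  have t3 : perThrough M (insert i S) i (i - 1) (n - 1)
      = (-1) ^ (i + 1 + n - j) * pathPer y (j - i - 1 + 2) := by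
    -- The cycle `i, i - 1, …, 0, j, j + 1, …, n - 1`, with `j` at position `i + 1`.
    let c : ℕ → ℕ := fun t => if t ≤ i then i - t else if t < i + 1 + n - j then j + t - (i + 1)
      else i
    have hcyc := perThrough_cycle M (S := insert i S) (c := c) (L := i + 1 + n - j)
      (m := i + 1) (by omega)
      (by intro a ha b hb hab; simp only [c] at hab; split_ifs at hab <;> omega)
      (by simp only [c]; split_ifs <;> omega)
      (by
        intro t ht
        rw [← hrange, Finset.mem_range]; simp only [c]; split_ifs <;> omega)
      (by
        intro t ht
        rcases Nat.lt_trichotomy t i with h1 | h1 | h1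
        · rw [show c t = i - t by simp only [c]; split_ifs <;> omega,
            show c (t + 1) = i - t - 1 by simp only [c]; split_ifs <;> omega]
          exact step' _ (by omega) (by omega)
        · rw [show c t = 0 by simp only [c]; split_ifs <;> omega,
            show c (t + 1) = j by simp only [c]; split_ifs <;> omega]
          exact H.chord_j
        · rcases Nat.lt_or_ge (t + 1) (i + 1 + n - j) with h2 | h2
          · rw [show c t = j + t - (i + 1) by simp only [c]; split_ifs <;> omega,
              show c (t + 1) = j + t - (i + 1) + 1 by simp only [c]; split_ifs <;> omega]
            exact H.step _ (by omega)
          · rw [show c t = n - 1 by simp only [c]; split_ifs <;> omega,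
              show c (t + 1) = i by simp only [c]; split_ifs <;> omega, H.symm]
            exact H.chord_i)
      (by
        intro t ht htm x hx h1 h2 h3
        have key : M (c (t + 1)) x = 0 := by
          rw [← hrange, Finset.mem_range] at hx
          simp only [c] at h1 h2 h3 ⊢
          split_ifs at h1 h2 h3 ⊢ <;> first | omega | (apply zero <;> omega)
        exact ⟨key, (H.symm _ _).trans key⟩)
    have hrest : insert i S \ (Finset.range (i + 1 + n - j)).image c = Finset.Ico (i + 1) j := by
      ext x
      rw [← hrange]
      simp only [Finset.mem_sdiff, Finset.mem_range, Finset.mem_image, Finset.mem_Ico]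
      constructor
      · rintro ⟨h1, h2⟩
        by_contra hcon
        apply h2
        rcases Nat.lt_or_ge i x with h3 | h3
        · exact ⟨x + (i + 1) - j, by omega, by simp only [c]; split_ifs <;> omega⟩
        · exact ⟨i - x, by omega, by simp only [c]; split_ifs <;> omega⟩
      · rintro ⟨h1, h2⟩
        refine ⟨by omega, ?_⟩
        rintro ⟨t, ht, rfl⟩
        simp only [c] at h1 h2
        split_ifs at h1 h2 <;> omega
    rw [hrest, perOn_Ico (H.isPathOn (by omega) (by omega) (by omega)),
      show c 0 = i by simp only [c]; split_ifs <;> omega,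
      show c 1 = i - 1 by simp only [c]; split_ifs <;> omega,
      show c (i + 1 + n - j - 1) = n - 1 by simp only [c]; split_ifs <;> omega,
      show j - (i + 1) = j - i - 1 by omega] at hcyc
    exact hcyc
  have sgn : ∀ a b : ℕ, a % 2 = b % 2 → ((-1 : R)) ^ a = (-1) ^ b := fun a b h => by
    rw [neg_one_pow_eq_pow_mod_two, h, ← neg_one_pow_eq_pow_mod_two]
  rw [hrange, hexp, s0, s1, s2, s3, t1, t2, t3, H.diag_i, thetaPer,
    sgn (j + 1) (i + (j - i - 1)) (by omega), sgn (n - i) (j - i - 1 + (n - j - 1)) (by omega),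
    sgn (i + 1 + n - j) (i + (n - j - 1)) (by omega)]
  ring

end PathsAndCycles

/-! ### The substitution `y = s - 1/s` and the normalised forms. -/

section Laurent

variable {R : Type*} [CommRing R]

/-- The Laurent form of the polynomial of a dumbbell graph in the variable `s`, where
`x - 2 = s - 1 / s`. -/
def dumbbellForm (s : R) (p q r : ℕ) : R :=
  (1 + s + 2 * s ^ 2 + 2 * (1 + s ^ 2) * s ^ p + (1 - s) * (-s ^ 2) ^ p)
      * (1 + s + 2 * s ^ 2 + 2 * (1 + s ^ 2) * s ^ q + (1 - s) * (-s ^ 2) ^ q)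
    - (-s ^ 2) ^ (r - 1)
      * ((s + s ^ 2 + 2 * (1 + s ^ 2) * s ^ p + (2 - s + s ^ 2) * (-s ^ 2) ^ p)
        * (s + s ^ 2 + 2 * (1 + s ^ 2) * s ^ q + (2 - s + s ^ 2) * (-s ^ 2) ^ q))

/-- The Laurent form of the polynomial of two vertices joined by three paths with `a`, `b` and `c`
edges. -/
def thetaForm (s : R) (a b c : ℕ) : R :=
  let A := (-s ^ 2) ^ a
  let B := (-s ^ 2) ^ b
  let C := (-s ^ 2) ^ c
  (1 + s + 2 * s ^ 2) ^ 2 * ((1 - A) * (1 - B) * (1 - C))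
    + (2 * (1 + s + 2 * s ^ 2) * (1 + s ^ 2) - (1 + s ^ 2) ^ 2)
      * (A * (1 - B) * (1 - C) + B * (1 - A) * (1 - C) + C * (1 - A) * (1 - B))
    + 2 * (1 + s ^ 2) ^ 2 * (A * B * (1 - C) + A * C * (1 - B) + B * C * (1 - A))
    + 2 * (1 + s ^ 2) ^ 2 * (s ^ (a + b) * (1 - C) + s ^ (a + c) * (1 - B) + s ^ (b + c) * (1 - A))

/-- The Laurent form of the polynomial of a cycle. -/
def cycleForm (s : R) (k : ℕ) : R := 1 + 2 * s ^ k + (-s ^ 2) ^ k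

theorem map_dumbbellForm {S : Type*} [CommRing S] (f : R →+* S) (s : R) (p q r : ℕ) :
    f (dumbbellForm s p q r) = dumbbellForm (f s) p q r := by
  have h2 : f 2 = 2 := map_ofNat f 2
  simp [dumbbellForm, h2]

theorem map_thetaForm {S : Type*} [CommRing S] (f : R →+* S) (s : R) (a b c : ℕ) :
    f (thetaForm s a b c) = thetaForm (f s) a b c := by
  have h2 : f 2 = 2 := map_ofNat f 2
  simp [thetaForm, h2]

theorem map_cycleForm {S : Type*} [CommRing S] (f : R →+* S) (s : R) (k : ℕ) :
    f (cycleForm s k) = cycleForm (f s) k := by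
  have h2 : f 2 = 2 := map_ofNat f 2
  simp [cycleForm, h2]

/-- The roots of `λ² = yλ + 1` with `y = z + s` are `z` and `s`. This is the resulting closed
formula, with denominators cleared and `(-s)^k z^k = 1` used. -/
theorem pathPer_normalized {s z : R} (hz : z * s = -1) (k : ℕ) :
    (-s) ^ k * (z - s) * pathPer (z + s) k = z * (-s ^ 2) ^ k - s := by
  induction k using Nat.strong_induction_on with
  | _ k ih =>
    rcases k with _ | _ | k
    · simp [pathPer]
    · simp only [pathPer]; linear_combination s * hz
    · have h1 := ih (k + 1) (by omega)
      have h0 := ih k (by omega)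
      simp only [pathPer]
      have e : (-s) ^ (k + 2) * (z - s) * ((z + s) * pathPer (z + s) (k + 1) + pathPer (z + s) k)
          = (-s) * (z + s) * ((-s) ^ (k + 1) * (z - s) * pathPer (z + s) (k + 1))
            + s ^ 2 * ((-s) ^ k * (z - s) * pathPer (z + s) k) := by ring
      rw [e, h1, h0, pow_succ (-s ^ 2) (k + 1), pow_succ (-s ^ 2) k]
      linear_combination (s + (-s ^ 2) ^ k * s ^ 2 * z) * hz

end Laurent

section Field

variable {K : Type*} [Field K]

theorem pathPer_normalized_succ {s : K} (hs : s ≠ 0) (k : ℕ) :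
    (-s) ^ (k + 1) * (-1 / s - s) * pathPer (-1 / s + s) (k + 1) = s * ((-s ^ 2) ^ k - 1) := by
  rw [pathPer_normalized (by field_simp), pow_succ]
  field_simp

theorem cyclePer_normalized {s : K} (hs : s ≠ 0) (k : ℕ) :
    (-s) ^ (k + 1) * (-1 / s - s) * cyclePer (-1 / s + s) (-1 / s + s - 1) k
      = (s ^ 2 - s - 1) * ((-s ^ 2) ^ k - 1) + 2 * ((-s ^ 2) ^ k + s ^ 2)
        + 2 * (1 + s ^ 2) * s ^ k := by
  have h1 := pathPer_normalized_succ hs k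
  have h0 := pathPer_normalized (show (-1 / s) * s = -1 by field_simp) k
  have e : (-s) ^ (k + 1) * (-1 / s - s) * cyclePer (-1 / s + s) (-1 / s + s - 1) k
      = (-1 / s + s - 1) * ((-s) ^ (k + 1) * (-1 / s - s) * pathPer (-1 / s + s) (k + 1))
        + 2 * (-s) * ((-s) ^ k * (-1 / s - s) * pathPer (-1 / s + s) k)
        + 2 * ((-1) ^ k * (-s) ^ k) * (-s) * (-1 / s - s) := by
    rw [cyclePer]; ring
  rw [e, h1, h0, ← mul_pow, show (-1 : K) * -s = s by ring]
  field_simp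
  ring

theorem dumbbellPer_normalized {s : K} (hs : s ≠ 0) (p q e : ℕ) :
    (-s) ^ (p + q + e) * (1 + s ^ 2) ^ 3 * dumbbellPer (-1 / s + s) p q e
      = dumbbellForm s p q (e + 2) := by
  have cp := cyclePer_normalized hs p
  have cq := cyclePer_normalized hs q
  have rp := pathPer_normalized_succ hs p
  have rq := pathPer_normalized_succ hs q
  have e2 := pathPer_normalized_succ hs (e + 1)
  have e1 := pathPer_normalized_succ hs e
  have e0 := pathPer_normalized (show (-1 / s) * s = -1 by field_simp) e
  set z := -1 / s with hz
  have hN : 1 + s ^ 2 = (-s) * (z - s) := by rw [hz]; field_simp; ring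
  set y := z + s with hy
  -- Since `1 + s² = -s (z - s)`, the extra factor `-s` makes the powers add up to `p + 1`, `q + 1`
  -- and `e + 2`. Each of the three factors in a product thus gets exactly its own normalisation.
  have key : (-s) * ((-s) ^ (p + q + e) * (1 + s ^ 2) ^ 3 * dumbbellPer y p q e)
      = (-s) ^ (p + 1) * (z - s) * cyclePer y (y - 1) p *
        (((y - 1) * ((-s) ^ (e + 1 + 1) * (z - s) * pathPer y (e + 1 + 1))
          + (-s) * ((-s) ^ (e + 1) * (z - s) * pathPer y (e + 1)))
            * ((-s) ^ (q + 1) * (z - s) * pathPer y (q + 1))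
          + (-s) ^ (e + 1 + 1) * (z - s) * pathPer y (e + 1 + 1)
            * ((-s) ^ (q + 1) * (z - s) * cyclePer y (y - 1) q
              - (y - 1) * ((-s) ^ (q + 1) * (z - s) * pathPer y (q + 1))))
      + (-s) ^ (p + 1) * (z - s) * pathPer y (p + 1) *
        ((((y - 1) * ((y - 1) * ((-s) ^ (e + 1 + 1) * (z - s) * pathPer y (e + 1 + 1))
          + (-s) * ((-s) ^ (e + 1) * (z - s) * pathPer y (e + 1)))
          + (y - 1) * (-s) * ((-s) ^ (e + 1) * (z - s) * pathPer y (e + 1))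
          + s ^ 2 * ((-s) ^ e * (z - s) * pathPer y e))
            * ((-s) ^ (q + 1) * (z - s) * pathPer y (q + 1))
          + ((y - 1) * ((-s) ^ (e + 1 + 1) * (z - s) * pathPer y (e + 1 + 1))
          + (-s) * ((-s) ^ (e + 1) * (z - s) * pathPer y (e + 1)))
            * ((-s) ^ (q + 1) * (z - s) * cyclePer y (y - 1) q
              - (y - 1) * ((-s) ^ (q + 1) * (z - s) * pathPer y (q + 1))))
        - (y - 1) * (((y - 1) * ((-s) ^ (e + 1 + 1) * (z - s) * pathPer y (e + 1 + 1))
          + (-s) * ((-s) ^ (e + 1) * (z - s) * pathPer y (e + 1)))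
            * ((-s) ^ (q + 1) * (z - s) * pathPer y (q + 1))
          + (-s) ^ (e + 1 + 1) * (z - s) * pathPer y (e + 1 + 1)
            * ((-s) ^ (q + 1) * (z - s) * cyclePer y (y - 1) q
              - (y - 1) * ((-s) ^ (q + 1) * (z - s) * pathPer y (q + 1))))) := by
    rw [hN, dumbbellPer]
    ring
  have hs' : -s ≠ 0 := neg_ne_zero.2 hs
  apply mul_left_cancel₀ hs'
  rw [key, cp, cq, rp, rq, e2, e1, e0, dumbbellForm, show e + 2 - 1 = e + 1 by omega,
    pow_succ (-s ^ 2) e, hy, hz]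
  generalize (-s ^ 2) ^ p = Wp
  generalize (-s ^ 2) ^ q = Wq
  generalize (-s ^ 2) ^ e = We
  generalize s ^ p = Tp
  generalize s ^ q = Tq
  field_simp
  ring

theorem thetaPer_normalized {s : K} (hs : s ≠ 0) (a b c : ℕ) :
    (-s) ^ (a + b + c + 2) * (1 + s ^ 2) ^ 3 * thetaPer (-1 / s + s) a b c
      = thetaForm s (a + 1) (b + 1) (c + 1) := by
  have a2 := pathPer_normalized_succ hs (a + 1)
  have a1 := pathPer_normalized_succ hs a
  have a0 := pathPer_normalized (show (-1 / s) * s = -1 by field_simp) a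
  have b2 := pathPer_normalized_succ hs (b + 1)
  have b1 := pathPer_normalized_succ hs b
  have b0 := pathPer_normalized (show (-1 / s) * s = -1 by field_simp) b
  have c2 := pathPer_normalized_succ hs (c + 1)
  have c1 := pathPer_normalized_succ hs c
  have c0 := pathPer_normalized (show (-1 / s) * s = -1 by field_simp) c
  set z := -1 / s with hz
  have hN : 1 + s ^ 2 = (-s) * (z - s) := by rw [hz]; field_simp; ring
  set y := z + s with hy
  have sg : ∀ k : ℕ, (-1 : K) ^ k * (-s) ^ k = s ^ k := fun k => by
    rw [← mul_pow]; congr 1; ring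
  -- As for dumbbells, the extra `-s` splits the power of `-s` into `a + 2`, `b + 2` and `c + 2`,
  -- one normalisation for each of the three paths.
  have key : ∀ A2 A1 A0 B2 B1 B0 C2 C1 C0 : K,
      (-s) ^ (a + 1 + 1) * (z - s) * pathPer y (a + 1 + 1) = A2 →
      (-s) ^ (a + 1) * (z - s) * pathPer y (a + 1) = A1 →
      (-s) ^ a * (z - s) * pathPer y a = A0 →
      (-s) ^ (b + 1 + 1) * (z - s) * pathPer y (b + 1 + 1) = B2 →
      (-s) ^ (b + 1) * (z - s) * pathPer y (b + 1) = B1 →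
      (-s) ^ b * (z - s) * pathPer y b = B0 →
      (-s) ^ (c + 1 + 1) * (z - s) * pathPer y (c + 1 + 1) = C2 →
      (-s) ^ (c + 1) * (z - s) * pathPer y (c + 1) = C1 →
      (-s) ^ c * (z - s) * pathPer y c = C0 →
      (-s) * ((-s) ^ (a + b + c + 2) * (1 + s ^ 2) ^ 3 * thetaPer y a b c)
      = (y - 1) * ((y - 1) * A2 * B2 * C2 + (-s) * (A1 * B2 * C2 + A2 * B1 * C2 + A2 * B2 * C1))
        + (-s) * ((y - 1) * A1 * B2 * C2 + (-s) * (A0 * B2 * C2 + A1 * B1 * C2 + A1 * B2 * C1))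
        + (-s) * ((y - 1) * A2 * B1 * C2 + (-s) * (A1 * B1 * C2 + A2 * B0 * C2 + A2 * B1 * C1))
        + (-s) * ((y - 1) * A2 * B2 * C1 + (-s) * (A1 * B2 * C1 + A2 * B1 * C1 + A2 * B2 * C0))
        + 2 * ((s * (s * (z - s))) ^ 2 * (s ^ (a + b) * C2 + s ^ (a + c) * B2
          + s ^ (b + c) * A2)) := by
    rintro _ _ _ _ _ _ _ _ _ rfl rfl rfl rfl rfl rfl rfl rfl rfl
    rw [hN, thetaPer, spiderPer, spiderPer, spiderPer, spiderPer, ← sg (a + b), ← sg (a + c),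
      ← sg (b + c)]
    ring
  apply mul_left_cancel₀ (neg_ne_zero.2 hs)
  rw [key _ _ _ _ _ _ _ _ _ a2 a1 a0 b2 b1 b0 c2 c1 c0, thetaForm]
  simp only [pow_succ (-s ^ 2) a, pow_succ (-s ^ 2) b, pow_succ (-s ^ 2) c]
  rw [hy, hz, show a + 1 + (b + 1) = a + b + 2 by ring, show a + 1 + (c + 1) = a + c + 2 by ring,
    show b + 1 + (c + 1) = b + c + 2 by ring, pow_add s (a + b), pow_add s (a + c),
    pow_add s (b + c)]
  generalize (-s ^ 2) ^ a = Wa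
  generalize (-s ^ 2) ^ b = Wb
  generalize (-s ^ 2) ^ c = Wc
  generalize s ^ (a + b) = Tab
  generalize s ^ (a + c) = Tac
  generalize s ^ (b + c) = Tbc
  field_simp
  ring

theorem cyclePer_free_normalized {s : K} (hs : s ≠ 0) (h : 1 + s ^ 2 ≠ 0) (k : ℕ) :
    (-s) ^ k * cyclePer (-1 / s + s) (-1 / s + s) k = cycleForm s k := by
  have h1 := pathPer_normalized_succ hs k
  have h0 := pathPer_normalized (show (-1 / s) * s = -1 by field_simp) k
  set z := -1 / s with hz
  have hN : 1 + s ^ 2 = (-s) * (z - s) := by rw [hz]; field_simp; ring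
  apply mul_left_cancel₀ h
  have e : (1 + s ^ 2) * ((-s) ^ k * cyclePer (z + s) (z + s) k)
      = (z + s) * ((-s) ^ (k + 1) * (z - s) * pathPer (z + s) (k + 1))
        + 2 * (-s) * ((-s) ^ k * (z - s) * pathPer (z + s) k)
        + 2 * ((-1) ^ k * (-s) ^ k) * (-s) * (z - s) := by
    rw [cyclePer, hN]; ring
  rw [e, h1, h0, ← mul_pow, show (-1 : K) * -s = s by ring, cycleForm, hz]
  field_simp
  ring

end Field

/-! ### Values at `s = ±1` and parity. -/

section Values

/-- At `s = ±1` one has `-s² = -1`, so only the parities of `p`, `q` and `r - 1` matter. -/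
theorem dumbbellForm_values (p q r : ℕ) (hr : 1 ≤ r) :
    (Even p ∧ Even q ∧ ((dumbbellForm (1 : ℤ) p q r = 128 ∧ dumbbellForm (-1 : ℤ) p q r = 128)
      ∨ (dumbbellForm (1 : ℤ) p q r = 0 ∧ dumbbellForm (-1 : ℤ) p q r = 0)))
    ∨ (¬ (Even p ∧ Even q) ∧
      ((dumbbellForm (1 : ℤ) p q r = 96 ∧ dumbbellForm (-1 : ℤ) p q r = -96)
      ∨ (dumbbellForm (1 : ℤ) p q r = 32 ∧ dumbbellForm (-1 : ℤ) p q r = 32)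
      ∨ (dumbbellForm (1 : ℤ) p q r = 80 ∧ dumbbellForm (-1 : ℤ) p q r = 80)
      ∨ (dumbbellForm (1 : ℤ) p q r = 48 ∧ dumbbellForm (-1 : ℤ) p q r = -48))) := by
  obtain ⟨t, rfl⟩ : ∃ t, r = t + 1 := ⟨r - 1, by omega⟩
  have e : ∀ k : ℕ, Even k → (-1 : ℤ) ^ k = 1 := fun k h => h.neg_one_pow
  have o : ∀ k : ℕ, ¬ Even k → (-1 : ℤ) ^ k = -1 := fun k h =>
    (Nat.not_even_iff_odd.1 h).neg_one_pow
  by_cases hp : Even p <;> by_cases hq : Even q <;> by_cases ht : Even t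
  all_goals
    simp only [dumbbellForm, Nat.add_sub_cancel, one_pow, even_two, Even.neg_pow]
    first | rw [e p hp] | rw [o p hp]
    first | rw [e q hq] | rw [o q hq]
    first | rw [e t ht] | rw [o t ht]
    norm_num [hp, hq]

theorem thetaForm_values (a b c : ℕ) :
    ((thetaForm (1 : ℤ) a b c = 80 ∧ thetaForm (-1 : ℤ) a b c = 80)
      ∨ (thetaForm (1 : ℤ) a b c = 48 ∧ thetaForm (-1 : ℤ) a b c = -48))
    ∨ (¬ (Odd a ∧ Odd b) ∧ ((thetaForm (1 : ℤ) a b c = 32 ∧ thetaForm (-1 : ℤ) a b c = 32)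
      ∨ (thetaForm (1 : ℤ) a b c = 0 ∧ thetaForm (-1 : ℤ) a b c = 0))) := by
  have e : ∀ k : ℕ, Even k → (-1 : ℤ) ^ k = 1 := fun k h => h.neg_one_pow
  have o : ∀ k : ℕ, ¬ Even k → (-1 : ℤ) ^ k = -1 := fun k h =>
    (Nat.not_even_iff_odd.1 h).neg_one_pow
  by_cases ha : Even a <;> by_cases hb : Even b <;> by_cases hc : Even c
  all_goals
    simp only [thetaForm, one_pow, even_two, Even.neg_pow, pow_add]
    first | rw [e a ha] | rw [o a ha]
    first | rw [e b hb] | rw [o b hb]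
    first | rw [e c hc] | rw [o c hc]
    norm_num [← Nat.not_even_iff_odd, ha, hb]

theorem cycleForm_values (k : ℕ) :
    (Even k ∧ cycleForm (1 : ℤ) k = 4 ∧ cycleForm (-1 : ℤ) k = 4)
      ∨ (Odd k ∧ cycleForm (1 : ℤ) k = 2 ∧ cycleForm (-1 : ℤ) k = -2) := by
  rcases Nat.even_or_odd k with h | h
  · left; refine ⟨h, ?_⟩; simp [cycleForm, h.neg_one_pow]
  · right; refine ⟨h, ?_⟩; simp [cycleForm, h.neg_one_pow]

theorem prod_cycleForm_values (ks : List ℕ) :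
    (ks = [] ∨ ((ks.map (cycleForm (1 : ℤ))).prod = 2 ∧ (ks.map (cycleForm (-1 : ℤ))).prod = -2)
      ∨ ∃ t : ℤ, 0 < t ∧ (ks.map (cycleForm (1 : ℤ))).prod = 4 * t) := by
  induction ks with
  | nil => left; rfl
  | cons k ks ih =>
    right
    simp only [List.map_cons, List.prod_cons]
    rcases cycleForm_values k with ⟨_, h1, h2⟩ | ⟨_, h1, h2⟩ <;>
      rcases ih with rfl | ⟨h3, h4⟩ | ⟨t, ht, h3⟩ <;>
      simp only [h1, h2, List.map_nil, List.prod_nil]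
    · right; exact ⟨1, by norm_num, by norm_num⟩
    · right; exact ⟨2, by norm_num, by rw [h3]⟩
    · right; exact ⟨4 * t, by linarith, by rw [h3]⟩
    · left; norm_num
    · right; exact ⟨1, by norm_num, by rw [h3]; norm_num⟩
    · right; exact ⟨2 * t, by linarith, by rw [h3]; ring⟩

/-- If `p` and `q` are not both even, the left side at 1 is 32, 48, 80 or 96. A cycle product
divisible by 4 gives 0 or at least 128. The only other cycle product is 2 at `s = 1`, with value -2
at `s = -1`; then `96 = 2 · 48` is the only match at 1, and it has the wrong sign at -1. -/
theorem even_of_eq_mul_prod {p q r : ℕ} (hr : 1 ≤ r) {ks : List ℕ} (hks : ks ≠ []) {c c' : ℤ}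
    (hc : (c = 128 ∧ c' = 128) ∨ (c = 0 ∧ c' = 0) ∨ (c = 96 ∧ c' = -96) ∨ (c = 32 ∧ c' = 32)
      ∨ (c = 80 ∧ c' = 80) ∨ (c = 48 ∧ c' = -48))
    (h1 : dumbbellForm (1 : ℤ) p q r = c * (ks.map (cycleForm (1 : ℤ))).prod)
    (h2 : dumbbellForm (-1 : ℤ) p q r = c' * (ks.map (cycleForm (-1 : ℤ))).prod) :
    Even p ∧ Even q := by
  rcases dumbbellForm_values p q r hr with h | ⟨h, hv⟩
  · exact ⟨h.1, h.2.1⟩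
  exfalso
  rcases prod_cycleForm_values ks with h0 | ⟨h3, h4⟩ | ⟨t, ht, h3⟩
  · exact hks h0
  · rw [h3] at h1
    rw [h4] at h2
    omega
  · rw [h3] at h1
    rcases hc with ⟨rfl, _⟩ | ⟨rfl, _⟩ | ⟨rfl, _⟩ | ⟨rfl, _⟩ | ⟨rfl, _⟩ | ⟨rfl, _⟩ <;> omega

end Values

/-! ### Roots of the cycle forms and divisibility of `dumbbellForm` for even `p`, `q`. -/

section Roots

/-- For even exponents each factor of the first product strictly dominates the corresponding factor
of the second in absolute value, and `|-s²| < 1`. -/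
theorem dumbbellForm_pos {s : ℝ} (h1 : -1 < s) (h2 : s < 0) {p q : ℕ} (hp : Even p) (hq : Even q)
    (hp0 : p ≠ 0) (hq0 : q ≠ 0) (r : ℕ) : 0 < dumbbellForm s p q r := by
  have hs2 : s ^ 2 < 1 := by nlinarith
  have hpow : ∀ k : ℕ, Even k → k ≠ 0 → 0 < s ^ k ∧ s ^ k < 1 ∧ (-s ^ 2) ^ k = (s ^ k) ^ 2 := by
    intro k hk hk0
    refine ⟨hk.pow_pos h2.ne, ?_, ?_⟩
    · obtain ⟨j, rfl⟩ := hk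
      rw [← two_mul, pow_mul]
      exact pow_lt_one₀ (sq_nonneg s) hs2 (by omega)
    · rw [hk.neg_pow, ← pow_mul, ← pow_mul, mul_comm]
  -- Right side minus the expression inside the absolute value is `(1 + s²)(1 - t²)`. Their sum has
  -- constant term `1 + 2s + 3s² = ((1 + 3s)² + 2)/3` in `t` and positive higher coefficients.
  have key : ∀ t : ℝ, 0 < t → t < 1 →
      |s + s ^ 2 + 2 * (1 + s ^ 2) * t + (2 - s + s ^ 2) * t ^ 2|
        < 1 + s + 2 * s ^ 2 + 2 * (1 + s ^ 2) * t + (1 - s) * t ^ 2 := by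
    intro t ht0 ht1
    rw [abs_lt]
    have e1 : 0 < (1 + s ^ 2) * t := by positivity
    have e2 : 0 < t ^ 2 := by positivity
    have e3 : t ^ 2 < 1 := by nlinarith
    constructor
    · nlinarith [sq_nonneg (1 + 3 * s), mul_pos e2 (by nlinarith : 0 < 3 - 2 * s + s ^ 2)]
    · nlinarith [mul_pos (by positivity : 0 < 1 + s ^ 2) (sub_pos.2 e3)]
  have hW : |(-s ^ 2) ^ (r - 1)| ≤ 1 := by
    rw [abs_pow, abs_neg, abs_of_nonneg (sq_nonneg s)]
    exact pow_le_one₀ (sq_nonneg s) hs2.le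
  obtain ⟨p0, p1, p2⟩ := hpow p hp hp0
  obtain ⟨q0, q1, q2⟩ := hpow q hq hq0
  have kp := key _ p0 p1
  have kq := key _ q0 q1
  rw [dumbbellForm, p2, q2]
  set Xp := 1 + s + 2 * s ^ 2 + 2 * (1 + s ^ 2) * s ^ p + (1 - s) * (s ^ p) ^ 2
  set Xq := 1 + s + 2 * s ^ 2 + 2 * (1 + s ^ 2) * s ^ q + (1 - s) * (s ^ q) ^ 2
  set Yp := s + s ^ 2 + 2 * (1 + s ^ 2) * s ^ p + (2 - s + s ^ 2) * (s ^ p) ^ 2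
  set Yq := s + s ^ 2 + 2 * (1 + s ^ 2) * s ^ q + (2 - s + s ^ 2) * (s ^ q) ^ 2
  have h3 : |(-s ^ 2) ^ (r - 1) * (Yp * Yq)| < Xp * Xq := by
    rw [abs_mul, abs_mul]
    calc |(-s ^ 2) ^ (r - 1)| * (|Yp| * |Yq|) ≤ 1 * (|Yp| * |Yq|) := by gcongr
      _ = |Yp| * |Yq| := one_mul _
      _ < Xp * Xq := mul_lt_mul'' kp kq (abs_nonneg _) (abs_nonneg _)
  linarith [(abs_lt.1 h3).2]

/-- For odd `k` and `s = -x` the form is `1 - 2x^k - x^(2k)`, which vanishes for `x^k = √2 - 1`. -/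
theorem exists_cycleForm_root {k : ℕ} (hk : Odd k) :
    ∃ s : ℝ, -1 < s ∧ s < 0 ∧ cycleForm s k = 0 := by
  have hk0 : k ≠ 0 := by rintro rfl; simp at hk
  have h2 : (√2 : ℝ) ^ 2 = 2 := Real.sq_sqrt (by norm_num)
  have h1 : 1 < (√2 : ℝ) := by
    have := Real.sqrt_nonneg 2
    nlinarith
  have h3 : (√2 : ℝ) < 2 := by nlinarith
  set x : ℝ := (√2 - 1) ^ ((k : ℝ)⁻¹) with hx
  have hxk : x ^ k = √2 - 1 := Real.rpow_inv_natCast_pow (by linarith) hk0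
  have hx0 : 0 < x := Real.rpow_pos_of_pos (by linarith) _
  have hx1 : x < 1 := Real.rpow_lt_one (by linarith) (by linarith) (by positivity)
  refine ⟨-x, by linarith, by linarith, ?_⟩
  rw [cycleForm, hk.neg_pow, neg_sq, hk.neg_pow, ← pow_mul, mul_comm 2 k, pow_mul, hxk]
  nlinarith

theorem not_cycleForm_dvd_of_odd {p q r k : ℕ} (hp : Even p) (hq : Even q) (hp0 : p ≠ 0)
    (hq0 : q ≠ 0) (hk : Odd k) : ¬ cycleForm (X : ℤ[X]) k ∣ dumbbellForm X p q r := by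
  rintro ⟨g, hg⟩
  obtain ⟨s, h1, h2, h3⟩ := exists_cycleForm_root hk
  have h4 := congrArg (Polynomial.eval₂RingHom (Int.castRingHom ℝ) s) hg
  rw [map_mul, map_dumbbellForm, map_cycleForm] at h4
  simp only [coe_eval₂RingHom, eval₂_X, h3, zero_mul] at h4
  exact (dumbbellForm_pos h1 h2 hp hq hp0 hq0 r).ne' h4

/-- The two quantities are the cofactors of `1 + t` in the factors of `dumbbellForm` at an even
exponent with `t = s^p`. On the unit circle with `Re s > 0` the first is at least as large as the
second, and strictly larger unless `t = 1`. -/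
theorem normSq_sub_normSq {s t : ℂ} (hs : Complex.normSq s = 1) (ht : Complex.normSq t = 1) :
    Complex.normSq ((1 - s) * t + (1 + s + 2 * s ^ 2))
      = Complex.normSq ((2 - s + s ^ 2) * t + (s + s ^ 2)) + 8 * s.re * (1 - t.re) := by
  have conj_eq : ∀ z : ℂ, Complex.normSq z = 1 → z ≠ 0 ∧ (starRingEnd ℂ) z = z⁻¹ := by
    intro z hz
    have h0 : z ≠ 0 := by rintro rfl; simp at hz
    refine ⟨h0, eq_inv_of_mul_eq_one_left ?_⟩
    rw [← Complex.normSq_eq_conj_mul_self, hz, Complex.ofReal_one]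
  obtain ⟨hs0, hs1⟩ := conj_eq s hs
  obtain ⟨ht0, ht1⟩ := conj_eq t ht
  have hsre : (s.re : ℂ) = (s + s⁻¹) / 2 := by rw [← hs1, Complex.add_conj]; push_cast; ring
  have htre : (t.re : ℂ) = (t + t⁻¹) / 2 := by rw [← ht1, Complex.add_conj]; push_cast; ring
  apply Complex.ofReal_injective
  push_cast
  rw [Complex.normSq_eq_conj_mul_self, Complex.normSq_eq_conj_mul_self, hsre, htre]
  simp only [map_add, map_mul, map_sub, map_pow, map_one, map_ofNat, hs1, ht1]
  field_simp
  ring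

/-- For even `k` the cycle form is `(1 + X^k)²`, with the double root `s = exp(πi/k)`, and
`dumbbellForm = (1 + X^p)(1 + X^q) J`. If `J(s) = 0`, comparing absolute values forces `s^p = s^q =
1`. Otherwise both other factors must vanish at `s`, their roots being simple, so `s^p = s^q = -1`.
Either way `s^(2p) = s^(2q) = 1`, and `s` has order `2k`. -/
theorem even_cycleForm_dvd {p q r k : ℕ} (hp : Even p) (hq : Even q) (hp0 : p ≠ 0)
    (hq0 : q ≠ 0) (hk : Even k) (hk3 : 3 ≤ k)
    (hdvd : cycleForm (X : ℤ[X]) k ∣ dumbbellForm X p q r) : k ∣ p ∧ k ∣ q := by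
  have hprim := Complex.isPrimitiveRoot_exp (2 * k) (by omega)
  set s : ℂ := Complex.exp (2 * Real.pi * Complex.I / (2 * k : ℕ)) with hsdef
  have hsexp : s = Complex.exp ((Real.pi / k : ℝ) * Complex.I) := by
    rw [hsdef]; congr 1; push_cast; field_simp
  have hre : 0 < s.re := by
    rw [hsexp, Complex.exp_ofReal_mul_I_re]
    have hk' : (3 : ℝ) ≤ k := by exact_mod_cast hk3
    have hpi := Real.pi_pos
    apply Real.cos_pos_of_mem_Ioo
    constructor
    · have : 0 < Real.pi / k := by positivity
      linarith
    · rw [div_lt_div_iff₀ (by linarith) (by norm_num)]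
      nlinarith
  have hs1 : ‖s‖ = 1 := by rw [hsexp, Complex.norm_exp_ofReal_mul_I]
  have hsn : ∀ j : ℕ, Complex.normSq (s ^ j) = 1 := fun j => by
    rw [Complex.normSq_eq_norm_sq, norm_pow, hs1, one_pow, one_pow]
  have hs0 : s ≠ 0 := by rintro h; rw [h] at hs1; simp at hs1
  have hsk : s ^ k = -1 := by
    have h1 : (s ^ k) ^ 2 = 1 := by rw [← pow_mul, mul_comm, hprim.pow_eq_one]
    rcases mul_self_eq_one_iff.1 ((sq _).symm.trans h1) with h | h
    · have := Nat.le_of_dvd (by omega) ((hprim.pow_eq_one_iff_dvd k).1 h)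
      omega
    · exact h
  have dvd_of_sq : ∀ j : ℕ, (s ^ j) ^ 2 = 1 → k ∣ j := by
    intro j hj
    rw [← pow_mul, mul_comm] at hj
    exact Nat.dvd_of_mul_dvd_mul_left (by norm_num) ((hprim.pow_eq_one_iff_dvd (2 * j)).1 hj)
  obtain ⟨g, hg⟩ := hdvd
  have hg' := congrArg (Polynomial.mapRingHom (Int.castRingHom ℂ)) hg
  rw [map_mul, map_dumbbellForm, map_cycleForm] at hg'
  simp only [coe_mapRingHom, Polynomial.map_X] at hg'
  set g' : ℂ[X] := g.map (Int.castRingHom ℂ)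
  have hpow : ∀ j : ℕ, Even j → (-(X : ℂ[X]) ^ 2) ^ j = (X ^ j) ^ 2 := fun j hj => by
    rw [hj.neg_pow, ← pow_mul, ← pow_mul, mul_comm]
  let x : ℕ → ℂ[X] := fun j => (1 - X) * X ^ j + (1 + X + 2 * X ^ 2)
  let y : ℕ → ℂ[X] := fun j => (2 - X + X ^ 2) * X ^ j + (X + X ^ 2)
  set J : ℂ[X] := x p * x q - (-X ^ 2) ^ (r - 1) * (y p * y q) with hJ
  have hfac : dumbbellForm (X : ℂ[X]) p q r = (1 + X ^ p) * (1 + X ^ q) * J := by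
    rw [dumbbellForm, hpow p hp, hpow q hq, hJ]
    simp only [x, y]
    ring
  have hcyc : cycleForm (X : ℂ[X]) k = (1 + X ^ k) ^ 2 := by
    rw [cycleForm, hpow k hk]; ring
  rw [hfac, hcyc] at hg'
  by_cases hJ0 : J.eval s = 0
  · have hx : ∀ j, Complex.normSq ((x j).eval s)
        = Complex.normSq ((y j).eval s) + 8 * s.re * (1 - (s ^ j).re) := by
      intro j
      have := normSq_sub_normSq (s := s) (t := s ^ j) (by simpa using hsn 1) (hsn j)
      simpa [x, y] using this
    have hle : ∀ j, (s ^ j).re ≤ 1 := fun j => by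
      have := Complex.re_le_norm (s ^ j)
      rwa [norm_pow, hs1, one_pow] at this
    have hone : ∀ j, (s ^ j).re = 1 → s ^ j = 1 := fun j hj => by
      have h1 := hsn j
      rw [Complex.normSq_apply, hj] at h1
      exact Complex.ext (by simpa using hj) (by simpa using (by nlinarith : (s ^ j).im = 0))
    have hprod : Complex.normSq ((x p).eval s) * Complex.normSq ((x q).eval s)
        = Complex.normSq ((y p).eval s) * Complex.normSq ((y q).eval s) := by
      rw [hJ] at hJ0
      simp only [eval_sub, eval_mul, eval_pow, eval_neg, eval_X, sub_eq_zero] at hJ0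
      have h1 := congrArg Complex.normSq hJ0
      simp only [map_mul, map_pow, Complex.normSq_neg] at h1
      have h2 : Complex.normSq s = 1 := by simpa using hsn 1
      rwa [h2, one_pow, one_pow, one_mul] at h1
    -- If `s^j = 1` the value is `2 + 2s²`; were it zero, then `s⁴ = 1`, against the order `2k ≥ 6`.
    have hxone : ∀ j, s ^ j = 1 → Complex.normSq ((x j).eval s) ≠ 0 := by
      intro j hj h0
      have h1 := Complex.normSq_eq_zero.1 h0
      simp only [x, eval_add, eval_mul, eval_sub, eval_one, eval_X, eval_pow, eval_ofNat, hj] at h1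
      have h2 : s ^ 2 = -1 := by linear_combination h1 / 2
      have h3 : s ^ 4 = 1 := by rw [show s ^ 4 = (s ^ 2) ^ 2 by ring, h2]; norm_num
      have := Nat.le_of_dvd (by norm_num) ((hprim.pow_eq_one_iff_dvd 4).1 h3)
      omega
    -- A strict inequality at `i` is compatible with equal products only if `x j` vanishes at `s`.
    -- Then equality holds at `j`, so `s^j = 1`, which `hxone` excludes.
    have main : ∀ i j, Complex.normSq ((x i).eval s) * Complex.normSq ((x j).eval s)
        = Complex.normSq ((y i).eval s) * Complex.normSq ((y j).eval s) → s ^ i = 1 := by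
      intro i j hij
      apply hone
      by_contra hne
      have hlt : (s ^ i).re < 1 := lt_of_le_of_ne (hle i) hne
      have h1 := hx i
      have h2 := hx j
      have h3 := Complex.normSq_nonneg ((y i).eval s)
      have h4 := Complex.normSq_nonneg ((y j).eval s)
      have h5 := mul_pos hre (sub_pos.2 hlt)
      have h6 := mul_nonneg hre.le (sub_nonneg.2 (hle j))
      have h7 : Complex.normSq ((x j).eval s) = 0 := by
        have h8 := Complex.normSq_nonneg ((x j).eval s)
        by_contra h9
        have h10 : 0 < Complex.normSq ((x j).eval s) := lt_of_le_of_ne h8 (Ne.symm h9)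
        nlinarith
      have h8 : (s ^ j).re = 1 := by
        have : s.re * (1 - (s ^ j).re) = 0 := by nlinarith
        rcases mul_eq_zero.1 this with h | h
        · exact absurd h hre.ne'
        · linarith
      exact hxone j (hone j h8) h7
    exact ⟨dvd_of_sq p (by rw [main p q hprod, one_pow]),
      dvd_of_sq q (by rw [main q p (by rw [mul_comm, hprod, mul_comm]), one_pow])⟩
  · have h0 := congrArg (Polynomial.eval s) hg'
    -- The derivative detects the second order of vanishing: if just one of `1 + X^p`, `1 + X^q`
    -- vanished at `s`, the derivative of the product would not.
    have h1 := congrArg (fun f => Polynomial.eval s (derivative f)) hg'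
    simp only [derivative_mul, derivative_pow, derivative_add, derivative_one, derivative_X,
      eval_add, eval_mul, eval_pow, eval_one, eval_X, hsk] at h0 h1
    simp at h0 h1
    have hne : ∀ j : ℕ, j ≠ 0 → (j : ℂ) * s ^ (j - 1) ≠ 0 := fun j hj =>
      mul_ne_zero (Nat.cast_ne_zero.2 hj) (pow_ne_zero _ hs0)
    have hboth : 1 + s ^ p = 0 ∧ 1 + s ^ q = 0 := by
      rcases h0.resolve_right hJ0 with h2 | h2
      · refine ⟨h2, ?_⟩
        rw [h2] at h1
        simpa [hJ0, hp0, hs0] using h1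
      · refine ⟨?_, h2⟩
        rw [h2] at h1
        simpa [hJ0, hq0, hs0] using h1
    exact ⟨dvd_of_sq p (by rw [show s ^ p = -1 by linear_combination hboth.1]; norm_num),
      dvd_of_sq q (by rw [show s ^ q = -1 by linear_combination hboth.2]; norm_num)⟩

end Roots

/-! ### Expansions at `s = 0` up to order `m + 1`. -/

section LowOrder

theorem X_pow_dvd_of_le {m n : ℕ} (h : m ≤ n) : (X : ℤ[X]) ^ m ∣ X ^ n := pow_dvd_pow X h

theorem X_pow_dvd_neg_sq_pow {m n : ℕ} (h : m ≤ 2 * n) : (X : ℤ[X]) ^ m ∣ (-X ^ 2) ^ n := by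
  rw [neg_pow, ← pow_mul]
  exact Dvd.dvd.mul_left (pow_dvd_pow X h) _

theorem X_pow_dvd_mul_of_le {m i j : ℕ} (h : m ≤ i + j) {f g : ℤ[X]} (hf : X ^ i ∣ f)
    (hg : X ^ j ∣ g) : (X : ℤ[X]) ^ m ∣ f * g :=
  (pow_dvd_pow X h).trans (by rw [pow_add]; exact mul_dvd_mul hf hg)

/-- `dumbbellForm` up to the order following the length of the shortest cycle. -/
theorem dumbbellForm_mod {m p q r : ℕ} (hm : 3 ≤ m) (hp : m ≤ p) (hq : m ≤ q) (hr : 2 ≤ r) :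
    (X : ℤ[X]) ^ (m + 2) ∣ dumbbellForm X p q r
      - ((1 + X + 2 * X ^ 2) ^ 2 - (X + X ^ 2) ^ 2 * (-X ^ 2) ^ (r - 1)
        + 2 * (1 + X) * (X ^ p + X ^ q)) := by
  obtain ⟨W, hW⟩ : (X : ℤ[X]) ^ 2 ∣ (-X ^ 2) ^ (r - 1) := X_pow_dvd_neg_sq_pow (by omega)
  have key : ∀ a b W ea eb : ℤ[X],
      (1 + X + 2 * X ^ 2 + 2 * (1 + X ^ 2) * a + (1 - X) * (ea * (a * a)))
        * (1 + X + 2 * X ^ 2 + 2 * (1 + X ^ 2) * b + (1 - X) * (eb * (b * b)))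
      - X ^ 2 * W * ((X + X ^ 2 + 2 * (1 + X ^ 2) * a + (2 - X + X ^ 2) * (ea * (a * a)))
          * (X + X ^ 2 + 2 * (1 + X ^ 2) * b + (2 - X + X ^ 2) * (eb * (b * b))))
      - ((1 + X + 2 * X ^ 2) ^ 2 - (X + X ^ 2) ^ 2 * (X ^ 2 * W) + 2 * (1 + X) * (a + b))
      = a * X ^ 2 * (2 * (3 + X + 2 * X ^ 2) - W * (2 * (1 + X ^ 2) * (X + X ^ 2)))
      + b * X ^ 2 * (2 * (3 + X + 2 * X ^ 2) - W * (2 * (1 + X ^ 2) * (X + X ^ 2)))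
      + a * a * (((1 + X + 2 * X ^ 2) * (1 - X)
          - X ^ 2 * W * (X + X ^ 2) * (2 - X + X ^ 2)) * ea)
      + b * b * (((1 + X + 2 * X ^ 2) * (1 - X)
          - X ^ 2 * W * (X + X ^ 2) * (2 - X + X ^ 2)) * eb)
      + a * b * ((2 * (1 + X ^ 2) + (1 - X) * ea * a) * (2 * (1 + X ^ 2) + (1 - X) * eb * b)
        - X ^ 2 * W * ((2 * (1 + X ^ 2) + (2 - X + X ^ 2) * ea * a)
          * (2 * (1 + X ^ 2) + (2 - X + X ^ 2) * eb * b))) := by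
    intros; ring
  have hpow : ∀ k : ℕ, (-(X : ℤ[X]) ^ 2) ^ k = (-1) ^ k * (X ^ k * X ^ k) := fun k => by
    rw [neg_pow, ← pow_mul, two_mul, pow_add]
  rw [dumbbellForm, hW, hpow p, hpow q, key]
  have a2 : (X : ℤ[X]) ^ (m + 2) ∣ X ^ p * X ^ 2 := by
    rw [← pow_add]; exact X_pow_dvd_of_le (by omega)
  have b2 : (X : ℤ[X]) ^ (m + 2) ∣ X ^ q * X ^ 2 := by
    rw [← pow_add]; exact X_pow_dvd_of_le (by omega)
  have aa : (X : ℤ[X]) ^ (m + 2) ∣ X ^ p * X ^ p := by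
    rw [← pow_add]; exact X_pow_dvd_of_le (by omega)
  have bb : (X : ℤ[X]) ^ (m + 2) ∣ X ^ q * X ^ q := by
    rw [← pow_add]; exact X_pow_dvd_of_le (by omega)
  have ab : (X : ℤ[X]) ^ (m + 2) ∣ X ^ p * X ^ q := by
    rw [← pow_add]; exact X_pow_dvd_of_le (by omega)
  exact dvd_add (dvd_add (dvd_add (dvd_add (a2.mul_right _) (b2.mul_right _)) (aa.mul_right _))
    (bb.mul_right _)) (ab.mul_right _)

/-- `thetaForm` up to the order following the length of the shortest cycle. -/
theorem thetaForm_mod {m a b c : ℕ} (hab : a ≤ b) (hbc : b ≤ c) (hm : 3 ≤ m)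
    (hmab : m ≤ a + b) :
    (X : ℤ[X]) ^ (m + 2) ∣ thetaForm X a b c
      - ((1 + X + 2 * X ^ 2) ^ 2 - (X + X ^ 2) ^ 2 * (-X ^ 2) ^ a
        + 2 * (X ^ (a + b) + X ^ (a + c) + X ^ (b + c))) := by
  have key : ∀ A B C u v w : ℤ[X],
      (1 + X + 2 * X ^ 2) ^ 2 * ((1 - A) * (1 - B) * (1 - C))
      + (2 * (1 + X + 2 * X ^ 2) * (1 + X ^ 2) - (1 + X ^ 2) ^ 2)
        * (A * (1 - B) * (1 - C) + B * (1 - A) * (1 - C) + C * (1 - A) * (1 - B))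
      + 2 * (1 + X ^ 2) ^ 2 * (A * B * (1 - C) + A * C * (1 - B) + B * C * (1 - A))
      + 2 * (1 + X ^ 2) ^ 2 * (u * (1 - C) + v * (1 - B) + w * (1 - A))
      - ((1 + X + 2 * X ^ 2) ^ 2 - (X + X ^ 2) ^ 2 * A + 2 * (u + v + w))
      = (X ^ 2 * B + X ^ 2 * C) * (-(1 + X) ^ 2)
      + (A * B + A * C + B * C) * ((1 + X + 2 * X ^ 2) ^ 2
        - 2 * (2 * (1 + X + 2 * X ^ 2) * (1 + X ^ 2) - (1 + X ^ 2) ^ 2) + 2 * (1 + X ^ 2) ^ 2)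
      + A * B * C * (-(1 + X + 2 * X ^ 2) ^ 2
        + 3 * (2 * (1 + X + 2 * X ^ 2) * (1 + X ^ 2) - (1 + X ^ 2) ^ 2) - 6 * (1 + X ^ 2) ^ 2)
      + (u * X ^ 2 + v * X ^ 2 + w * X ^ 2) * (2 * (2 + X ^ 2))
      + (u * C + v * B + w * A) * (-2 * (1 + X ^ 2) ^ 2) := by
    intros; ring
  rw [thetaForm, key]
  have dA := X_pow_dvd_neg_sq_pow (le_refl (2 * a))
  have dB := X_pow_dvd_neg_sq_pow (le_refl (2 * b))
  have dC := X_pow_dvd_neg_sq_pow (le_refl (2 * c))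
  have dX : (X : ℤ[X]) ^ 2 ∣ X ^ 2 := dvd_rfl
  have e1 := X_pow_dvd_mul_of_le (m := m + 2) (by omega) dX dB
  have e2 := X_pow_dvd_mul_of_le (m := m + 2) (by omega) dX dC
  have e3 := X_pow_dvd_mul_of_le (m := m + 2) (by omega) dA dB
  have e4 := X_pow_dvd_mul_of_le (m := m + 2) (by omega) dA dC
  have e5 := X_pow_dvd_mul_of_le (m := m + 2) (by omega) dB dC
  have e6 := X_pow_dvd_mul_of_le (m := m + 2) (by omega) (dvd_refl (X ^ (a + b))) dX
  have e7 := X_pow_dvd_mul_of_le (m := m + 2) (by omega) (dvd_refl (X ^ (a + c))) dX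
  have e8 := X_pow_dvd_mul_of_le (m := m + 2) (by omega) (dvd_refl (X ^ (b + c))) dX
  have e9 := X_pow_dvd_mul_of_le (m := m + 2) (by omega) (dvd_refl (X ^ (a + b))) dC
  have e10 := X_pow_dvd_mul_of_le (m := m + 2) (by omega) (dvd_refl (X ^ (a + c))) dB
  have e11 := X_pow_dvd_mul_of_le (m := m + 2) (by omega) (dvd_refl (X ^ (b + c))) dA
  exact dvd_add (dvd_add (dvd_add (dvd_add ((dvd_add e1 e2).mul_right _)
    ((dvd_add (dvd_add e3 e4) e5).mul_right _)) ((e3.mul_right _).mul_right _))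
    ((dvd_add (dvd_add e6 e7) e8).mul_right _)) ((dvd_add (dvd_add e9 e10) e11).mul_right _)

theorem X_pow_dvd_sum {m : ℕ} {ks : List ℕ} (hks : ∀ k ∈ ks, m ≤ k) :
    (X : ℤ[X]) ^ m ∣ (ks.map (fun k => (X : ℤ[X]) ^ k)).sum := by
  apply List.dvd_sum
  intro x hx
  obtain ⟨k, hk, rfl⟩ := List.mem_map.1 hx
  exact X_pow_dvd_of_le (hks k hk)

/-- Cross terms and the terms `(-X²)^k` have order at least `2m ≥ m + 2`, so only the linear
contributions `2X^k` remain. -/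
theorem prod_cycleForm_mod {m : ℕ} (hm : 3 ≤ m) {ks : List ℕ} (hks : ∀ k ∈ ks, m ≤ k) :
    (X : ℤ[X]) ^ (m + 2) ∣ (ks.map (cycleForm (X : ℤ[X]))).prod
      - (1 + 2 * (ks.map (fun k => (X : ℤ[X]) ^ k)).sum) := by
  induction ks with
  | nil => simp
  | cons k ks ih =>
    have h1 := ih fun x hx => hks x (List.mem_cons_of_mem _ hx)
    have h2 := X_pow_dvd_sum fun x hx => hks x (List.mem_cons_of_mem _ hx)
    have hk := hks k List.mem_cons_self
    simp only [List.map_cons, List.prod_cons, List.sum_cons]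
    set P := (ks.map (cycleForm (X : ℤ[X]))).prod
    set S := (ks.map (fun k => (X : ℤ[X]) ^ k)).sum
    have e : cycleForm X k * P - (1 + 2 * (X ^ k + S))
        = (P - (1 + 2 * S)) * cycleForm X k + X ^ k * S * 4 + (-X ^ 2) ^ k * (1 + 2 * S) := by
      rw [cycleForm]; ring
    rw [e]
    exact dvd_add (dvd_add (h1.mul_right _)
      ((X_pow_dvd_mul_of_le (by omega) (dvd_refl (X ^ k)) h2).mul_right _))
      ((X_pow_dvd_neg_sq_pow (by omega)).mul_right _)

/-- As the sum over the cycles starts at order `m`, only `T` modulo `X²` matters for it. This is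
where the weight `1 + 2X` of an extra cycle comes from. -/
theorem mul_prod_cycleForm_mod {m : ℕ} (hm : 3 ≤ m) {ks : List ℕ} (hks : ∀ k ∈ ks, m ≤ k)
    {F T : ℤ[X]} (hF : X ^ (m + 2) ∣ F - T) (hT : X ^ 2 ∣ T - (1 + 2 * X)) :
    (X : ℤ[X]) ^ (m + 2) ∣ F * (ks.map (cycleForm (X : ℤ[X]))).prod
      - (T + 2 * (1 + 2 * X) * (ks.map (fun k => (X : ℤ[X]) ^ k)).sum) := by
  have h1 := prod_cycleForm_mod hm hks
  have h2 := X_pow_dvd_sum hks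
  set P := (ks.map (cycleForm (X : ℤ[X]))).prod
  set S := (ks.map (fun k => (X : ℤ[X]) ^ k)).sum
  have e : F * P - (T + 2 * (1 + 2 * X) * S)
      = (F - T) * P + (P - (1 + 2 * S)) * T + S * (T - (1 + 2 * X)) * 2 := by ring
  rw [e]
  exact dvd_add (dvd_add (hF.mul_right _) (h1.mul_right _))
    ((X_pow_dvd_mul_of_le (by omega) h2 hT).mul_right _)

theorem coeff_neg_sq_pow (a j : ℕ) :
    ((X + X ^ 2) ^ 2 * (-(X : ℤ[X]) ^ 2) ^ a).coeff (j + 2)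
      = (-1) ^ a * (((1 : ℤ[X]) + 2 * X + X ^ 2) * X ^ (2 * a)).coeff j := by
  rw [neg_pow, ← pow_mul, show (X + X ^ 2) ^ 2 * ((-1) ^ a * (X : ℤ[X]) ^ (2 * a))
    = C ((-1) ^ a) * (((1 + 2 * X + X ^ 2) * X ^ (2 * a)) * X ^ 2) by
      simp only [map_pow, map_neg, map_one]; ring, coeff_C_mul, coeff_mul_X_pow]

/-- The contributions of the paths are odd, so they have to cancel. -/
theorem path_terms_cancel {M a b : ℕ} {Z : ℤ[X]}
    (h : X ^ M ∣ 2 * Z + ((X + X ^ 2) ^ 2 * (-X ^ 2) ^ b - (X + X ^ 2) ^ 2 * (-X ^ 2) ^ a)) :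
    (a = b ∨ (M ≤ 2 * a + 2 ∧ M ≤ 2 * b + 2)) ∧ ∀ j < M, Z.coeff j = 0 := by
  have hdvd : ∀ e, M ≤ 2 * e + 2 → X ^ M ∣ (X + X ^ 2) ^ 2 * (-(X : ℤ[X]) ^ 2) ^ e := fun e he =>
    X_pow_dvd_mul_of_le (i := 2) (j := 2 * e) (by omega) ⟨(1 + X) ^ 2, by ring⟩
      (X_pow_dvd_neg_sq_pow le_rfl)
  have hself : ∀ e, ((X + X ^ 2) ^ 2 * (-(X : ℤ[X]) ^ 2) ^ e).coeff (2 * e + 2) = (-1) ^ e := by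
    intro e
    rw [coeff_neg_sq_pow, coeff_mul_X_pow', if_pos le_rfl, Nat.sub_self]
    simp [coeff_zero_eq_eval_zero]
  have hlow : ∀ e f, f < e → ((X + X ^ 2) ^ 2 * (-(X : ℤ[X]) ^ 2) ^ e).coeff (2 * f + 2) = 0 := by
    intro e f hfe
    rw [coeff_neg_sq_pow, coeff_mul_X_pow', if_neg (by omega), mul_zero]
  have hcoeff : ∀ j < M, 2 * Z.coeff j + (((X + X ^ 2) ^ 2 * (-(X : ℤ[X]) ^ 2) ^ b).coeff j
      - ((X + X ^ 2) ^ 2 * (-(X : ℤ[X]) ^ 2) ^ a).coeff j) = 0 := by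
    intro j hj
    have := X_pow_dvd_iff.1 h j hj
    rwa [coeff_add, coeff_sub, coeff_ofNat_mul] at this
  have hone : ∀ e : ℕ, (-1 : ℤ) ^ e = 1 ∨ (-1 : ℤ) ^ e = -1 := fun e => neg_one_pow_eq_or ℤ e
  -- If `a ≠ b`, the difference of the path terms has coefficient `±1` in degree `2 min(a, b) + 2`,
  -- which the even polynomial `2 * Z` cannot cancel.
  have hab : a = b ∨ (M ≤ 2 * a + 2 ∧ M ≤ 2 * b + 2) := by
    rcases lt_trichotomy a b with hlt | heq | hlt
    · right
      by_contra hcon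
      have h1 := hcoeff (2 * a + 2) (by omega)
      rw [hself, hlow b a hlt] at h1
      have := hone a
      omega
    · exact Or.inl heq
    · right
      by_contra hcon
      have h1 := hcoeff (2 * b + 2) (by omega)
      rw [hself, hlow a b hlt] at h1
      have := hone b
      omega
  refine ⟨hab, fun j hj => ?_⟩
  have h1 := hcoeff j hj
  rcases hab with rfl | ⟨h2, h3⟩
  · omega
  · rw [X_pow_dvd_iff.1 (hdvd a h2) j hj, X_pow_dvd_iff.1 (hdvd b h3) j hj] at h1
    omega

theorem coeff_sum_X_pow (ks : List ℕ) (j : ℕ) :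
    ((ks.map (fun k => (X : ℤ[X]) ^ k)).sum).coeff j = ks.count j := by
  induction ks with
  | nil => simp
  | cons k ks ih =>
    rw [List.map_cons, List.sum_cons, coeff_add, ih, coeff_X_pow, List.count_cons]
    by_cases h : j = k
    · subst h; simp [add_comm]
    · simp [h, Ne.symm h]

end LowOrder

/-! ### The polynomial identity determines the parameters. -/

section Arithmetic

theorem eq_of_X_pow_mul_eq {i j : ℕ} {u v : ℤ} {f g : ℤ[X]} (hu : u ≠ 0) (hv : v ≠ 0)
    (h : X ^ i * (C u + X * f) = X ^ j * (C v + X * g)) : u = v := by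
  have hc : ∀ (k l : ℕ) (w : ℤ) (f : ℤ[X]), k ≤ l →
      ((X : ℤ[X]) ^ l * (C w + X * f)).coeff k = if k = l then w else 0 := by
    intro k l w f hkl
    rw [mul_comm, coeff_mul_X_pow']
    rcases hkl.eq_or_lt with rfl | h1
    · simp
    · rw [if_neg (by omega), if_neg (by omega)]
  rcases lt_trichotomy i j with hij | rfl | hij
  · have h1 := congrArg (fun f => Polynomial.coeff f i) h
    simp only [hc i i u f le_rfl, hc i j v g hij.le, if_true, if_neg hij.ne] at h1
    exact absurd h1 hu
  · have h1 := congrArg (fun f => Polynomial.coeff f i) h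
    simpa only [hc i i u f le_rfl, hc i i v g le_rfl, if_true] using h1
  · have h1 := congrArg (fun f => Polynomial.coeff f j) h
    simp only [hc j i u f hij.le, hc j j v g le_rfl, if_true, if_neg hij.ne] at h1
    exact absurd h1.symm hv

/-- In the difference the shorter cycle `q` contributes the lowest term `2X^q` and the shorter path
the lowest term `±X^(2r')`. Coefficients 2 and `±1` never cancel, even in equal degrees. -/
theorem dumbbellForm_ne {p q q' r r' : ℕ} (hp : 3 ≤ p) (hq : 3 ≤ q) (hqq : q < q') (hr : 2 ≤ r')
    (hrr : r' < r) : dumbbellForm (X : ℤ[X]) p q r ≠ dumbbellForm X p q' r' := by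
  intro h
  have hd : ∀ {i j : ℕ}, i ≤ j → ∃ f : ℤ[X], X ^ j = X ^ i * f := fun hij => pow_dvd_pow X hij
  have hd' : ∀ {i j : ℕ}, i ≤ 2 * j → ∃ f : ℤ[X], (-X ^ 2) ^ j = X ^ i * f := fun hij =>
    X_pow_dvd_neg_sq_pow hij
  obtain ⟨P, hP⟩ := hd (show 2 ≤ p by omega)
  obtain ⟨P', hP'⟩ := hd' (show 2 ≤ 2 * p by omega)
  obtain ⟨Q, hQ⟩ := hd (show 2 ≤ q by omega)
  obtain ⟨Q2, hQ2⟩ := hd' (show q + 1 ≤ 2 * q by omega)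
  obtain ⟨Q3, hQ3⟩ := hd (show q + 1 ≤ q' by omega)
  obtain ⟨Q4, hQ4⟩ := hd' (show q + 1 ≤ 2 * q' by omega)
  obtain ⟨V, hV⟩ := hd' (show 1 ≤ 2 * (r - r') by omega)
  have hW : (-(X : ℤ[X]) ^ 2) ^ (r - 1) = (-X ^ 2) ^ (r' - 1) * (X * V) := by
    rw [show r - 1 = (r' - 1) + (r - r') by omega, pow_add, hV, pow_one]
  have hW' : (-(X : ℤ[X]) ^ 2) ^ (r' - 1) = C ((-1) ^ (r' - 1)) * X ^ (2 * (r' - 1)) := by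
    rw [neg_pow, ← pow_mul]; simp
  rw [dumbbellForm, dumbbellForm, hW, hW', hP', hQ2, hQ4, hQ3, pow_succ X q, hP] at h
  set e : ℤ := (-1) ^ (r' - 1) with he
  set t := 2 * (r' - 1)
  have hL : X ^ q * (C (2 : ℤ) + X * (
        (2 * X + (1 - X) * Q2 - 2 * (1 + X ^ 2) * Q3 - (1 - X) * Q4)
        + (1 + 2 * X + 2 * (1 + X ^ 2) * (X * P) + (1 - X) * (X * P'))
          * (2 + X * (2 * X + (1 - X) * Q2 - 2 * (1 + X ^ 2) * Q3 - (1 - X) * Q4))))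
      = X ^ (t + 2) * (C (-e) + X * (C e * (
        -(1 + 2 * (1 + X ^ 2) * P + (2 - X + X ^ 2) * P')
        + (1 + X * (1 + 2 * (1 + X ^ 2) * P + (2 - X + X ^ 2) * P'))
          * (V * (1 + X + 2 * (1 + X ^ 2) * X * Q + (2 - X + X ^ 2) * (X ^ 2 * Q * Q2))
            - (1 + 2 * (1 + X ^ 2) * X * Q * Q3 + (2 - X + X ^ 2) * X * Q * Q4))))) := by
    rw [hQ] at h ⊢
    rw [map_neg, pow_add X t 2, map_ofNat]
    generalize C e = E at h ⊢
    linear_combination h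
  have := eq_of_X_pow_mul_eq (by norm_num) (by simp [he]) hL
  rcases neg_one_pow_eq_or ℤ (r' - 1) with h1 | h1 <;> rw [he, h1] at this <;> omega

theorem ite_one_zero_nonneg (P : Prop) [Decidable P] : 0 ≤ (if P then (1 : ℤ) else 0) := by
  split_ifs <;> norm_num

theorem ite_one_zero_le (P : Prop) [Decidable P] : (if P then (1 : ℤ) else 0) ≤ 1 := by
  split_ifs <;> norm_num

theorem exists_least (p q : ℕ) (l : List ℕ) : ∃ m, (m = p ∨ m = q ∨ m ∈ l) ∧ m ≤ p ∧ m ≤ q ∧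
    ∀ k ∈ l, m ≤ k := by
  classical
  have hex : ∃ m, m = p ∨ m = q ∨ m ∈ l := ⟨p, Or.inl rfl⟩
  exact ⟨Nat.find hex, Nat.find_spec hex, Nat.find_min' hex (Or.inl rfl),
    Nat.find_min' hex (Or.inr (Or.inl rfl)), fun k hk => Nat.find_min' hex (Or.inr (Or.inr hk))⟩

theorem coeff_one_add_X_mul (f : ℤ[X]) (j : ℕ) :
    ((1 + X) * f).coeff (j + 1) = f.coeff (j + 1) + f.coeff j := by
  rw [add_mul, one_mul, coeff_add, coeff_X_mul]

theorem coeff_one_add_two_X_mul (f : ℤ[X]) (j : ℕ) :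
    ((1 + 2 * X) * f).coeff (j + 1) = f.coeff (j + 1) + 2 * f.coeff j := by
  rw [add_mul, one_mul, coeff_add, mul_assoc, coeff_ofNat_mul, coeff_X_mul]

/-- The hypothesis `hF` lists the values at `±1` that `dumbbellForm` and `thetaForm` can take, so
`F` may be either kind of core. -/
theorem dvd_of_form_eq {p q r : ℕ} (hp : 3 ≤ p) (hq : 3 ≤ q) (hr : 2 ≤ r) {ks : List ℕ}
    (hks : ∀ k ∈ ks, 3 ≤ k) (hne : ks ≠ []) {F : ℤ[X]}
    (hF : ((F.eval 1 = 128 ∧ F.eval (-1) = 128) ∨ (F.eval 1 = 0 ∧ F.eval (-1) = 0)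
      ∨ (F.eval 1 = 96 ∧ F.eval (-1) = -96) ∨ (F.eval 1 = 32 ∧ F.eval (-1) = 32)
      ∨ (F.eval 1 = 80 ∧ F.eval (-1) = 80) ∨ (F.eval 1 = 48 ∧ F.eval (-1) = -48)))
    (h : dumbbellForm X p q r = F * (ks.map (cycleForm (X : ℤ[X]))).prod) :
    Even p ∧ Even q ∧ ∀ k ∈ ks, k ∣ p ∧ k ∣ q := by
  have hev : ∀ s : ℤ, dumbbellForm s p q r = F.eval s * (ks.map (cycleForm s)).prod := by
    intro s
    have h1 := congrArg (Polynomial.evalRingHom s) h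
    rw [map_mul, map_dumbbellForm, map_list_prod, List.map_map] at h1
    simp only [coe_evalRingHom, eval_X] at h1
    rw [h1]
    congr 3
    funext k
    simp only [Function.comp]
    rw [← coe_evalRingHom, map_cycleForm]; simp
  obtain ⟨ep, eq⟩ := even_of_eq_mul_prod (by omega) hne hF (hev 1) (hev (-1))
  refine ⟨ep, eq, fun k hk => ?_⟩
  have hdvd : cycleForm (X : ℤ[X]) k ∣ dumbbellForm X p q r := by
    rw [h]
    exact (List.dvd_prod (List.mem_map_of_mem hk)).mul_left F
  rcases Nat.even_or_odd k with hk2 | hk2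
  · exact even_cycleForm_dvd ep eq (by omega) (by omega) hk2 (hks k hk) hdvd
  · exact absurd hdvd (not_cycleForm_dvd_of_odd ep eq (by omega) (by omega) hk2)

theorem eval_dumbbellForm (s : ℤ) (p q r : ℕ) :
    (dumbbellForm (X : ℤ[X]) p q r).eval s = dumbbellForm s p q r := by
  rw [← coe_evalRingHom, map_dumbbellForm]; simp

theorem eval_thetaForm (s : ℤ) (a b c : ℕ) :
    (thetaForm (X : ℤ[X]) a b c).eval s = thetaForm s a b c := by
  rw [← coe_evalRingHom, map_thetaForm]; simp

theorem eval_cycleForm (s : ℤ) (k : ℕ) :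
    (cycleForm (X : ℤ[X]) k).eval s = cycleForm s k := by
  rw [← coe_evalRingHom, map_cycleForm]; simp

/-- Half the coefficient of `X^(j+1)` once the path terms have cancelled: a dumbbell cycle of length
`k` counts as `X^k + X^(k+1)`, an extra cycle as `X^k + 2X^(k+1)`. -/
theorem dumbbellForm_coeff_eq {p q r p' q' r' m : ℕ} (hm : 3 ≤ m) (hp : m ≤ p) (hq : m ≤ q)
    (hr : 2 ≤ r) (hp' : m ≤ p') (hq' : m ≤ q') (hr' : 2 ≤ r') {ks : List ℕ}
    (hks : ∀ k ∈ ks, m ≤ k)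
    (h : dumbbellForm X p q r
      = dumbbellForm X p' q' r' * (ks.map (cycleForm (X : ℤ[X]))).prod) (j : ℕ) (hj : j < m + 1) :
    (if j + 1 = p then 1 else 0) + (if j + 1 = q then 1 else 0)
      + ((if j = p then 1 else 0) + (if j = q then 1 else 0))
      = (if j + 1 = p' then 1 else 0) + (if j + 1 = q' then 1 else 0)
      + ((if j = p' then 1 else 0) + (if j = q' then 1 else 0))
      + ((ks.count (j + 1) : ℤ) + 2 * ks.count j) := by
  have h1 := dumbbellForm_mod hm hp hq hr
  have h2 := mul_prod_cycleForm_mod hm hks (dumbbellForm_mod hm hp' hq' hr') (by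
    have e1 : (X : ℤ[X]) ^ 2 ∣ X ^ p' := X_pow_dvd_of_le (by omega)
    have e2 : (X : ℤ[X]) ^ 2 ∣ X ^ q' := X_pow_dvd_of_le (by omega)
    have e : (1 + X + 2 * X ^ 2) ^ 2 - (X + X ^ 2) ^ 2 * (-(X : ℤ[X]) ^ 2) ^ (r' - 1)
        + 2 * (1 + X) * (X ^ p' + X ^ q') - (1 + 2 * X)
        = X ^ 2 * (5 + 4 * X + 4 * X ^ 2 - (1 + X) ^ 2 * (-(X : ℤ[X]) ^ 2) ^ (r' - 1))
          + (X ^ p' + X ^ q') * (2 * (1 + X)) := by ring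
    rw [e]
    exact dvd_add (dvd_mul_right _ _) ((dvd_add e1 e2).mul_right _))
  rw [← h] at h2
  have h3 := dvd_sub h2 h1
  have h4 := (path_terms_cancel (M := m + 2) (a := r - 1) (b := r' - 1)
    (Z := (1 + X) * (X ^ p + X ^ q) - (1 + X) * (X ^ p' + X ^ q')
      - (1 + 2 * X) * (ks.map (fun k => (X : ℤ[X]) ^ k)).sum) (by
        convert h3 using 1; ring)).2 (j + 1) (by omega)
  rw [coeff_sub, coeff_sub, coeff_one_add_X_mul, coeff_one_add_X_mul, coeff_one_add_two_X_mul,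
    coeff_sum_X_pow, coeff_sum_X_pow] at h4
  simp only [coeff_add, coeff_X_pow] at h4
  linarith

/-- A cycle of the theta graph counts as `X^k` only. The first conclusion compares the connecting
path of the dumbbell with the shortest path of the theta graph. -/
theorem thetaForm_coeff_eq {p q r a b c m : ℕ} (hm : 3 ≤ m) (hp : m ≤ p) (hq : m ≤ q)
    (hr : 2 ≤ r) (hab : a ≤ b) (hbc : b ≤ c) (hmab : m ≤ a + b) {ks : List ℕ}
    (hks : ∀ k ∈ ks, m ≤ k)
    (h : dumbbellForm X p q r
      = thetaForm X a b c * (ks.map (cycleForm (X : ℤ[X]))).prod) :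
    (a + 1 = r ∨ m ≤ 2 * a) ∧ ∀ j < m + 1, (if j + 1 = p then 1 else 0) + (if j + 1 = q then 1 else 0)
      + ((if j = p then 1 else 0) + (if j = q then 1 else 0))
      = (if j + 1 = a + b then 1 else 0) + (if j + 1 = a + c then 1 else 0)
      + (if j + 1 = b + c then 1 else 0)
      + ((ks.count (j + 1) : ℤ) + 2 * ks.count j) := by
  have h1 := dumbbellForm_mod hm hp hq hr
  have h2 := mul_prod_cycleForm_mod hm hks (thetaForm_mod hab hbc hm hmab) (by
    have e1 : (X : ℤ[X]) ^ 2 ∣ X ^ (a + b) := X_pow_dvd_of_le (by omega)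
    have e2 : (X : ℤ[X]) ^ 2 ∣ X ^ (a + c) := X_pow_dvd_of_le (by omega)
    have e3 : (X : ℤ[X]) ^ 2 ∣ X ^ (b + c) := X_pow_dvd_of_le (by omega)
    have e : (1 + X + 2 * X ^ 2) ^ 2 - (X + X ^ 2) ^ 2 * (-(X : ℤ[X]) ^ 2) ^ a
        + 2 * (X ^ (a + b) + X ^ (a + c) + X ^ (b + c)) - (1 + 2 * X)
        = X ^ 2 * (5 + 4 * X + 4 * X ^ 2 - (1 + X) ^ 2 * (-(X : ℤ[X]) ^ 2) ^ a)
          + (X ^ (a + b) + X ^ (a + c) + X ^ (b + c)) * 2 := by ring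
    rw [e]
    exact dvd_add (dvd_mul_right _ _) ((dvd_add (dvd_add e1 e2) e3).mul_right _))
  rw [← h] at h2
  have h3 := dvd_sub h2 h1
  obtain ⟨h5, h6⟩ := path_terms_cancel (M := m + 2) (a := r - 1) (b := a)
    (Z := (1 + X) * (X ^ p + X ^ q) - (X ^ (a + b) + X ^ (a + c) + X ^ (b + c))
      - (1 + 2 * X) * (ks.map (fun k => (X : ℤ[X]) ^ k)).sum) (by
        convert h3 using 1; ring)
  refine ⟨by omega, fun j hj => ?_⟩
  have h4 := h6 (j + 1) (by omega)
  rw [coeff_sub, coeff_sub, coeff_one_add_X_mul, coeff_one_add_two_X_mul,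
    coeff_sum_X_pow, coeff_sum_X_pow] at h4
  simp only [coeff_add, coeff_X_pow] at h4
  linarith

theorem dumbbellForm_comm {R : Type*} [CommRing R] (s : R) (p q r : ℕ) :
    dumbbellForm s p q r = dumbbellForm s q p r := by
  rw [dumbbellForm, dumbbellForm]; ring

theorem dumbbell_of_dumbbellForm_eq {p q r p' q' r' : ℕ} (hp : 3 ≤ p) (hq : 3 ≤ q) (hr : 2 ≤ r)
    (hp' : 3 ≤ p') (hq' : 3 ≤ q') (hr' : 2 ≤ r') {ks : List ℕ} (hks : ∀ k ∈ ks, 3 ≤ k)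
    (hsum : p + q + r = p' + q' + r' + ks.sum)
    (h : dumbbellForm X p q r
      = dumbbellForm X p' q' r' * (ks.map (cycleForm (X : ℤ[X]))).prod) :
    ks = [] ∧ r' = r ∧ ((p' = p ∧ q' = q) ∨ (p' = q ∧ q' = p)) := by
  obtain ⟨m, hm, hmp, hmq, hml⟩ := exists_least p q (p' :: q' :: ks)
  have hmp' : m ≤ p' := hml p' (by simp)
  have hmq' : m ≤ q' := hml q' (by simp)
  have hmk : ∀ k ∈ ks, m ≤ k := fun k hk => hml k (by simp [hk])
  have hm' : m = p ∨ m = q ∨ m = p' ∨ m = q' ∨ m ∈ ks := by simpa using hm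
  have hm3 : 3 ≤ m := by
    rcases hm' with h | h | h | h | h
    · omega
    · omega
    · omega
    · omega
    · exact hks m h
  have hc := dumbbellForm_coeff_eq hm3 hmp hmq hr hmp' hmq' hr' hmk h
  have hc0 := hc (m - 1) (by omega)
  have hc1 := hc m (by omega)
  rw [show m - 1 + 1 = m by omega] at hc0
  have hcount : ks.count (m - 1) = 0 := List.count_eq_zero.2 fun hmem => by
    have := hmk _ hmem; omega
  rw [hcount, Nat.cast_zero, if_neg (show ¬ m - 1 = p by omega), if_neg (show ¬ m - 1 = q by omega),
    if_neg (show ¬ m - 1 = p' by omega), if_neg (show ¬ m - 1 = q' by omega)] at hc0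
  have hpq : m = p ∨ m = q := by
    by_contra hcon
    push Not at hcon
    rw [if_neg hcon.1, if_neg hcon.2] at hc0
    have n1 := ite_one_zero_nonneg (m = p')
    have n2 := ite_one_zero_nonneg (m = q')
    have n3 : (0 : ℤ) ≤ ks.count m := Nat.cast_nonneg _
    rcases hm' with h1 | h1 | h1 | h1 | h1
    · exact hcon.1 h1
    · exact hcon.2 h1
    · rw [if_pos h1] at hc0; linarith
    · rw [if_pos h1] at hc0; linarith
    · have h4 : (0 : ℤ) < ks.count m := Nat.cast_pos.2 (List.count_pos_iff.2 h1)
      linarith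
  by_cases hne : ks = []
  · subst hne
    refine ⟨rfl, ?_⟩
    simp only [List.map_nil, List.prod_nil, mul_one, List.sum_nil, add_zero] at h hsum
    simp only [List.count_nil] at hc0
    -- Once one cycle is matched, the equal sums make a longer second cycle go with a shorter path,
    -- the situation excluded by `dumbbellForm_ne`.
    have main : ∀ {p q r p' q' r' : ℕ}, 3 ≤ p → 3 ≤ q → 2 ≤ r → 3 ≤ q' → 2 ≤ r' → p = p' →
        p + q + r = p' + q' + r' → dumbbellForm (X : ℤ[X]) p q r = dumbbellForm X p' q' r' →
        r' = r ∧ q' = q := by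
      intro p q r p' q' r' hp hq hr hq' hr' hpp hsum h
      subst hpp
      rcases lt_trichotomy q q' with h1 | h1 | h1
      · exact absurd h (dumbbellForm_ne hp hq h1 hr' (by omega))
      · omega
      · exact absurd h.symm (dumbbellForm_ne hp hq' h1 hr (by omega))
    have hpq' : m = p' ∨ m = q' := by
      by_contra hcon
      push Not at hcon
      rw [if_neg hcon.1, if_neg hcon.2] at hc0
      split_ifs at hc0 <;> omega
    rcases hpq with h1 | h1 <;> rcases hpq' with h2 | h2
    · have := main hp hq hr hq' hr' (by omega) hsum h
      omega
    · have := main hp hq hr hp' hr' (by omega : p = q') (by omega)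
        (h.trans (dumbbellForm_comm _ _ _ _))
      omega
    · have := main hq hp hr hq' hr' (by omega : q = p') (by omega)
        ((dumbbellForm_comm _ _ _ _).trans h)
      omega
    · have := main hq hp hr hp' hr' (by omega : q = q') (by omega)
        ((dumbbellForm_comm _ _ _ _).trans (h.trans (dumbbellForm_comm _ _ _ _)))
      omega
  · exfalso
    obtain ⟨_, _, hdvd⟩ := dvd_of_form_eq hp hq hr hks hne (by
      rw [eval_dumbbellForm, eval_dumbbellForm]
      rcases dumbbellForm_values p' q' r' (by omega) with
        ⟨_, _, h | h⟩ | ⟨_, h | h | h | h⟩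
      · exact Or.inl h
      · exact Or.inr (Or.inl h)
      · exact Or.inr (Or.inr (Or.inl h))
      · exact Or.inr (Or.inr (Or.inr (Or.inl h)))
      · exact Or.inr (Or.inr (Or.inr (Or.inr (Or.inl h))))
      · exact Or.inr (Or.inr (Or.inr (Or.inr (Or.inr h))))) h
    obtain ⟨k, hk⟩ := List.exists_mem_of_ne_nil ks hne
    have hkm : k = m := by
      obtain ⟨d1, d2⟩ := hdvd k hk
      have h1 := hmk k hk
      have h2 := Nat.le_of_dvd (by omega) d1
      have h3 := Nat.le_of_dvd (by omega) d2
      omega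
    subst hkm
    obtain ⟨d1, d2⟩ := hdvd k hk
    have hpos := List.count_pos_iff.2 hk
    have n1 : ¬ k + 1 = p := by
      intro h1; rw [← h1, ← Nat.dvd_add_iff_right (dvd_refl k)] at d1
      have := Nat.le_of_dvd (by omega) d1; omega
    have n2 : ¬ k + 1 = q := by
      intro h1; rw [← h1, ← Nat.dvd_add_iff_right (dvd_refl k)] at d2
      have := Nat.le_of_dvd (by omega) d2; omega
    -- All extra cycles have length `m`, which divides `p` and `q`, so neither is `m + 1`.
    -- Subtracting the `X^m` equation from the `X^(m+1)` equation leaves zero equal to a sum of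
    -- nonnegative terms and the positive number of these cycles.
    rw [if_neg n1, if_neg n2] at hc1
    linarith [ite_one_zero_nonneg (k + 1 = p'), ite_one_zero_nonneg (k + 1 = q'),
      (Nat.cast_nonneg (ks.count (k + 1)) : (0 : ℤ) ≤ _), (Nat.cast_pos.2 hpos : (0 : ℤ) < _)]

theorem thetaForm_comm₁₂ {R : Type*} [CommRing R] (s : R) (a b c : ℕ) :
    thetaForm s a b c = thetaForm s b a c := by
  rw [thetaForm, thetaForm, add_comm a b]; ring

theorem thetaForm_comm₂₃ {R : Type*} [CommRing R] (s : R) (a b c : ℕ) :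
    thetaForm s a b c = thetaForm s a c b := by
  rw [thetaForm, thetaForm, add_comm b c]; ring

/-- The one candidate that the low order terms and divisibility do not exclude. -/
theorem thetaForm_mul_cycleForm_ne {a c : ℕ} (ha : a ≠ 0) :
    dumbbellForm (X : ℤ[X]) (2 * a) (2 * a) (c + 1)
      ≠ thetaForm X a a c * cycleForm X (2 * a) := by
  intro h
  have hs : ∀ s : ℤ, dumbbellForm s (2 * a) (2 * a) (c + 1)
      = thetaForm s a a c * cycleForm s (2 * a) := fun s => by
    rw [← eval_dumbbellForm, h, eval_mul, eval_thetaForm, eval_cycleForm]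
  rcases Nat.even_or_odd a with hae | hao
  · have h2 := hs 2
    have e1 : (-(2 : ℤ) ^ 2) ^ (2 * a) = 2 ^ (2 * a) * 2 ^ (2 * a) := by
      rw [(even_two_mul a).neg_pow, ← pow_mul, two_mul (2 * a), pow_add]
    have e2 : (2 : ℤ) ^ (a + a) = 2 ^ (2 * a) := by rw [two_mul]
    have e3 : (-(2 : ℤ) ^ 2) ^ a = 2 ^ (2 * a) := by rw [hae.neg_pow, pow_mul]
    rw [dumbbellForm, thetaForm, cycleForm, e1, e2, e3, Nat.add_sub_cancel, pow_add 2 a c] at h2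
    have ht : (4 : ℤ) ≤ 2 ^ (2 * a) := by
      calc (4 : ℤ) = 2 ^ 2 := by norm_num
        _ ≤ 2 ^ (2 * a) := pow_le_pow_right₀ (by norm_num) (by omega)
    have hac : 0 < (2 : ℤ) ^ a * 2 ^ c := by positivity
    generalize (2 : ℤ) ^ (2 * a) = t at h2 ht
    generalize (2 : ℤ) ^ a * 2 ^ c = u at h2 hac
    generalize (-(2 : ℤ) ^ 2) ^ c = w at h2
    -- At `s = 2` everything cancels except the terms with `u`, which come from the two long cycles
    -- of the theta graph; the factor is `100 = 4 (1 + s²)²`.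
    have h3 : u * ((t - 1) * (1 + t) ^ 2) = 0 := by
      have : 100 * (u * ((t - 1) * (1 + t) ^ 2)) = 0 := by linear_combination h2
      linarith
    have h4 : 0 < (t - 1) * (1 + t) ^ 2 := mul_pos (by linarith) (by positivity)
    exact (mul_pos hac h4).ne' h3
  -- At `s = 1` the right side is `4 · 80` or `4 · 48`, the left side 128 or 0.
  · have h1 := hs 1
    have hc := cycleForm_values (2 * a)
    have ht := thetaForm_values a a c
    have hd := dumbbellForm_values (2 * a) (2 * a) (c + 1) (by omega)
    have e2 : Even (2 * a) := even_two_mul a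
    have hc' : cycleForm (1 : ℤ) (2 * a) = 4 := by
      rcases hc with hc | hc
      · exact hc.2.1
      · exact absurd hc.1 (Nat.not_odd_iff_even.2 e2)
    rw [hc'] at h1
    rcases ht with ht | ht
    · rcases hd with hd | hd
      · omega
      · exact hd.1 ⟨e2, e2⟩
    · exact ht.1 ⟨hao, hao⟩

theorem dumbbellForm_ne_thetaForm_mul {p q r a b c : ℕ} (hp : 3 ≤ p) (hq : 3 ≤ q) (hr : 2 ≤ r)
    (hab : a ≤ b) (hbc : b ≤ c) (hab3 : 3 ≤ a + b) {ks : List ℕ}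
    (hks : ∀ k ∈ ks, 3 ≤ k) (hsum : p + q + r = a + b + c + 1 + ks.sum) :
    dumbbellForm X p q r ≠ thetaForm X a b c * (ks.map (cycleForm (X : ℤ[X]))).prod := by
  intro h
  obtain ⟨m, hm, hmp, hmq, hml⟩ := exists_least p q ((a + b) :: ks)
  have hmab : m ≤ a + b := hml (a + b) (by simp)
  have hmk : ∀ k ∈ ks, m ≤ k := fun k hk => hml k (by simp [hk])
  have hm' : m = p ∨ m = q ∨ m = a + b ∨ m ∈ ks := by simpa using hm
  have hm3 : 3 ≤ m := by
    rcases hm' with h | h | h | h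
    · omega
    · omega
    · omega
    · exact hks m h
  obtain ⟨hpath, hc⟩ := thetaForm_coeff_eq hm3 hmp hmq hr hab hbc hmab hmk h
  have hc0 := hc (m - 1) (by omega)
  have hc1 := hc m (by omega)
  rw [show m - 1 + 1 = m by omega] at hc0
  have hcount : ks.count (m - 1) = 0 := List.count_eq_zero.2 fun hmem => by
    have := hmk _ hmem; omega
  rw [hcount, Nat.cast_zero, if_neg (show ¬ m - 1 = p by omega), if_neg (show ¬ m - 1 = q by omega)] at hc0
  by_cases hne : ks = []
  · subst hne
    simp only [List.count_nil, List.sum_nil, add_zero, Nat.cast_zero] at hc0 hc1 hsum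
    have n0 := ite_one_zero_nonneg (m = p)
    have n1 := ite_one_zero_nonneg (m = q)
    have hmab' : m = a + b := by
      by_contra hcon
      rw [if_neg hcon, if_neg (show ¬ m = a + c by omega), if_neg (show ¬ m = b + c by omega)]
        at hc0
      rcases hm' with h1 | h1 | h1 | h1
      · rw [if_pos h1] at hc0 n0; linarith
      · rw [if_pos h1] at hc0 n1; linarith
      · exact hcon h1
      · simp at h1
    rw [if_pos hmab'] at hc0
    -- The vertex count with `p, q ≥ m = a + b` and the alternative `hpath` make `c` too long for a
    -- theta cycle of length `m + 1`. So the right side vanishes, while `p` or `q` equals `m`.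
    rw [if_neg (show ¬ m + 1 = a + b by omega), if_neg (show ¬ m + 1 = a + c by omega),
      if_neg (show ¬ m + 1 = b + c by omega)] at hc1
    linarith [ite_one_zero_nonneg (m + 1 = p), ite_one_zero_nonneg (m + 1 = q),
      ite_one_zero_nonneg (m = a + c), ite_one_zero_nonneg (m = b + c)]
  · obtain ⟨_, _, hdvd⟩ := dvd_of_form_eq hp hq hr hks hne (by
      rw [eval_thetaForm, eval_thetaForm]
      rcases thetaForm_values a b c with (h | h) | ⟨_, h | h⟩
      · exact Or.inr (Or.inr (Or.inr (Or.inr (Or.inl h))))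
      · exact Or.inr (Or.inr (Or.inr (Or.inr (Or.inr h))))
      · exact Or.inr (Or.inr (Or.inr (Or.inl h)))
      · exact Or.inr (Or.inl h)) h
    have hpq : m = p ∨ m = q := by
      by_contra hcon
      push Not at hcon
      rw [if_neg hcon.1, if_neg hcon.2] at hc0
      have w1 := ite_one_zero_nonneg (m = a + b)
      have w2 := ite_one_zero_nonneg (m = a + c)
      have w3 := ite_one_zero_nonneg (m = b + c)
      have n3 : (0 : ℤ) ≤ ks.count m := Nat.cast_nonneg _
      rcases hm' with h1 | h1 | h1 | h1
      · exact hcon.1 h1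
      · exact hcon.2 h1
      · rw [if_pos h1] at hc0; linarith
      · have h4 : (0 : ℤ) < ks.count m := Nat.cast_pos.2 (List.count_pos_iff.2 h1)
        linarith
    have hkm : ∀ k ∈ ks, k = m := by
      intro k hk
      obtain ⟨d1, d2⟩ := hdvd k hk
      have h1 := hmk k hk
      have h2 := Nat.le_of_dvd (by omega) d1
      have h3 := Nat.le_of_dvd (by omega) d2
      omega
    have hrep := List.eq_replicate_of_mem hkm
    have hmem : m ∈ ks := by
      obtain ⟨k, hk⟩ := List.exists_mem_of_ne_nil ks hne
      exact hkm k hk ▸ hk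
    obtain ⟨d1, d2⟩ := hdvd m hmem
    have hpos := List.count_pos_iff.2 hmem
    have n1 : ¬ m + 1 = p := by
      intro h1; rw [← h1, ← Nat.dvd_add_iff_right (dvd_refl m)] at d1
      have := Nat.le_of_dvd (by omega) d1; omega
    have n2 : ¬ m + 1 = q := by
      intro h1; rw [← h1, ← Nat.dvd_add_iff_right (dvd_refl m)] at d2
      have := Nat.le_of_dvd (by omega) d2; omega
    rw [if_neg n1, if_neg n2] at hc1
    -- In degree `m + 1` each extra cycle has weight 2 against at most 2 on the left, so there is
    -- one and `p = q = m`. Degree `m` then leaves exactly one theta cycle of length `m`.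
    have hfin : ks.count m = 1 ∧ m = p ∧ m = q ∧ m = a + b ∧ m ≠ a + c := by
      have u1 := ite_one_zero_le (m = p)
      have u2 := ite_one_zero_le (m = q)
      have v1 := ite_one_zero_nonneg (m + 1 = a + b)
      have v2 := ite_one_zero_nonneg (m + 1 = a + c)
      have v3 := ite_one_zero_nonneg (m + 1 = b + c)
      have w1 := ite_one_zero_nonneg (m = a + b)
      have w2 := ite_one_zero_nonneg (m = a + c)
      have w3 := ite_one_zero_nonneg (m = b + c)
      have x1 : (0 : ℤ) ≤ ks.count (m + 1) := Nat.cast_nonneg _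
      have x2 : (1 : ℤ) ≤ ks.count m := by exact_mod_cast hpos
      have c1 : (ks.count m : ℤ) = 1 := by linarith
      have hmab' : m = a + b := by
        by_contra hcon
        rw [if_neg hcon, if_neg (show ¬ m = a + c by omega), if_neg (show ¬ m = b + c by omega)]
          at hc0
        linarith
      refine ⟨by exact_mod_cast c1, ?_, ?_, hmab', ?_⟩
      · by_contra hcon
        rw [if_neg hcon] at hc1; linarith
      · by_contra hcon
        rw [if_neg hcon] at hc1; linarith
      · intro hcon
        rw [if_pos hmab', if_pos hcon] at hc0; linarith
    obtain ⟨c1, rfl, rfl, hmab', hmac⟩ := hfin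
    have hlen : ks.length = 1 := by
      rw [hrep, List.count_replicate_self] at c1
      exact c1
    rw [hlen] at hrep
    rw [hrep] at hsum h
    simp only [List.replicate_one, List.sum_singleton, List.map_singleton, List.prod_singleton]
      at hsum h
    -- The sizes give `r = c + 1`. So `a + 1 = r` would mean `a = b = c`, against `m ≠ a + c`; hence
    -- `m ≤ 2a` by `hpath`, and `m = a + b` with `a ≤ b`.
    obtain rfl : b = a := by omega
    obtain rfl : r = c + 1 := by omega
    obtain rfl : m = 2 * b := by omega
    exact thetaForm_mul_cycleForm_ne (by omega) h

theorem dumbbellForm_ne_thetaForm_mul' {p q r a b c : ℕ} (hp : 3 ≤ p) (hq : 3 ≤ q) (hr : 2 ≤ r)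
    (hab : 3 ≤ a + b) (hac : 3 ≤ a + c) (hbc : 3 ≤ b + c)
    {ks : List ℕ} (hks : ∀ k ∈ ks, 3 ≤ k) (hsum : p + q + r = a + b + c + 1 + ks.sum) :
    dumbbellForm X p q r ≠ thetaForm X a b c * (ks.map (cycleForm (X : ℤ[X]))).prod := by
  rcases le_total a b with h1 | h1 <;> rcases le_total a c with h2 | h2 <;>
    rcases le_total b c with h3 | h3
  · exact dumbbellForm_ne_thetaForm_mul hp hq hr h1 h3 hab hks hsum
  · rw [thetaForm_comm₂₃]
    exact dumbbellForm_ne_thetaForm_mul hp hq hr h2 h3 hac hks (by omega)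
  · exact dumbbellForm_ne_thetaForm_mul hp hq hr h1 h3 hab hks hsum
  · rw [thetaForm_comm₂₃, thetaForm_comm₁₂]
    exact dumbbellForm_ne_thetaForm_mul hp hq hr h2 h1 (by omega) hks (by omega)
  · rw [thetaForm_comm₁₂]
    exact dumbbellForm_ne_thetaForm_mul hp hq hr h1 h2 (by omega) hks (by omega)
  · rw [thetaForm_comm₂₃, thetaForm_comm₁₂, thetaForm_comm₂₃]
    exact dumbbellForm_ne_thetaForm_mul hp hq hr h3 h1 (by omega) hks (by omega)
  · rw [thetaForm_comm₁₂, thetaForm_comm₂₃]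
    exact dumbbellForm_ne_thetaForm_mul hp hq hr h3 h2 (by omega) hks (by omega)
  · rw [thetaForm_comm₂₃, thetaForm_comm₁₂, thetaForm_comm₂₃]
    exact dumbbellForm_ne_thetaForm_mul hp hq hr h3 h1 (by omega) hks (by omega)

end Arithmetic

/-! ### Structure of graphs with two vertices of degree 3 and all others of degree 2. -/

section Trails

variable {V : Type*}

/-- The vertices `x 0, …, x (n - 1)` form a path of `G` inside the set `W`. -/
structure IsPathIn (G : SimpleGraph V) (W : Set V) (n : ℕ) (x : ℕ → V) : Prop where
  inj : ∀ a b, a < n → b < n → x a = x b → a = b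
  adj : ∀ a, a + 1 < n → G.Adj (x a) (x (a + 1))
  mem : ∀ a, a < n → x a ∈ W

variable {G : SimpleGraph V} {W : Set V} {n : ℕ} {x : ℕ → V}

theorem IsPathIn.reverse (H : IsPathIn G W n x) : IsPathIn G W n (fun k => x (n - 1 - k)) where
  inj a b ha hb h := by
    have := H.inj _ _ (by omega) (by omega) h
    omega
  adj a ha := by
    have := H.adj (n - 1 - (a + 1)) (by omega)
    rw [show n - 1 - (a + 1) + 1 = n - 1 - a by omega] at this
    exact this.symm
  mem a ha := H.mem _ (by omega)

theorem IsPathIn.cons (H : IsPathIn G W n x) {w : V} (hw : w ∈ W) (hadj : 0 < n → G.Adj w (x 0))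
    (hne : ∀ a < n, w ≠ x a) : IsPathIn G W (n + 1) (fun k => if k = 0 then w else x (k - 1)) where
  inj a b ha hb h := by
    split_ifs at h with h1 h2 h2
    · omega
    · exact absurd h (hne _ (by omega))
    · exact absurd h.symm (hne _ (by omega))
    · have := H.inj _ _ (by omega) (by omega) h
      omega
  adj a ha := by
    rw [if_neg (by omega : ¬ a + 1 = 0)]
    split_ifs with h1
    · subst h1
      exact hadj (by omega)
    · have := H.adj (a - 1) (by omega)
      rwa [show a - 1 + 1 = a + 1 - 1 by omega] at this
  mem a ha := by
    split_ifs
    · exact hw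
    · exact H.mem _ (by omega)

theorem IsPathIn.le_card [Fintype V] (H : IsPathIn G W n x) : n ≤ Fintype.card V := by
  have : Function.Injective (fun k : Fin n => x k) := fun a b h =>
    Fin.ext (H.inj _ _ a.2 b.2 h)
  simpa using Fintype.card_le_of_injective _ this

/-- A path inside `W` containing `u` of the largest possible length. -/
structure IsLongestPathIn (G : SimpleGraph V) (W : Set V) (u : V) (n : ℕ) (x : ℕ → V) : Prop
    extends IsPathIn G W n x where
  through : ∃ a < n, x a = u
  longest : ∀ m y, IsPathIn G W m y → (∃ a < m, y a = u) → m ≤ n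

theorem exists_isLongestPathIn [Fintype V] (G : SimpleGraph V) {W : Set V} {u : V} (hu : u ∈ W) :
    ∃ n x, IsLongestPathIn G W u n x := by
  classical
  let P : ℕ → Prop := fun n => ∃ x, IsPathIn G W n x ∧ ∃ a < n, x a = u
  have h1 : P 1 := ⟨fun _ => u, ⟨fun a b ha hb _ => by omega, fun a ha => by omega,
    fun a _ => hu⟩, 0, Nat.one_pos, rfl⟩
  have hle : ∀ m, P m → m ≤ Fintype.card V := fun m ⟨x, hx, _⟩ => hx.le_card
  obtain ⟨x, hx, hxu⟩ := Nat.findGreatest_spec (hle 1 h1) h1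
  exact ⟨_, x, hx, hxu, fun m y hy hyu => Nat.le_findGreatest (hle m ⟨y, hy, hyu⟩) ⟨y, hy, hyu⟩⟩

theorem IsLongestPathIn.reverse {u : V} (H : IsLongestPathIn G W u n x) :
    IsLongestPathIn G W u n (fun k => x (n - 1 - k)) where
  toIsPathIn := H.toIsPathIn.reverse
  through := by
    obtain ⟨a, ha, hx⟩ := H.through
    exact ⟨n - 1 - a, by omega, by rwa [show n - 1 - (n - 1 - a) = a by omega]⟩
  longest := H.longest

theorem IsLongestPathIn.congr {u : V} (H : IsLongestPathIn G W u n x) {y : ℕ → V}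
    (hy : IsPathIn G W n y) (hu : ∃ a < n, y a = u) : IsLongestPathIn G W u n y :=
  ⟨hy, hu, H.longest⟩

/-- A neighbour off the path could be put in front of it. -/
theorem IsLongestPathIn.exists_eq_of_adj {u : V} (H : IsLongestPathIn G W u n x) {w : V}
    (hw : w ∈ W) (hadj : G.Adj (x 0) w) : ∃ a, 0 < a ∧ a < n ∧ w = x a := by
  by_contra hcon
  push Not at hcon
  obtain ⟨a, ha, hau⟩ := H.through
  have h1 := H.longest _ _ (H.toIsPathIn.cons hw (fun _ => hadj.symm) (fun b hb => by
    rcases Nat.eq_zero_or_pos b with rfl | hb0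
    · exact hadj.ne'
    · exact hcon b hb0 hb)) ⟨a + 1, by omega, by simpa using hau⟩
  omega

section Degree

variable [Fintype V] [DecidableRel G.Adj]

theorem two_lt_degree {w a b c : V} (ha : G.Adj w a) (hb : G.Adj w b) (hc : G.Adj w c)
    (hab : a ≠ b) (hac : a ≠ c) (hbc : b ≠ c) : 2 < G.degree w := by
  rw [← G.card_neighborFinset_eq_degree, Finset.two_lt_card]
  exact ⟨a, by simpa using ha, b, by simpa using hb, c, by simpa using hc, hab, hac, hbc⟩

theorem exists_adj_ne {w a : V} (h : 2 ≤ G.degree w) : ∃ b, G.Adj w b ∧ b ≠ a := by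
  rw [← G.card_neighborFinset_eq_degree] at h
  have h1 : 1 < (G.neighborFinset w).card := h
  obtain ⟨b, hb, hba⟩ := Finset.exists_mem_ne h1 a
  exact ⟨b, by simpa using hb, hba⟩

theorem exists_adj_ne_ne {w a b : V} (h : 3 ≤ G.degree w) : ∃ c, G.Adj w c ∧ c ≠ a ∧ c ≠ b := by
  classical
  rw [← G.card_neighborFinset_eq_degree] at h
  have h1 : (({a, b} : Finset V)).card < (G.neighborFinset w).card :=
    (Finset.card_le_two).trans_lt (by omega)
  obtain ⟨c, hc, hcn⟩ := Finset.exists_mem_notMem_of_card_lt_card h1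
  simp only [Finset.mem_insert, Finset.mem_singleton, not_or] at hcn
  exact ⟨c, by simpa using hc, hcn.1, hcn.2⟩

theorem adj_iff_of_degree_two {w a b : V} (h : G.degree w = 2) (ha : G.Adj w a) (hb : G.Adj w b)
    (hab : a ≠ b) (z : V) : G.Adj w z ↔ z = a ∨ z = b := by
  constructor
  · intro hz
    by_contra hcon
    push Not at hcon
    have := two_lt_degree hz ha hb hcon.1 hcon.2 hab
    omega
  · rintro (rfl | rfl) <;> assumption

theorem adj_iff_of_degree_three {w a b c : V} (h : G.degree w = 3) (ha : G.Adj w a)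
    (hb : G.Adj w b) (hc : G.Adj w c) (hab : a ≠ b) (hac : a ≠ c) (hbc : b ≠ c) (z : V) :
    G.Adj w z ↔ z = a ∨ z = b ∨ z = c := by
  classical
  have hs : ({a, b, c} : Finset V) = G.neighborFinset w := by
    apply Finset.eq_of_subset_of_card_le
    · intro d hd
      simp only [Finset.mem_insert, Finset.mem_singleton] at hd
      rw [SimpleGraph.mem_neighborFinset]
      rcases hd with rfl | rfl | rfl <;> assumption
    · rw [G.card_neighborFinset_eq_degree, h, Finset.card_eq_three.2 ⟨a, b, c, hab, hac, hbc, rfl⟩]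
  rw [← SimpleGraph.mem_neighborFinset, ← hs]
  simp

theorem IsLongestPathIn.exists_chord {u : V} (H : IsLongestPathIn G W u n x)
    (hclosed : ∀ a ∈ W, ∀ b, G.Adj a b → b ∈ W) (hdeg : ∀ a ∈ W, 2 ≤ G.degree a) :
    ∃ j, 2 ≤ j ∧ j < n ∧ G.Adj (x 0) (x j) := by
  obtain ⟨a, ha, hau⟩ := H.through
  have h0 : x 0 ∈ W := H.mem 0 (by omega)
  obtain ⟨b, hb, hb1⟩ := exists_adj_ne (a := x 1) (hdeg _ h0)
  obtain ⟨j, hj0, hj, rfl⟩ := H.exists_eq_of_adj (hclosed _ h0 _ hb) hb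
  refine ⟨j, ?_, hj, hb⟩
  by_contra hcon
  obtain rfl : j = 1 := by omega
  exact hb1 rfl

theorem IsPathIn.two_lt_degree (H : IsPathIn G W n x) {j : ℕ} (hj : 1 ≤ j) (hjn : j + 1 < n)
    {k : ℕ} (hk : k < n) (h1 : k ≠ j - 1) (h2 : k ≠ j + 1) (hadj : G.Adj (x j) (x k)) :
    2 < G.degree (x j) := by
  have e1 := H.adj (j - 1) (by omega)
  rw [Nat.sub_add_cancel hj] at e1
  refine _root_.two_lt_degree e1.symm (H.adj j hjn) hadj ?_ ?_ ?_ <;> intro h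
  · have := H.inj _ _ (by omega) (by omega) h; omega
  · have := H.inj _ _ (by omega) (by omega) h; omega
  · have := H.inj _ _ (by omega) (by omega) h; omega

/-- `x 0, …, x (n - 1)` are the vertices of a connected component of `G` that is a cycle. -/
structure IsCycleComp (G : SimpleGraph V) (n : ℕ) (x : ℕ → V) : Prop where
  three_le : 3 ≤ n
  inj : ∀ a b, a < n → b < n → x a = x b → a = b
  adj_iff : ∀ a, a < n → ∀ w, G.Adj (x a) w ↔ ∃ b < n, w = x b ∧
    (b = a + 1 ∨ a = b + 1 ∨ (a = 0 ∧ b = n - 1) ∨ (a = n - 1 ∧ b = 0))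

/-- The first vertex of a longest path has a second neighbour on the path. It must be the last
vertex, since an inner vertex would get degree 3. -/
theorem exists_isCycleComp {u : V} (hu : u ∈ W)
    (hclosed : ∀ a ∈ W, ∀ b, G.Adj a b → b ∈ W) (hdeg : ∀ a ∈ W, G.degree a = 2) :
    ∃ n x, IsCycleComp G n x ∧ ∀ a < n, x a ∈ W := by
  obtain ⟨n, x, H⟩ := exists_isLongestPathIn G hu
  obtain ⟨j, hj2, hjn, hadj⟩ := H.exists_chord hclosed (fun a ha => (hdeg a ha).ge)
  obtain rfl : j = n - 1 := by
    by_contra hcon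
    have h1 := H.two_lt_degree (j := j) (by omega) (by omega) (k := 0) (by omega) (by omega)
      (by omega) hadj.symm
    have h2 := hdeg _ (H.mem j hjn)
    omega
  refine ⟨n, x, ⟨by omega, H.inj, fun a ha w => ?_⟩, H.mem⟩
  have key : ∀ b c, b < n → c < n → b ≠ c → G.Adj (x a) (x b) → G.Adj (x a) (x c) →
      (∀ d, d < n → (d = b ∨ d = c ↔
        (d = a + 1 ∨ a = d + 1 ∨ (a = 0 ∧ d = n - 1) ∨ (a = n - 1 ∧ d = 0)))) →
      (G.Adj (x a) w ↔ ∃ b < n, w = x b ∧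
        (b = a + 1 ∨ a = b + 1 ∨ (a = 0 ∧ b = n - 1) ∨ (a = n - 1 ∧ b = 0))) := by
    intro b c hb hc hbc h1 h2 h3
    rw [adj_iff_of_degree_two (hdeg _ (H.mem a ha)) h1 h2 (fun h => hbc (H.inj _ _ hb hc h))]
    constructor
    · rintro (rfl | rfl)
      · exact ⟨b, hb, rfl, (h3 b hb).1 (Or.inl rfl)⟩
      · exact ⟨c, hc, rfl, (h3 c hc).1 (Or.inr rfl)⟩
    · rintro ⟨d, hd, rfl, h4⟩
      rcases (h3 d hd).2 h4 with rfl | rfl <;> simp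
  rcases Nat.eq_zero_or_pos a with rfl | ha0
  · exact key 1 (n - 1) (by omega) (by omega) (by omega) (H.adj 0 (by omega)) hadj
      (fun d hd => by omega)
  have e1 := H.adj (a - 1) (by omega)
  rw [Nat.sub_add_cancel ha0] at e1
  rcases eq_or_ne a (n - 1) with h | h
  · exact key (a - 1) 0 (by omega) (by omega) (by omega) e1.symm (h ▸ hadj.symm)
      (fun d hd => by omega)
  · exact key (a - 1) (a + 1) (by omega) (by omega) (by omega) e1.symm (H.adj a (by omega))
      (fun d hd => by omega)

/-- Adjacency of a path `0, 1, …, n - 1` with the two chords `{0, j}` and `{i, n - 1}`. -/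
def ChordedAdj (n j i a b : ℕ) : Prop :=
  b = a + 1 ∨ a = b + 1 ∨ (a = 0 ∧ b = j) ∨ (a = j ∧ b = 0) ∨ (a = i ∧ b = n - 1) ∨
    (a = n - 1 ∧ b = i)

/-- `x 0, …, x (n - 1)` are the vertices of a union of components of `G`, in which they form
a Hamiltonian path, the other edges being `{x 0, x j}` and `{x i, x (n - 1)}`. -/
structure IsChordedComp (G : SimpleGraph V) (n j i : ℕ) (x : ℕ → V) : Prop where
  two_le_j : 2 ≤ j
  j_le : j + 2 ≤ n
  one_le_i : 1 ≤ i
  i_le : i + 3 ≤ n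
  i_ne_j : i ≠ j
  inj : ∀ a b, a < n → b < n → x a = x b → a = b
  adj_iff : ∀ a, a < n → ∀ w, G.Adj (x a) w ↔ ∃ b < n, w = x b ∧ ChordedAdj n j i a b

/-- If the ends are not adjacent, each has a chord to an inner vertex, which then has degree 3. The
two inner vertices differ, as a common one would have degree 4, so they are `u` and `v` and all
edges at the path are accounted for. -/
theorem IsLongestPathIn.exists_isChordedComp {u v w : V}
    (hu : G.degree u = 3) (hv : G.degree v = 3) (hdeg : ∀ a, a ≠ u → a ≠ v → G.degree a = 2)
    (H : IsLongestPathIn G Set.univ w n x) (hend : ¬ G.Adj (x 0) (x (n - 1))) :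
    ∃ j i, IsChordedComp G n j i x ∧ ((x j = u ∧ x i = v) ∨ (x j = v ∧ x i = u)) := by
  have hdeg2 : ∀ a ∈ Set.univ, 2 ≤ G.degree a := fun a _ => by
    by_cases h1 : a = u
    · rw [h1]; omega
    by_cases h2 : a = v
    · rw [h2]; omega
    exact (hdeg a h1 h2).ge
  have hcl : ∀ a ∈ (Set.univ : Set V), ∀ b, G.Adj a b → b ∈ Set.univ := fun _ _ _ _ => trivial
  have hor : ∀ a, 2 < G.degree a → a = u ∨ a = v := fun a ha => by
    by_contra hcon
    push Not at hcon
    have := hdeg a hcon.1 hcon.2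
    omega
  obtain ⟨j, hj2, hjn, hj⟩ := H.exists_chord hcl hdeg2
  obtain ⟨i', hi2, hin', hi'⟩ := H.reverse.exists_chord hcl hdeg2
  obtain ⟨i, rfl⟩ : ∃ i, i' = n - 1 - i := ⟨n - 1 - i', by omega⟩
  rw [Nat.sub_zero, show n - 1 - (n - 1 - i) = i by omega] at hi'
  have hjn' : j ≠ n - 1 := by rintro rfl; exact hend hj
  have hi0 : i ≠ 0 := by rintro rfl; exact hend hi'.symm
  have dj := H.two_lt_degree (j := j) (by omega) (by omega) (k := 0) (by omega) (by omega)
    (by omega) hj.symm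
  have di := H.two_lt_degree (j := i) (by omega) (by omega) (k := n - 1) (by omega) (by omega)
    (by omega) hi'.symm
  have hij : i ≠ j := by
    rintro rfl
    have e1 := H.adj (i - 1) (by omega)
    rw [Nat.sub_add_cancel (by omega)] at e1
    have d3 : G.degree (x i) = 3 := by rcases hor _ di with h | h <;> rw [h] <;> assumption
    have ne : ∀ {a b}, a < n → b < n → a ≠ b → x a ≠ x b := fun ha hb hab h =>
      hab (H.inj _ _ ha hb h)
    rcases (adj_iff_of_degree_three d3 e1.symm (H.adj i (by omega)) hj.symm
      (ne (by omega) (by omega) (by omega)) (ne (by omega) (by omega) (by omega))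
      (ne (by omega) (by omega) (by omega)) _).1 hi'.symm with h | h | h <;>
      · have := H.inj _ _ (by omega) (by omega) h
        omega
  have hxx : (x j = u ∧ x i = v) ∨ (x j = v ∧ x i = u) := by
    have hne : x i ≠ x j := fun h => hij (H.inj _ _ (by omega) (by omega) h)
    rcases hor _ dj with h1 | h1 <;> rcases hor _ di with h2 | h2
    · exact absurd (h2.trans h1.symm) hne
    · exact Or.inl ⟨h1, h2⟩
    · exact Or.inr ⟨h1, h2⟩
    · exact absurd (h2.trans h1.symm) hne
  refine ⟨j, i, ⟨hj2, by omega, by omega, by omega, hij, H.inj, fun a ha w => ?_⟩, hxx⟩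
  have ne : ∀ {a b}, a < n → b < n → a ≠ b → x a ≠ x b := fun ha hb hab h =>
    hab (H.inj _ _ ha hb h)
  by_cases haij : a = i ∨ a = j
  · have d3 : G.degree (x a) = 3 := by
      rcases haij with h | h <;> rcases hxx with h' | h' <;> rw [h]
      · exact h'.2 ▸ hv
      · exact h'.2 ▸ hu
      · exact h'.1 ▸ hu
      · exact h'.1 ▸ hv
    have key : ∀ b c d, b < n → c < n → d < n → b ≠ c → b ≠ d → c ≠ d → G.Adj (x a) (x b) →
        G.Adj (x a) (x c) → G.Adj (x a) (x d) →
        (∀ e, e < n → (e = b ∨ e = c ∨ e = d ↔ ChordedAdj n j i a e)) →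
        (G.Adj (x a) w ↔ ∃ b < n, w = x b ∧ ChordedAdj n j i a b) := by
      intro b c d hb hc hd hbc hbd hcd h1 h2 h3 h4
      rw [adj_iff_of_degree_three d3 h1 h2 h3 (ne hb hc hbc) (ne hb hd hbd) (ne hc hd hcd)]
      constructor
      · rintro (rfl | rfl | rfl)
        · exact ⟨b, hb, rfl, (h4 b hb).1 (by simp)⟩
        · exact ⟨c, hc, rfl, (h4 c hc).1 (by simp)⟩
        · exact ⟨d, hd, rfl, (h4 d hd).1 (by simp)⟩
      · rintro ⟨e, he, rfl, h5⟩
        rcases (h4 e he).2 h5 with rfl | rfl | rfl <;> simp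
    have e1 := H.adj (a - 1) (by omega)
    rw [Nat.sub_add_cancel (by omega)] at e1
    rcases haij with rfl | rfl
    · exact key (a - 1) (a + 1) (n - 1) (by omega) (by omega) (by omega) (by omega) (by omega)
        (by omega) e1.symm (H.adj a (by omega)) hi'.symm
        (fun e he => by unfold ChordedAdj; omega)
    · exact key (a - 1) (a + 1) 0 (by omega) (by omega) (by omega) (by omega) (by omega)
        (by omega) e1.symm (H.adj a (by omega)) hj.symm
        (fun e he => by unfold ChordedAdj; omega)
  · push Not at haij
    have d2 : G.degree (x a) = 2 := by
      have h1 := ne ha (by omega) haij.1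
      have h2 := ne ha (by omega) haij.2
      rcases hxx with ⟨h3, h4⟩ | ⟨h3, h4⟩
      · exact hdeg _ (h3 ▸ h2) (h4 ▸ h1)
      · exact hdeg _ (h4 ▸ h1) (h3 ▸ h2)
    have key : ∀ b c, b < n → c < n → b ≠ c → G.Adj (x a) (x b) → G.Adj (x a) (x c) →
        (∀ e, e < n → (e = b ∨ e = c ↔ ChordedAdj n j i a e)) →
        (G.Adj (x a) w ↔ ∃ b < n, w = x b ∧ ChordedAdj n j i a b) := by
      intro b c hb hc hbc h1 h2 h4
      rw [adj_iff_of_degree_two d2 h1 h2 (ne hb hc hbc)]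
      constructor
      · rintro (rfl | rfl)
        · exact ⟨b, hb, rfl, (h4 b hb).1 (by simp)⟩
        · exact ⟨c, hc, rfl, (h4 c hc).1 (by simp)⟩
      · rintro ⟨e, he, rfl, h5⟩
        rcases (h4 e he).2 h5 with rfl | rfl <;> simp
    rcases Nat.eq_zero_or_pos a with rfl | ha0
    · exact key 1 j (by omega) (by omega) (by omega) (H.adj 0 (by omega)) hj
        (fun e he => by unfold ChordedAdj; omega)
    have e1 := H.adj (a - 1) (by omega)
    rw [Nat.sub_add_cancel ha0] at e1
    rcases eq_or_ne a (n - 1) with h | h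
    · exact key (a - 1) i (by omega) (by omega) (by omega) e1.symm (h ▸ hi')
        (fun e he => by unfold ChordedAdj; omega)
    · exact key (a - 1) (a + 1) (by omega) (by omega) (by omega) e1.symm (H.adj a (by omega))
        (fun e he => by unfold ChordedAdj; omega)

/-- If the ends of a longest path are adjacent, it closes to a cycle through `u`. The third edge at
`u` is then a chord leading to `v`, and rerouting through it gives an equally long path with
non-adjacent ends. -/
theorem exists_isChordedComp {u v : V}
    (hu : G.degree u = 3) (hv : G.degree v = 3) (hdeg : ∀ a, a ≠ u → a ≠ v → G.degree a = 2) :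
    ∃ n j i x, IsChordedComp G n j i x ∧ ((x j = u ∧ x i = v) ∨ (x j = v ∧ x i = u)) := by
  obtain ⟨n, x, H⟩ := exists_isLongestPathIn G (Set.mem_univ u)
  by_cases hend : G.Adj (x 0) (x (n - 1))
  swap
  · obtain ⟨j, i, h⟩ := H.exists_isChordedComp hu hv hdeg hend
    exact ⟨n, j, i, x, h⟩
  obtain ⟨a, ha, hau⟩ := H.through
  -- rotate the cycle so that it starts at `u`
  obtain ⟨y, Hy, hy0, hyend⟩ : ∃ y, IsPathIn G Set.univ n y ∧ y 0 = u ∧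
      G.Adj (y 0) (y (n - 1)) := by
    refine ⟨fun k => x (if k + a < n then k + a else k + a - n), ⟨fun b c hb hc h => ?_,
      fun b hb => ?_, fun _ _ => trivial⟩, ?_, ?_⟩
    · have := H.inj _ _ (by split_ifs <;> omega) (by split_ifs <;> omega) h
      split_ifs at this <;> omega
    · split_ifs with h1 h2 h2
      · rw [show b + 1 + a = b + a + 1 by omega]
        exact H.adj _ (by omega)
      · rw [show b + a = n - 1 by omega, show b + 1 + a - n = 0 by omega]
        exact hend.symm
      · omega
      · rw [show b + 1 + a - n = b + a - n + 1 by omega]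
        exact H.adj _ (by omega)
    · simp only [zero_add, if_pos ha, hau]
    · simp only [zero_add, if_pos ha]
      split_ifs with h1
      · obtain rfl : a = 0 := by omega
        simpa using hend
      · have := H.adj (a - 1) (by omega)
        rw [Nat.sub_add_cancel (by omega)] at this
        rw [show n - 1 + a - n = a - 1 by omega]
        exact this.symm
  have Ly := H.congr Hy ⟨0, by omega, hy0⟩
  obtain ⟨w, hw, hw1, hw2⟩ := exists_adj_ne_ne (a := y 1) (b := y (n - 1)) hu.ge
  rw [← hy0] at hw
  obtain ⟨t, ht0, htn, rfl⟩ := Ly.exists_eq_of_adj (Set.mem_univ w) hw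
  have ht1 : t ≠ 1 := by rintro rfl; exact hw1 rfl
  have ht2 : t ≠ n - 1 := by rintro rfl; exact hw2 rfl
  have dt := Hy.two_lt_degree (j := t) (by omega) (by omega) (k := 0) (by omega) (by omega)
    (by omega) hw.symm
  have hyne : ∀ {a b}, a < n → b < n → a ≠ b → y a ≠ y b := fun ha hb hab h =>
    hab (Hy.inj _ _ ha hb h)
  have htv : y t = v := by
    by_contra hcon
    have := hdeg (y t) (hy0 ▸ hyne htn (by omega) (by omega)) hcon
    omega
  have d1 : G.degree (y 1) = 2 := hdeg _ (hy0 ▸ hyne (by omega) (by omega) (by omega))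
    (htv ▸ hyne (by omega) (by omega) (by omega))
  -- reroute the path through the chord
  have Lz := Ly.congr (y := fun k => y (if k < t then k + 1 else if k = t then 0 else n + t - k))
    ⟨fun b c hb hc h => by
      have := Hy.inj _ _ (by split_ifs <;> omega) (by split_ifs <;> omega) h
      split_ifs at this <;> omega, fun b hb => by
      rcases lt_trichotomy (b + 1) t with h1 | h1 | h1
      · rw [if_pos (by omega), if_pos h1]
        exact Hy.adj _ (by omega)
      · rw [if_pos (by omega), if_neg (by omega), if_pos h1, h1]
        exact hw.symm
      · rcases eq_or_ne b t with h2 | h2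
        · rw [if_neg (by omega), if_pos h2, if_neg (by omega), if_neg (by omega),
            show n + t - (b + 1) = n - 1 by omega]
          exact hyend
        · rw [if_neg (by omega), if_neg h2, if_neg (by omega), if_neg (by omega)]
          have := Hy.adj (n + t - (b + 1)) (by omega)
          rw [show n + t - (b + 1) + 1 = n + t - b by omega] at this
          exact this.symm, fun _ _ => trivial⟩ ⟨t, htn, by simpa using hy0⟩
  -- The new path is `y 1, …, y t, y 0, y (n - 1), …, y (t + 1)`. Its first vertex has only the
  -- neighbours `y 0` and `y 2`, and `y (t + 1)` is neither.
  obtain ⟨j, i, h⟩ := Lz.exists_isChordedComp hu hv hdeg (by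
    rw [if_pos ht0, if_neg (by omega), if_neg (by omega), zero_add,
      adj_iff_of_degree_two d1 (Hy.adj 0 (by omega)).symm (Hy.adj 1 (by omega))
        (hyne (by omega) (by omega) (by omega))]
    rintro (h | h)
    · have := Hy.inj _ _ (by omega) (by omega) h
      omega
    · have := Hy.inj _ _ (by omega) (by omega) h
      omega)
  exact ⟨n, j, i, _, h⟩

end Degree

theorem IsChordedComp.adj_iff' {j i : ℕ} (H : IsChordedComp G n j i x) {a b : ℕ} (ha : a < n) (hb : b < n) :
    G.Adj (x a) (x b) ↔ ChordedAdj n j i a b := by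
  rw [H.adj_iff a ha]
  constructor
  · rintro ⟨c, hc, h1, h2⟩
    rwa [H.inj _ _ hb hc h1]
  · exact fun h => ⟨b, hb, rfl, h⟩

end Trails

/-! ### Relabelling and rescaling of permanents. -/

section PerOnTransport

variable {α β R : Type*} [DecidableEq α] [DecidableEq β] [CommRing R]

theorem perOn_eq_sum_perm (M : α → α → R) (S : Finset α) :
    perOn M S = ∑ σ : Equiv.Perm {x // x ∈ S}, ∏ x : {x // x ∈ S}, M x (σ x) := by
  let e := Equiv.Perm.subtypeEquivSubtypePerm (· ∈ S)
  have : Fintype {σ : Equiv.Perm α // ∀ a, a ∉ S → σ a = a} := Fintype.ofEquiv _ e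
  rw [perOn, Finset.sum_subtype _ (p := fun σ : Equiv.Perm α => ∀ a, a ∉ S → σ a = a)
    (fun σ => mem_permsOfFinset)]
  refine (Fintype.sum_equiv e _ _ fun σ => ?_).symm
  rw [← Finset.prod_coe_sort S fun x => M x ((e σ : Equiv.Perm α) x)]
  refine Finset.prod_congr rfl fun a _ => ?_
  rw [Equiv.Perm.subtypeEquivSubtypePerm_apply_coe, Equiv.Perm.ofSubtype_apply_coe]

/-- Serves to label the vertices of a component by `0, …, n - 1`, where subpaths are intervals. -/
theorem perOn_image (M : β → β → R) {x : α → β} {S : Finset α}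
    (hx : ∀ a ∈ S, ∀ b ∈ S, x a = x b → a = b) :
    perOn M (S.image x) = perOn (fun a b => M (x a) (x b)) S := by
  have hinj : Set.InjOn x S := fun a ha b hb h => hx a ha b hb h
  let e : {a // a ∈ S} ≃ {b // b ∈ S.image x} := Equiv.ofBijective
    (fun a => ⟨x a, Finset.mem_image_of_mem x a.2⟩) ⟨fun a b h => Subtype.ext
      (hinj a.2 b.2 (Subtype.mk.inj h)), fun ⟨b, hb⟩ => by
        obtain ⟨a, ha, rfl⟩ := Finset.mem_image.1 hb
        exact ⟨⟨a, ha⟩, rfl⟩⟩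
  rw [perOn_eq_sum_perm, perOn_eq_sum_perm]
  refine (Fintype.sum_equiv e.permCongr _ _ fun σ => ?_).symm
  refine Fintype.prod_equiv e _ _ fun a => ?_
  rw [Equiv.permCongr_apply, Equiv.symm_apply_apply]
  rfl

theorem perOn_univ [Fintype α] (M : α → α → R) :
    perOn M Finset.univ = ∑ σ : Equiv.Perm α, ∏ x, M x (σ x) := by
  rw [perOn]
  refine Finset.sum_congr ?_ fun _ _ => rfl
  ext σ
  simp [mem_permsOfFinset]

theorem map_perOn {R' : Type*} [CommRing R'] (f : R →+* R') (M : α → α → R) (S : Finset α) :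
    f (perOn M S) = perOn (fun a b => f (M a b)) S := by
  rw [perOn, perOn, map_sum]
  exact Finset.sum_congr rfl fun σ _ => map_prod f _ _

theorem pow_card_mul_perOn (c : R) (M : α → α → R) (S : Finset α) :
    c ^ S.card * perOn M S = perOn (fun a b => c * M a b) S := by
  rw [perOn, perOn, Finset.mul_sum]
  refine Finset.sum_congr rfl fun σ _ => ?_
  rw [Finset.prod_mul_distrib, Finset.prod_const]

end PerOnTransport

/-! ### The matrix `xI - Q(G)` and its factorisation over components. -/

section CharEntry

variable {V R : Type*} [Fintype V] [DecidableEq V] [CommRing R]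

/-- The entries of `x I - Q(G)`, where `Q(G)` is the signless Laplacian matrix. -/
def SimpleGraph.charEntry (G : SimpleGraph V) [DecidableRel G.Adj] (x : R) (a b : V) : R :=
  if a = b then x - G.degree a else if G.Adj a b then -1 else 0

variable (G : SimpleGraph V) [DecidableRel G.Adj]

theorem charEntry_self (x : R) (a : V) : G.charEntry x a a = x - G.degree a := if_pos rfl

theorem charEntry_adj (x : R) {a b : V} (h : G.Adj a b) : G.charEntry x a b = -1 := by
  rw [SimpleGraph.charEntry, if_neg h.ne, if_pos h]

theorem charEntry_not_adj (x : R) {a b : V} (hab : a ≠ b) (h : ¬ G.Adj a b) :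
    G.charEntry x a b = 0 := by
  rw [SimpleGraph.charEntry, if_neg hab, if_neg h]

theorem charEntry_symm (x : R) (a b : V) : G.charEntry x a b = G.charEntry x b a := by
  by_cases h : a = b
  · rw [h]
  by_cases h' : G.Adj a b
  · rw [charEntry_adj G x h', charEntry_adj G x h'.symm]
  · rw [charEntry_not_adj G x h h', charEntry_not_adj G x (Ne.symm h) (fun h'' => h' h''.symm)]

theorem eval₂_signlessLapPermPoly (f : ℤ →+* R) (x : R) :
    G.signlessLapPermPoly.eval₂ f x = perOn (G.charEntry x) Finset.univ := by
  rw [← coe_eval₂RingHom, SimpleGraph.signlessLapPermPoly, Matrix.permPoly, Matrix.permanent,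
    map_sum, perOn_univ]
  refine Finset.sum_congr rfl fun σ _ => ?_
  rw [map_prod]
  refine Finset.prod_congr rfl fun a _ => ?_
  rw [charEntry_symm, SimpleGraph.charEntry, SimpleGraph.signlessLapMatrix,
    SimpleGraph.degMatrix]
  by_cases h : σ a = a
  · rw [h]; simp
  · by_cases h' : G.Adj (σ a) a <;> simp [h, h']

end CharEntry

section Components

variable {V R : Type*} [Fintype V] [DecidableEq V] [CommRing R]
variable {G : SimpleGraph V} [DecidableRel G.Adj]

theorem IsCycleComp.perOn {n : ℕ} {x : ℕ → V} (H : IsCycleComp G n x)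
    (hdeg : ∀ a < n, G.degree (x a) = 2) (y : R) :
    perOn (G.charEntry (y + 2)) ((Finset.range n).image x) = cyclePer y y n := by
  have h3 := H.three_le
  set M : ℕ → ℕ → R := fun a b => G.charEntry (y + 2) (x a) (x b) with hM
  have hadj : ∀ {a b}, a < n → b < n → (G.Adj (x a) (x b) ↔
      (b = a + 1 ∨ a = b + 1 ∨ (a = 0 ∧ b = n - 1) ∨ (a = n - 1 ∧ b = 0))) := by
    intro a b ha hb
    rw [H.adj_iff a ha]
    constructor
    · rintro ⟨c, hc, h1, h2⟩
      rwa [H.inj _ _ hb hc h1]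
    · exact fun h => ⟨b, hb, rfl, h⟩
  have hone : ∀ {a b}, a < n → b < n →
      (b = a + 1 ∨ a = b + 1 ∨ (a = 0 ∧ b = n - 1) ∨ (a = n - 1 ∧ b = 0)) → M a b = -1 :=
    fun ha hb h => charEntry_adj G _ ((hadj ha hb).2 h)
  have hzero : ∀ {a b}, a < n → b < n → a ≠ b →
      ¬ (b = a + 1 ∨ a = b + 1 ∨ (a = 0 ∧ b = n - 1) ∨ (a = n - 1 ∧ b = 0)) → M a b = 0 :=
    fun ha hb hab h => charEntry_not_adj G _ (fun h' => hab (H.inj _ _ ha hb h'))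
      (fun h' => h ((hadj ha hb).1 h'))
  have hdiag : ∀ {a}, a < n → M a a = y := fun ha => by
    rw [hM]
    simp only [charEntry_self, hdeg _ ha]
    push_cast; ring
  have hpath : IsPathOn M y 1 n :=
    ⟨fun a b => charEntry_symm G _ _ _, fun a _ ha => hdiag ha,
      fun a _ ha => hone (by omega) (by omega) (by omega),
      fun a b h1 h2 h4 => hzero (by omega) (by omega) (by omega) (by omega)⟩
  rw [perOn_image _ (fun a ha b hb => H.inj a b (Finset.mem_range.1 ha) (Finset.mem_range.1 hb))]
  have hr : Finset.range n = insert 0 (Finset.Ico 1 n) := by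
    ext a
    simp only [Finset.mem_range, Finset.mem_insert, Finset.mem_Ico]
    omega
  rw [hr, ← hM, perOn_insert_Ico_cycle hpath (by omega) (by simp)
    (hone (by omega) (by omega) (by omega)) (hone (by omega) (by omega) (by omega))
    (fun a h1 h2 => hzero (by omega) (by omega) (by omega) (by omega)), hdiag (by omega)]
  congr 1
  omega

/-- Split off one cycle component at a time; no edges leave it, so the permanent is multiplicative.
-/
theorem exists_perOn_eq_prod_cyclePer (y : R) (W : Finset V)
    (hclosed : ∀ a ∈ W, ∀ b, G.Adj a b → b ∈ W) (hdeg : ∀ a ∈ W, G.degree a = 2) :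
    ∃ ks : List ℕ, (∀ k ∈ ks, 3 ≤ k) ∧ ks.sum = W.card ∧
      perOn (G.charEntry (y + 2)) W = (ks.map (cyclePer y y)).prod := by
  induction hc : W.card using Nat.strong_induction_on generalizing W with
  | _ c ih =>
    subst hc
    rcases W.eq_empty_or_nonempty with rfl | ⟨u, hu⟩
    · exact ⟨[], by simp, by simp, by simp [perOn_empty]⟩
    obtain ⟨n, x, H, hx⟩ := exists_isCycleComp (G := G) (W := (W : Set V)) (u := u)
      (by simpa using hu) (by simpa using hclosed) (by simpa using hdeg)
    set C := (Finset.range n).image x with hC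
    have hCW : C ⊆ W := fun a ha => by
      obtain ⟨b, hb, rfl⟩ := Finset.mem_image.1 ha
      exact hx b (Finset.mem_range.1 hb)
    have hcard : C.card = n := by
      rw [hC, Finset.card_image_of_injOn, Finset.card_range]
      exact fun a ha b hb h => H.inj a b (by simpa using ha) (by simpa using hb) h
    have hCclosed : ∀ a ∈ C, ∀ b, G.Adj a b → b ∈ C := fun a ha b hab => by
      obtain ⟨k, hk, rfl⟩ := Finset.mem_image.1 ha
      obtain ⟨l, hl, rfl, _⟩ := (H.adj_iff k (Finset.mem_range.1 hk) b).1 hab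
      exact Finset.mem_image_of_mem x (Finset.mem_range.2 hl)
    have h3 := H.three_le
    have hle := Finset.card_le_card hCW
    obtain ⟨ks, hks, hsum, hper⟩ := ih _ (by rw [Finset.card_sdiff_of_subset hCW]; omega) (W \ C)
      (fun a ha b hab => by
        rw [Finset.mem_sdiff] at ha ⊢
        exact ⟨hclosed a ha.1 b hab, fun hb => ha.2 (hCclosed b hb a hab.symm)⟩)
      (fun a ha => hdeg a (Finset.mem_sdiff.1 ha).1) rfl
    refine ⟨n :: ks, ?_, ?_, ?_⟩
    · intro k hk
      rcases List.mem_cons.1 hk with rfl | hk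
      · exact h3
      · exact hks k hk
    · rw [List.sum_cons, hsum, Finset.card_sdiff_of_subset hCW]
      omega
    · rw [List.map_cons, List.prod_cons, ← hper, ← H.perOn (fun a ha => hdeg _ (hx a ha)) y, ← hC,
        ← perOn_union _ Finset.disjoint_sdiff (fun a ha b hb => ?_), Finset.union_sdiff_of_subset hCW]
      rw [Finset.mem_sdiff] at hb
      exact charEntry_not_adj G _ (fun h => hb.2 (h ▸ ha)) (fun h => hb.2 (hCclosed a ha b h))

section Chorded

variable {n j i : ℕ} {x : ℕ → V}

theorem IsChordedComp.degree_eq (H : IsChordedComp G n j i x) {a : ℕ} (ha : a < n) :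
    G.degree (x a) = if a = j ∨ a = i then 3 else 2 := by
  have := H.two_le_j
  have := H.j_le
  have := H.one_le_i
  have := H.i_le
  have := H.i_ne_j
  have himg : ∀ s : Finset ℕ, (∀ b, b ∈ s ↔ b < n ∧ ChordedAdj n j i a b) →
      G.degree (x a) = s.card := by
    intro s hs
    rw [← G.card_neighborFinset_eq_degree, ← Finset.card_image_of_injOn (s := s) (f := x)]
    · congr 1
      ext w
      rw [SimpleGraph.mem_neighborFinset, H.adj_iff a ha, Finset.mem_image]
      constructor
      · rintro ⟨b, hb, rfl, h⟩
        exact ⟨b, (hs b).2 ⟨hb, h⟩, rfl⟩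
      · rintro ⟨b, hb, rfl⟩
        exact ⟨b, ((hs b).1 hb).1, rfl, ((hs b).1 hb).2⟩
    · exact fun b hb c hc h => H.inj b c ((hs b).1 hb).1 ((hs c).1 hc).1 h
  split_ifs with h
  · have h0 : 1 ≤ a := by omega
    rcases h with rfl | rfl
    · rw [himg {a - 1, a + 1, 0} (fun b => by
        simp only [Finset.mem_insert, Finset.mem_singleton]; unfold ChordedAdj; omega)]
      exact Finset.card_eq_three.2 ⟨_, _, _, by omega, by omega, by omega, rfl⟩
    · rw [himg {a - 1, a + 1, n - 1} (fun b => by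
        simp only [Finset.mem_insert, Finset.mem_singleton]; unfold ChordedAdj; omega)]
      exact Finset.card_eq_three.2 ⟨_, _, _, by omega, by omega, by omega, rfl⟩
  · rcases Nat.eq_zero_or_pos a with rfl | h0
    · rw [himg {1, j} (fun b => by
        simp only [Finset.mem_insert, Finset.mem_singleton]; unfold ChordedAdj; omega)]
      exact Finset.card_pair (by omega)
    rcases eq_or_ne a (n - 1) with h1 | h1
    · rw [himg {a - 1, i} (fun b => by
        simp only [Finset.mem_insert, Finset.mem_singleton]; unfold ChordedAdj; omega)]
      exact Finset.card_pair (by omega)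
    · rw [himg {a - 1, a + 1} (fun b => by
        simp only [Finset.mem_insert, Finset.mem_singleton]; unfold ChordedAdj; omega)]
      exact Finset.card_pair (by omega)

theorem IsChordedComp.isChordedPath (H : IsChordedComp G n j i x) (y : R) :
    IsChordedPath (fun a b => G.charEntry (y + 2) (x a) (x b)) y n j i := by
  have := H.two_le_j
  have := H.j_le
  have := H.one_le_i
  have := H.i_le
  have := H.i_ne_j
  have hone : ∀ {a b}, a < n → b < n → ChordedAdj n j i a b →
      G.charEntry (y + 2) (x a) (x b) = -1 :=
    fun ha hb h => charEntry_adj G _ ((H.adj_iff' ha hb).2 h)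
  refine ⟨fun a b => charEntry_symm G _ _ _, fun a ha h1 h2 => ?_, ?_, ?_,
    fun a ha => hone (by omega) (by omega) (by unfold ChordedAdj; omega),
    hone (by omega) (by omega) (by unfold ChordedAdj; omega),
    hone (by omega) (by omega) (by unfold ChordedAdj; omega), fun a b h1 h2 h3 h4 =>
      charEntry_not_adj G _ (fun h => ?_) (fun h => ?_)⟩
  · rw [charEntry_self, H.degree_eq ha, if_neg (by omega)]
    push_cast; ring
  · rw [charEntry_self, H.degree_eq (by omega), if_pos (by omega)]
    push_cast; ring
  · rw [charEntry_self, H.degree_eq (by omega), if_pos (by omega)]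
    push_cast; ring
  · have := H.inj _ _ (by omega) (by omega) h
    omega
  · rw [H.adj_iff' (by omega) (by omega)] at h
    unfold ChordedAdj at h
    omega

theorem IsChordedComp.perOn_image (H : IsChordedComp G n j i x) (y : R) :
    perOn (G.charEntry (y + 2)) ((Finset.range n).image x)
      = perOn (fun a b => G.charEntry (y + 2) (x a) (x b)) (Finset.range n) :=
  _root_.perOn_image _
    (fun a ha b hb => H.inj a b (Finset.mem_range.1 ha) (Finset.mem_range.1 hb))

/-- The permanent of `(y + 2) I - Q(G)` splits into the factor of the component with chords and
the factors of the remaining cycles. -/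
theorem IsChordedComp.exists_perOn_univ (H : IsChordedComp G n j i x)
    (hdeg : ∀ v, v ≠ x j → v ≠ x i → G.degree v = 2) (y : R) :
    ∃ ks : List ℕ, (∀ k ∈ ks, 3 ≤ k) ∧ n + ks.sum = Fintype.card V ∧
      perOn (G.charEntry (y + 2)) Finset.univ
        = perOn (fun a b => G.charEntry (y + 2) (x a) (x b)) (Finset.range n)
          * (ks.map (cyclePer y y)).prod := by
  have h1 := H.j_le
  have h2 := H.i_le
  set C := (Finset.range n).image x with hC
  have hCclosed : ∀ a ∈ C, ∀ b, G.Adj a b → b ∈ C := fun a ha b hab => by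
    obtain ⟨k, hk, rfl⟩ := Finset.mem_image.1 ha
    obtain ⟨l, hl, rfl, _⟩ := (H.adj_iff k (Finset.mem_range.1 hk) b).1 hab
    exact Finset.mem_image_of_mem x (Finset.mem_range.2 hl)
  have hcard : C.card = n := by
    rw [hC, Finset.card_image_of_injOn, Finset.card_range]
    exact fun a ha b hb h => H.inj a b (by simpa using ha) (by simpa using hb) h
  have hmem : ∀ a < n, x a ∈ C := fun a ha => Finset.mem_image_of_mem x (Finset.mem_range.2 ha)
  obtain ⟨ks, hks, hsum, hper⟩ := exists_perOn_eq_prod_cyclePer (G := G) y Cᶜ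
    (fun a ha b hab => by
      rw [Finset.mem_compl] at ha ⊢
      exact fun hb => ha (hCclosed b hb a hab.symm))
    (fun a ha => by
      rw [Finset.mem_compl] at ha
      exact hdeg a (fun h => ha (h ▸ hmem j (by omega))) (fun h => ha (h ▸ hmem i (by omega))))
  refine ⟨ks, hks, ?_, ?_⟩
  · rw [hsum, ← hcard, Finset.card_add_card_compl]
  · rw [← hper, ← H.perOn_image, ← Finset.union_compl C]
    refine perOn_union _ disjoint_compl_right fun a ha b hb => ?_
    rw [Finset.mem_compl] at hb
    exact charEntry_not_adj G _ (fun h => hb (h ▸ ha)) (fun h => hb (hCclosed a ha b h))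

end Chorded

end Components

/-! ### The number of vertices and the first two degree moments from the reversed polynomial. -/

section DegreeSums

variable {V : Type*} [Fintype V] [DecidableEq V] (G : SimpleGraph V) [DecidableRel G.Adj]

/-- The entries of `I - X Q(G)`, where `Q(G)` is the signless Laplacian matrix. -/
noncomputable def SimpleGraph.revEntry (a b : V) : ℤ[X] :=
  if a = b then 1 - C (G.degree a : ℤ) * X else if G.Adj a b then -X else 0

theorem X_dvd_revEntry {a b : V} (h : a ≠ b) : X ∣ G.revEntry a b := by
  rw [SimpleGraph.revEntry, if_neg h]
  split_ifs
  · exact (dvd_refl X).neg_right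
  · exact dvd_zero X

/-- The three rows `v`, `a`, `b` all use off-diagonal entries, each divisible by `X`. Hence cycles
of length at least 3 do not affect the coefficients up to `X²`. -/
theorem X_pow_three_dvd_perThrough {S : Finset V} {v a b : V} (hv : v ∈ S) (ha : a ∈ S)
    (hb : b ∈ S) (hva : v ≠ a) (hvb : v ≠ b) (hab : a ≠ b) :
    X ^ 3 ∣ perThrough G.revEntry S v a b := by
  refine Finset.dvd_sum fun σ hσ => ?_
  obtain ⟨h1, h2⟩ := (Finset.mem_filter.1 hσ).2
  have hsub : ({v, a, b} : Finset V) ⊆ S := by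
    intro x hx
    simp only [Finset.mem_insert, Finset.mem_singleton] at hx
    rcases hx with rfl | rfl | rfl <;> assumption
  refine dvd_trans ?_ (Finset.prod_dvd_prod_of_subset _ _ _ hsub)
  rw [Finset.prod_insert (by simp [hva, hvb]), Finset.prod_pair hab, h1, h2, pow_succ', pow_two]
  exact mul_dvd_mul (X_dvd_revEntry G hva) (mul_dvd_mul (X_dvd_revEntry G (fun h => hva
    (σ.injective (h1.trans h)))) (X_dvd_revEntry G hvb.symm))

theorem X_dvd_perOn_revEntry_sub_one (S : Finset V) : X ∣ perOn G.revEntry S - 1 := by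
  induction S using Finset.induction_on with
  | empty => simp [perOn_empty]
  | insert v S hv ih =>
    rw [perOn_insert _ hv]
    have h1 : X ∣ ∑ w ∈ S, G.revEntry v w * G.revEntry w v * perOn G.revEntry (S.erase w) :=
      Finset.dvd_sum fun w hw => ((X_dvd_revEntry G
        (ne_of_mem_of_not_mem hw hv).symm).mul_right _).mul_right _
    have h2 : X ∣ ∑ a ∈ S, ∑ b ∈ S.erase a, perThrough G.revEntry (insert v S) v a b :=
      Finset.dvd_sum fun a ha => Finset.dvd_sum fun b hb =>
        (dvd_pow_self X (by norm_num)).trans (X_pow_three_dvd_perThrough G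
          (Finset.mem_insert_self _ _) (Finset.mem_insert_of_mem ha)
          (Finset.mem_insert_of_mem (Finset.mem_of_mem_erase hb)) (fun h => hv (h ▸ ha))
          (fun h => hv (h ▸ Finset.mem_of_mem_erase hb)) (Finset.ne_of_mem_erase hb).symm)
    have h3 : G.revEntry v v = 1 - C (G.degree v : ℤ) * X := if_pos rfl
    rw [h3]
    have h4 : X ∣ C (G.degree v : ℤ) * X * perOn G.revEntry S :=
      (dvd_mul_left X _).mul_right _
    have h5 := ((ih.sub h4).add h1).add h2
    convert h5 using 1
    ring

/-- The `X²` coefficient counts pairs of fixed points, giving the second elementary symmetric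
function `e` of the degrees, and transpositions along the `f` edges inside `S`. -/
theorem exists_perOn_revEntry_mod (S : Finset V) : ∃ e f : ℤ,
    2 * e = (∑ a ∈ S, (G.degree a : ℤ)) ^ 2 - ∑ a ∈ S, (G.degree a : ℤ) ^ 2 ∧
    2 * f = ∑ a ∈ S, ∑ b ∈ S, (if G.Adj a b then 1 else 0) ∧
    X ^ 3 ∣ perOn G.revEntry S
      - (1 - C (∑ a ∈ S, (G.degree a : ℤ)) * X + C (e + f) * X ^ 2) := by
  induction S using Finset.induction_on with
  | empty => exact ⟨0, 0, by simp, by simp, by simp [perOn_empty]⟩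
  | insert v S hv ih =>
    obtain ⟨e, f, he, hf, hd⟩ := ih
    have hvw : ∀ w ∈ S, v ≠ w := fun w hw h => hv (h ▸ hw)
    set σ := ∑ a ∈ S, (G.degree a : ℤ) with hσ
    set k := ∑ w ∈ S, (if G.Adj v w then (1 : ℤ) else 0) with hk
    refine ⟨e + σ * G.degree v, f + k, ?_, ?_, ?_⟩
    · rw [Finset.sum_insert hv, Finset.sum_insert hv, mul_add, he]
      ring
    · have h1 : ∑ a ∈ S, (if G.Adj a v then (1 : ℤ) else 0) = k :=
        Finset.sum_congr rfl fun a _ => by simp only [G.adj_comm a v]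
      rw [Finset.sum_insert hv, Finset.sum_insert hv]
      simp only [Finset.sum_insert hv, Finset.sum_add_distrib, SimpleGraph.irrefl, if_false]
      rw [h1, ← hk, mul_add, hf]
      ring
    · rw [perOn_insert _ hv, Finset.sum_insert hv, ← hσ]
      have h1 : X ^ 3 ∣ (∑ w ∈ S, G.revEntry v w * G.revEntry w v
          * perOn G.revEntry (S.erase w)) - C k * X ^ 2 := by
        rw [hk, map_sum, Finset.sum_mul, ← Finset.sum_sub_distrib]
        refine Finset.dvd_sum fun w hw => ?_
        rw [SimpleGraph.revEntry, SimpleGraph.revEntry, if_neg (hvw w hw), if_neg (hvw w hw).symm]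
        by_cases h : G.Adj v w
        · rw [if_pos h, if_pos h.symm, if_pos h]
          obtain ⟨g, hg⟩ := X_dvd_perOn_revEntry_sub_one G (S.erase w)
          refine ⟨g, ?_⟩
          rw [map_one]
          linear_combination X ^ 2 * hg
        · rw [if_neg h, if_neg h]
          simp
      have h2 : X ^ 3 ∣ ∑ a ∈ S, ∑ b ∈ S.erase a, perThrough G.revEntry (insert v S) v a b :=
        Finset.dvd_sum fun a ha => Finset.dvd_sum fun b hb => X_pow_three_dvd_perThrough G
          (Finset.mem_insert_self _ _) (Finset.mem_insert_of_mem ha)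
          (Finset.mem_insert_of_mem (Finset.mem_of_mem_erase hb)) (hvw a ha)
          (hvw b (Finset.mem_of_mem_erase hb)) (Finset.ne_of_mem_erase hb).symm
      have h3 : G.revEntry v v = 1 - C (G.degree v : ℤ) * X := if_pos rfl
      rw [h3]
      obtain ⟨g0, hg0⟩ := hd
      obtain ⟨g1, hg1⟩ := h1
      obtain ⟨g2, hg2⟩ := h2
      rw [hg2]
      refine ⟨(1 - C (G.degree v : ℤ) * X) * g0 + g1 + g2 - C (G.degree v : ℤ) * C (e + f), ?_⟩
      simp only [map_add, map_mul] at hg0 ⊢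
      linear_combination (1 - C (G.degree v : ℤ) * X) * hg0 + hg1

theorem exists_perOn_revEntry_univ_mod : ∃ t : ℤ,
    2 * t = (∑ a, (G.degree a : ℤ)) ^ 2 - ∑ a, (G.degree a : ℤ) ^ 2 + ∑ a, (G.degree a : ℤ) ∧
    X ^ 3 ∣ perOn G.revEntry Finset.univ
      - (1 - C (∑ a, (G.degree a : ℤ)) * X + C t * X ^ 2) := by
  obtain ⟨e, f, he, hf, hd⟩ := exists_perOn_revEntry_mod G Finset.univ
  refine ⟨e + f, ?_, hd⟩
  rw [mul_add, he, hf]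
  congr 1
  refine Finset.sum_congr rfl fun a _ => ?_
  rw [Finset.sum_boole, ← G.card_neighborFinset_eq_degree, SimpleGraph.neighborFinset_eq_filter]

theorem coeffs_eq_of_X_pow_three_dvd {a b c d : ℤ} {F : ℤ[X]}
    (h1 : X ^ 3 ∣ F - (1 - C a * X + C b * X ^ 2))
    (h2 : X ^ 3 ∣ F - (1 - C c * X + C d * X ^ 2)) : a = c ∧ b = d := by
  have h := X_pow_dvd_iff.1 (h1.sub h2)
  have e1 := h 1 (by norm_num)
  have e2 := h 2 (by norm_num)
  simp only [coeff_sub, coeff_add, coeff_C_mul, coeff_X, coeff_X_pow, coeff_one] at e1 e2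
  norm_num at e1 e2
  constructor <;> linarith

/-- `per(I - XQ) = X^n π(1/X)`, read in the fraction field where `1/X` makes sense. -/
theorem algebraMap_perOn_revEntry :
    algebraMap ℤ[X] (FractionRing ℤ[X]) (perOn G.revEntry Finset.univ)
      = algebraMap ℤ[X] (FractionRing ℤ[X]) X ^ Fintype.card V * G.signlessLapPermPoly.eval₂
        (Int.castRingHom _) (algebraMap ℤ[X] (FractionRing ℤ[X]) X)⁻¹ := by
  have hX : algebraMap ℤ[X] (FractionRing ℤ[X]) X ≠ 0 := by
    simp [X_ne_zero]
  rw [eval₂_signlessLapPermPoly, map_perOn, ← Finset.card_univ, pow_card_mul_perOn]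
  refine perOn_congr fun a _ b _ => ?_
  rw [SimpleGraph.revEntry, SimpleGraph.charEntry]
  by_cases h : a = b
  · rw [if_pos h, if_pos h, mul_sub, mul_inv_cancel₀ hX]
    simp [mul_comm]
  · rw [if_neg h, if_neg h]
    split_ifs <;> simp

theorem degree_sums_eq {V' : Type*} [Fintype V'] [DecidableEq V'] {G' : SimpleGraph V'}
    [DecidableRel G'.Adj] (h : G.signlessLapPermPoly = G'.signlessLapPermPoly) :
    Fintype.card V = Fintype.card V' ∧ ∑ a, (G.degree a : ℤ) = ∑ a, (G'.degree a : ℤ) ∧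
      ∑ a, (G.degree a : ℤ) ^ 2 = ∑ a, (G'.degree a : ℤ) ^ 2 := by
  set F := perOn G.revEntry Finset.univ with hF
  set F' := perOn G'.revEntry Finset.univ with hF'
  have hmul : X ^ Fintype.card V' * F = X ^ Fintype.card V * F' := by
    apply IsFractionRing.injective ℤ[X] (FractionRing ℤ[X])
    rw [map_mul, map_mul, hF, hF', algebraMap_perOn_revEntry, algebraMap_perOn_revEntry, h, map_pow,
      map_pow]
    ring
  -- Both reversed polynomials have constant term 1, so the powers of `X` in `hmul` must agree.
  have hcard : Fintype.card V = Fintype.card V' := by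
    have hn : ∀ {m n : ℕ} {F F' : ℤ[X]}, X ∣ F - 1 → X ^ m * F = X ^ n * F' → ¬ m < n := by
      intro m n F F' hd hm hmn
      obtain ⟨k, rfl⟩ := Nat.exists_eq_add_of_lt hmn
      rw [show m + k + 1 = m + (k + 1) by ring, pow_add, mul_assoc] at hm
      have h1 := mul_left_cancel₀ (pow_ne_zero m X_ne_zero) hm
      rw [h1, pow_succ', mul_assoc] at hd
      have h2 : (X : ℤ[X]) ∣ 1 := (dvd_sub_right (dvd_mul_right X _)).1 hd
      exact not_isUnit_X (isUnit_of_dvd_one h2)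
    have h1 := hn (X_dvd_perOn_revEntry_sub_one G Finset.univ) hmul
    have h2 := hn (X_dvd_perOn_revEntry_sub_one G' Finset.univ) hmul.symm
    omega
  have hFF : F = F' := by
    rw [hcard] at hmul
    exact mul_left_cancel₀ (pow_ne_zero _ X_ne_zero) hmul
  obtain ⟨t, ht, hd⟩ := exists_perOn_revEntry_univ_mod G
  obtain ⟨t', ht', hd'⟩ := exists_perOn_revEntry_univ_mod G'
  rw [← hF] at hd
  rw [← hF', ← hFF] at hd'
  obtain ⟨h1, h2⟩ := coeffs_eq_of_X_pow_three_dvd hd hd'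
  refine ⟨hcard, h1, ?_⟩
  rw [h2, ht', h1] at ht
  linarith

/-- The nonnegative integers `f a ^ 2 - f a` sum to 0, so `f` takes only the values 0 and 1. -/
theorem exists_two_of_sums {f : V → ℤ} (h1 : ∑ a, f a = 2) (h2 : ∑ a, f a ^ 2 = 2) :
    ∃ u v, u ≠ v ∧ f u = 1 ∧ f v = 1 ∧ ∀ a, a ≠ u → a ≠ v → f a = 0 := by
  have h3 : ∀ a ∈ Finset.univ, 0 ≤ f a ^ 2 - f a := fun a _ => by
    rcases le_or_gt (f a) 0 with h | h <;> nlinarith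
  have h4 : ∑ a, (f a ^ 2 - f a) = 0 := by rw [Finset.sum_sub_distrib, h1, h2, sub_self]
  have h5 : ∀ a, f a = if f a = 1 then 1 else 0 := fun a => by
    have h6 := (Finset.sum_eq_zero_iff_of_nonneg h3).1 h4 a (Finset.mem_univ a)
    have h7 : f a * (f a - 1) = 0 := by linarith
    rcases mul_eq_zero.1 h7 with h | h
    · simp [h]
    · rw [if_pos (by omega)]; omega
  rw [Finset.sum_congr rfl fun a _ => h5 a, Finset.sum_boole] at h1
  obtain ⟨u, v, huv, hs⟩ := Finset.card_eq_two.1 (by exact_mod_cast h1)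
  have hmem : ∀ a, f a = 1 ↔ a = u ∨ a = v := fun a => by
    have : a ∈ Finset.univ.filter (fun a => f a = 1) ↔ a ∈ ({u, v} : Finset V) := by rw [hs]
    simpa using this
  refine ⟨u, v, huv, (hmem u).2 (Or.inl rfl), (hmem v).2 (Or.inr rfl), fun a hu hv => ?_⟩
  rw [h5 a, if_neg]
  rw [hmem]
  tauto

end DegreeSums

/-! ### Reversal of chorded paths and isomorphism from equal parameters. -/

section Iso

variable {V V' : Type*} {G : SimpleGraph V} {G' : SimpleGraph V'} {n j i : ℕ} {x : ℕ → V}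

theorem IsChordedComp.reverse (H : IsChordedComp G n j i x) :
    IsChordedComp G n (n - 1 - i) (n - 1 - j) (fun k => x (n - 1 - k)) := by
  have h1 := H.two_le_j
  have h2 := H.j_le
  have h3 := H.one_le_i
  have h4 := H.i_le
  have h5 := H.i_ne_j
  refine ⟨by omega, by omega, by omega, by omega, by omega, fun a b ha hb h => ?_,
    fun a ha w => ?_⟩
  · have := H.inj _ _ (by omega) (by omega) h
    omega
  · rw [H.adj_iff _ (by omega)]
    constructor
    · rintro ⟨b, hb, rfl, h⟩
      refine ⟨n - 1 - b, by omega, by rw [show n - 1 - (n - 1 - b) = b by omega], ?_⟩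
      unfold ChordedAdj at h ⊢
      omega
    · rintro ⟨b, hb, rfl, h⟩
      refine ⟨n - 1 - b, by omega, rfl, ?_⟩
      unfold ChordedAdj at h ⊢
      omega

theorem IsChordedComp.bijective [Fintype V] (H : IsChordedComp G n j i x)
    (hn : Fintype.card V = n) : Function.Bijective (fun k : Fin n => x k) := by
  rw [Fintype.bijective_iff_injective_and_card]
  exact ⟨fun a b h => Fin.ext (H.inj _ _ a.2 b.2 h), by simp [hn]⟩

theorem IsChordedComp.nonempty_iso [Fintype V] [Fintype V'] {x' : ℕ → V'}
    (H : IsChordedComp G n j i x) (H' : IsChordedComp G' n j i x') (hn : Fintype.card V = n)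
    (hn' : Fintype.card V' = n) : Nonempty (G ≃g G') := by
  let e := Equiv.ofBijective _ (H.bijective hn)
  let e' := Equiv.ofBijective _ (H'.bijective hn')
  refine ⟨⟨e.symm.trans e', ?_⟩⟩
  intro a b
  obtain ⟨k, rfl⟩ := e.surjective a
  obtain ⟨l, rfl⟩ := e.surjective b
  rw [Equiv.trans_apply, Equiv.trans_apply, e.symm_apply_apply, e.symm_apply_apply]
  exact (H'.adj_iff' k.2 l.2).trans (H.adj_iff' k.2 l.2).symm

end Iso

/-! ### The graph `d(p,q,r)` as a chorded path with `j = p - 1` and `i = p + r - 2`. -/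

section DGraph

theorem cycleGraph_adj_iff {p : ℕ} (hp : 3 ≤ p) (u v : Fin p) :
    (SimpleGraph.cycleGraph p).Adj u v ↔ (v.val = u.val + 1 ∨ u.val = v.val + 1 ∨
      (u.val = 0 ∧ v.val = p - 1) ∨ (u.val = p - 1 ∧ v.val = 0)) := by
  have h : ∀ a b : Fin p, (a - b).val = 1 ↔ a.val = b.val + 1 ∨ (a.val = 0 ∧ b.val = p - 1) := by
    intro a b
    have ha := a.2
    have hb := b.2
    rcases le_or_gt b.val a.val with h | h
    · rw [Fin.sub_val_of_le h]; omega
    · rw [Fin.coe_sub_iff_lt.2 h]; omega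
  rw [SimpleGraph.cycleGraph_adj', h, h]
  omega

theorem map_shiftEmb_adj {m n s : ℕ} (hs : s + m ≤ n) (G : SimpleGraph (Fin m)) (a b : Fin n) :
    (G.map (SimpleGraph.shiftEmb s m n hs)).Adj a b ↔
      ∃ u v : Fin m, G.Adj u v ∧ s + u.val = a.val ∧ s + v.val = b.val := by
  rw [SimpleGraph.map_adj]
  simp only [SimpleGraph.shiftEmb, Fin.ext_iff]
  exact Iff.rfl

theorem dGraph_adj_iff {p q r : ℕ} (hp : 3 ≤ p) (hq : 3 ≤ q) (hr : 2 ≤ r)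
    (a b : Fin (p + q + r - 2)) : (SimpleGraph.dGraph p q r hp hq hr).Adj a b ↔
      ChordedAdj (p + q + r - 2) (p - 1) (p + r - 2) a.val b.val := by
  have ha := a.2
  have hb := b.2
  rw [SimpleGraph.dGraph, SimpleGraph.sup_adj, SimpleGraph.sup_adj, map_shiftEmb_adj,
    map_shiftEmb_adj, map_shiftEmb_adj]
  simp only [cycleGraph_adj_iff hp, cycleGraph_adj_iff hq, SimpleGraph.pathGraph_adj]
  unfold ChordedAdj
  constructor
  · rintro ((⟨u, v, h, h1, h2⟩ | ⟨u, v, h, h1, h2⟩) | ⟨u, v, h, h1, h2⟩) <;>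
      · have hu := u.2
        have hv := v.2
        omega
  · intro h
    by_cases h1 : a.val < p ∧ b.val < p
    · exact Or.inl (Or.inl ⟨⟨a.val, h1.1⟩, ⟨b.val, h1.2⟩, by dsimp only; omega,
        by dsimp only; omega, by dsimp only; omega⟩)
    by_cases h2 : p + r - 2 ≤ a.val ∧ p + r - 2 ≤ b.val
    · exact Or.inr ⟨⟨a.val - (p + r - 2), by omega⟩, ⟨b.val - (p + r - 2), by omega⟩,
        by dsimp only; omega, by dsimp only; omega, by dsimp only; omega⟩
    · exact Or.inl (Or.inr ⟨⟨a.val - (p - 1), by omega⟩, ⟨b.val - (p - 1), by omega⟩,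
        by dsimp only; omega, by dsimp only; omega, by dsimp only; omega⟩)

theorem exists_isChordedComp_dGraph {p q r : ℕ} (hp : 3 ≤ p) (hq : 3 ≤ q) (hr : 2 ≤ r) :
    ∃ x, IsChordedComp (SimpleGraph.dGraph p q r hp hq hr) (p + q + r - 2) (p - 1) (p + r - 2)
      x := by
  refine ⟨fun k => if h : k < p + q + r - 2 then ⟨k, h⟩ else ⟨0, by omega⟩, by omega, by omega,
    by omega, by omega, by omega, fun a b ha hb h => ?_, fun a ha w => ?_⟩
  · rw [dif_pos ha, dif_pos hb] at h
    exact Fin.mk.inj h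
  · rw [dif_pos ha, dGraph_adj_iff]
    constructor
    · intro h
      exact ⟨w.val, w.2, by rw [dif_pos w.2], h⟩
    · rintro ⟨b, hb, rfl, h⟩
      rwa [dif_pos hb]

end DGraph

/-! ### Degrees of a graph with the same polynomial. -/

section Degrees

variable {V : Type*} [Fintype V] [DecidableEq V] {G : SimpleGraph V} [DecidableRel G.Adj]
variable {n j i : ℕ} {x : ℕ → V}

theorem IsChordedComp.sum_degree (H : IsChordedComp G n j i x) (hn : Fintype.card V = n)
    (f : ℕ → ℤ) (h2 : f 2 = 0) (h3 : f 3 = 1) : ∑ v, f (G.degree v) = 2 := by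
  have e1 := H.j_le
  have e2 := H.i_le
  rw [← (H.bijective hn).sum_comp (fun v => f (G.degree v))]
  have : ∀ k : Fin n, f (G.degree (x k)) = if k.val = j ∨ k.val = i then 1 else 0 := fun k => by
    rw [H.degree_eq k.2]
    split_ifs <;> assumption
  rw [Finset.sum_congr rfl fun k _ => this k,
    Fin.sum_univ_eq_sum_range (fun k => if k = j ∨ k = i then (1 : ℤ) else 0), Finset.sum_boole]
  have hs : (Finset.range n).filter (fun k => k = j ∨ k = i) = {j, i} := by
    ext k
    simp only [Finset.mem_filter, Finset.mem_range, Finset.mem_insert, Finset.mem_singleton]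
    omega
  rw [hs, Finset.card_pair H.i_ne_j.symm]
  rfl

/-- A graph with the same signless Laplacian permanental polynomial as a bicyclic graph without
vertices of degree `1` is itself of degree `2` except at two vertices of degree `3`. -/
theorem exists_degrees {V' : Type*} [Fintype V'] [DecidableEq V'] {G' : SimpleGraph V'}
    [DecidableRel G'.Adj] (H : IsChordedComp G n j i x) (hn : Fintype.card V = n)
    (h : G'.signlessLapPermPoly = G.signlessLapPermPoly) :
    ∃ u v, u ≠ v ∧ G'.degree u = 3 ∧ G'.degree v = 3 ∧ ∀ a, a ≠ u → a ≠ v → G'.degree a = 2 := by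
  obtain ⟨hc, hs1, hs2⟩ := degree_sums_eq G' h
  have h1 := H.sum_degree hn (fun d => (d : ℤ) - 2) (by norm_num) (by norm_num)
  have h2 := H.sum_degree hn (fun d => ((d : ℤ) - 2) ^ 2) (by norm_num) (by norm_num)
  have h1' : ∑ v, ((G'.degree v : ℤ) - 2) = 2 := by
    refine Eq.trans ?_ h1
    rw [Finset.sum_sub_distrib, Finset.sum_sub_distrib, hs1]
    simp [hc]
  have e : ∀ d : ℤ, (d - 2) ^ 2 = d ^ 2 - 4 * (d - 2) - 4 := fun d => by ring
  have h2' : ∑ v, ((G'.degree v : ℤ) - 2) ^ 2 = 2 := by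
    refine Eq.trans ?_ h2
    rw [Finset.sum_congr rfl fun v _ => e (G'.degree v), Finset.sum_congr rfl fun v _ =>
      e (G.degree v), Finset.sum_sub_distrib, Finset.sum_sub_distrib, Finset.sum_sub_distrib,
      Finset.sum_sub_distrib, ← Finset.mul_sum, ← Finset.mul_sum, h1', h1, hs2]
    simp [hc]
  obtain ⟨u, v, huv, hu, hv, hd⟩ := exists_two_of_sums h1' h2'
  refine ⟨u, v, huv, by omega, by omega, fun a ha hb => ?_⟩
  have := hd a ha hb
  omega

end Degrees

/-! ### From the permanental polynomial to the normalised forms, and the conclusion. -/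

section Normalized

variable {V : Type*} [Fintype V] [DecidableEq V] {G : SimpleGraph V} [DecidableRel G.Adj]
variable {n j i : ℕ} {x : ℕ → V} {K : Type*} [Field K]

theorem prod_cyclePer_normalized {s : K} (hs : s ≠ 0) (h : 1 + s ^ 2 ≠ 0) (ks : List ℕ) :
    (-s) ^ ks.sum * (ks.map (cyclePer (-1 / s + s) (-1 / s + s))).prod
      = (ks.map (cycleForm s)).prod := by
  induction ks with
  | nil => simp
  | cons k ks ih =>
    rw [List.sum_cons, List.map_cons, List.map_cons, List.prod_cons, List.prod_cons, ← ih,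
      ← cyclePer_free_normalized hs h, pow_add]
    ring

/-- The normalised factor of a component with chords. -/
noncomputable def coreForm (n j i : ℕ) : ℤ[X] :=
  if j < i then dumbbellForm X (j + 1) (n - i) (i - j + 1)
  else thetaForm X (i + 1) (j - i) (n - j)

theorem IsChordedComp.perOn_normalized (H : IsChordedComp G n j i x) (f : ℤ[X] →+* K)
    (hs : f X ≠ 0) :
    (-f X) ^ n * (1 + f X ^ 2) ^ 3 * perOn (fun a b =>
      G.charEntry (-1 / f X + f X + 2) (x a) (x b)) (Finset.range n) = f (coreForm n j i) := by
  have h1 := H.two_le_j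
  have h2 := H.j_le
  have h3 := H.one_le_i
  have h4 := H.i_le
  have h5 := H.i_ne_j
  have hM := H.isChordedPath (-1 / f X + f X)
  rw [coreForm]
  split_ifs with h
  · rw [perOn_dumbbell hM h1 h (by omega), map_dumbbellForm,
      show i - j + 1 = (i - j - 1) + 2 by omega, ← dumbbellPer_normalized hs,
      show j + 1 + (n - i) + (i - j - 1) = n by omega]
  · rw [perOn_theta hM h3 (by omega) h2, map_thetaForm,
      show j - i = (j - i - 1) + 1 by omega, show n - j = (n - j - 1) + 1 by omega,
      ← thetaPer_normalized hs]
    simp only [Nat.add_sub_cancel]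
    rw [show i + (j - i - 1) + (n - j - 1) + 2 = n by omega]

theorem IsChordedComp.exists_form (H : IsChordedComp G n j i x)
    (hdeg : ∀ v, v ≠ x j → v ≠ x i → G.degree v = 2) (f : ℤ[X] →+* K) (hs : f X ≠ 0)
    (hs2 : 1 + f X ^ 2 ≠ 0) :
    ∃ ks : List ℕ, (∀ k ∈ ks, 3 ≤ k) ∧ n + ks.sum = Fintype.card V ∧
      (-f X) ^ Fintype.card V * (1 + f X ^ 2) ^ 3
        * G.signlessLapPermPoly.eval₂ (Int.castRingHom K) (-1 / f X + f X + 2)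
      = f (coreForm n j i * (ks.map (cycleForm (X : ℤ[X]))).prod) := by
  obtain ⟨ks, hks, hsum, hper⟩ := H.exists_perOn_univ hdeg (-1 / f X + f X)
  refine ⟨ks, hks, hsum, ?_⟩
  have hcyc : f (ks.map (cycleForm (X : ℤ[X]))).prod = (ks.map (cycleForm (f X))).prod := by
    rw [map_list_prod, List.map_map]
    congr 2
    funext k
    exact map_cycleForm f X k
  rw [eval₂_signlessLapPermPoly, hper, map_mul, hcyc, ← prod_cyclePer_normalized hs hs2,
    ← H.perOn_normalized f hs, ← hsum, pow_add]
  ring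

end Normalized

theorem theorem1p3 (p q r : ℕ) (hp : 3 ≤ p) (hq : 3 ≤ q) (hr : 2 ≤ r)
    {V : Type*} [Fintype V] [DecidableEq V] (G : SimpleGraph V) [DecidableRel G.Adj]
    (h : G.signlessLapPermPoly = (SimpleGraph.dGraph p q r hp hq hr).signlessLapPermPoly) :
    Nonempty (G ≃g SimpleGraph.dGraph p q r hp hq hr) := by
  obtain ⟨x', H'⟩ := exists_isChordedComp_dGraph hp hq hr
  have hn' : Fintype.card (Fin (p + q + r - 2)) = p + q + r - 2 := Fintype.card_fin _
  have hcard := (degree_sums_eq G h).1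
  obtain ⟨u, v, -, hu, hv, hdeg⟩ := exists_degrees H' hn' h
  obtain ⟨n, j, i, x, H, hx⟩ := exists_isChordedComp hu hv hdeg
  have hdx : ∀ w, w ≠ x j → w ≠ x i → G.degree w = 2 := fun w h1 h2 => by
    rcases hx with ⟨h3, h4⟩ | ⟨h3, h4⟩
    · exact hdeg w (h3 ▸ h1) (h4 ▸ h2)
    · exact hdeg w (h4 ▸ h2) (h3 ▸ h1)
  have hdx' : ∀ w, w ≠ x' (p - 1) → w ≠ x' (p + r - 2) →
      (SimpleGraph.dGraph p q r hp hq hr).degree w = 2 := fun w h1 h2 => by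
    obtain ⟨k, rfl⟩ := (H'.bijective hn').2 w
    dsimp only at h1 h2 ⊢
    rw [H'.degree_eq k.2, if_neg]
    rintro (h3 | h3)
    · exact h1 (by rw [h3])
    · exact h2 (by rw [h3])
  let f := algebraMap ℤ[X] (FractionRing ℤ[X])
  have hinj : Function.Injective f := IsFractionRing.injective ℤ[X] (FractionRing ℤ[X])
  have hs : f X ≠ 0 := (map_ne_zero_iff f hinj).2 X_ne_zero
  have hs2 : 1 + f X ^ 2 ≠ 0 := by
    rw [← map_one f, ← map_pow, ← map_add, map_ne_zero_iff f hinj]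
    intro h0
    simpa using congrArg (Polynomial.eval 0) h0
  obtain ⟨ks, hks, hsum, hF⟩ := H.exists_form hdx f hs hs2
  obtain ⟨ks', hks', hsum', hF'⟩ := H'.exists_form hdx' f hs hs2
  -- The chorded path already uses all vertices of `d(p,q,r)`.
  have hnil : ks' = [] := by
    rcases ks' with _ | ⟨k, l⟩
    · rfl
    · have := hks' k (by simp)
      rw [List.sum_cons] at hsum'
      omega
  rw [h, hcard, hF'] at hF
  have hform := hinj hF
  rw [hnil, List.map_nil, List.prod_nil, mul_one, coreForm, if_pos (by omega),
    show p - 1 + 1 = p by omega, show p + q + r - 2 - (p + r - 2) = q by omega,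
    show p + r - 2 - (p - 1) + 1 = r by omega, coreForm] at hform
  have h1 := H.two_le_j
  have h2 := H.j_le
  have h3 := H.one_le_i
  have h4 := H.i_le
  have h5 := H.i_ne_j
  rw [hcard, hn'] at hsum
  by_cases hji : j < i
  · rw [if_pos hji] at hform
    obtain ⟨rfl, e1, e2⟩ := dumbbell_of_dumbbellForm_eq hp hq hr (by omega) (by omega) (by omega)
      hks (by omega) hform
    rw [List.sum_nil, add_zero] at hsum
    subst hsum
    rcases e2 with e2 | e2
    · obtain rfl : j = p - 1 := by omega
      obtain rfl : i = p + r - 2 := by omega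
      exact H.nonempty_iso H' (by rw [hcard, hn']) hn'
    -- Traversing the path backwards exchanges the two cycles.
    · have Hr := H.reverse
      rw [show p + q + r - 2 - 1 - i = p - 1 by omega,
        show p + q + r - 2 - 1 - j = p + r - 2 by omega] at Hr
      exact Hr.nonempty_iso H' (by rw [hcard, hn']) hn'
  · rw [if_neg hji] at hform
    exact absurd hform (dumbbellForm_ne_thetaForm_mul' hp hq hr (by omega) (by omega) (by omega)
      hks (by omega))
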